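/- Let $X$ be an oriented $n$-dimensional smooth manifold, $i\colon Y\hookrightarrow X$ a closed submanifold (not necessarily orientable) of even codimension $m=2r$, and $\mu\colon X\to\mathbb R_{\ge 0}$ a nonnegative Morse--Bott function with zero set $Y$, that is, a smooth function vanishing exactly on $Y$ whose Hessian has rank $m$ at every point of $Y$. Differential forms and functions are complex valued, $C^\infty_X$ is the sheaf of smooth functions on $X$, $\mathcal A_Z$ is the de Rham complex of sheaves of smooth differential forms on a manifold $Z$, and $\mathrm{or}_Y$ is the orientation bundle of $Y$, so that $\mathrm{or}_Y\otimes\mathcal A_Y$ is the complex of forms on $Y$ twisted by $\mathrm{or}_Y$; top degree sections of it with compact support can be integrated over $Y$. The shift $[-m]$ means that the part of degree $p$ is $\mathrm{or}_Y\otimes\mathcal A_Y^{p-m}$ (zero for $p<m$), with differential $(-1)^m d$. Let $\mathcal A^{\mathrm{tame}}_{X,\mu}$ be the sheaf on $X$ whose sections over an open set $U$ are the smooth forms $\omega$ on $U\smallsetminus Y$ such that $\mu^r\omega$ and $\mu^{r-1}d\mu\wedge\omega$ extend to smooth forms on $U$. For a form $\omega$ of degree $n$ on $X\smallsetminus Y$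 such that $\mu^N\omega$ extends, for some $N$, to a smooth form with compact support on $X$, let $I_0(\mu,\omega)=\mathrm{res}_{s=0}\,\zeta(s;\mu,\omega)$, where $\zeta(s;\mu,\omega)$ is the meromorphic continuation to $\mathbb C$ (with at most a simple pole at $s=0$) of the integral $\int_X\mu^{s/2}\omega$, which converges absolutely for $\mathrm{Re}\,s$ large. Then there is a unique morphism of sheaves of graded $C^\infty_X$-modules $$R\colon \mathcal A_{X,\mu}^{\mathrm{tame}}\to i_*(\mathrm{or}_Y\otimes\mathcal A_{Y}[-m])$$ such that for all $p$, all $p$-forms $\omega\in\Gamma(X,\mathcal A_{X,\mu}^{\mathrm{tame}})$ and all smooth $(n-p)$-forms $\varphi$ with compact support on $X$, $$I_0(\mu,\omega\wedge\varphi)=\int_Y R(\omega)\wedge\varphi .$$ Moreover, $\mathcal A^{\mathrm{tame}}_{X,\mu}$ is closed under the de Rham differential and $R$ is a morphism of complexes of sheaves. -/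

import Mathlib

open Set Filter Topology MeasureTheory Manifold
open scoped ContDiff

noncomputable section

namespace TameResidue

/-! ### Exterior algebra

The tangent space `TangentSpace (𝓡 d) x` of a `d`-manifold is, by definition in Mathlib,
the model space `EuclideanSpace ℝ (Fin d)`, identified through the preferred chart
`chartAt _ x`.  Hence a (not necessarily continuous) complex valued differential `q`-form on a
manifold `Z` is a function `Z → Alt d q`. -/

/-- Alternating real `q`-linear forms on `E` with values in `F`. -/
abbrev AltForms (E F : Type) [NormedAddCommGroup E] [NormedSpace ℝ E] [NormedAddCommGroup F]
    [NormedSpace ℝ F] (q : ℕ) : Type :=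
  E [⋀^Fin q]→L[ℝ] F

/-- Complex valued alternating `q`-linear forms on a tangent space of a `d`-manifold. -/
abbrev Alt (d q : ℕ) : Type := AltForms (EuclideanSpace ℝ (Fin d)) ℂ q

/-- The multilinear form `(v₁, …, v_{p+q}) ↦ a (v₁, …, v_p) * b (v_{p+1}, …, v_{p+q})`. -/
def tensor {d p q : ℕ} (a : Alt d p) (b : Alt d q) :
    ContinuousMultilinearMap ℝ (fun _ : Fin (p + q) => EuclideanSpace ℝ (Fin d)) ℂ where
  toMultilinearMap := (LinearMap.mul' ℝ ℂ).compMultilinearMap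
    ((a.toAlternatingMap.toMultilinearMap.domCoprod
      b.toAlternatingMap.toMultilinearMap).domDomCongr finSumFinEquiv)
  cont := by
    have h : Continuous fun v : Fin (p + q) → EuclideanSpace ℝ (Fin d) =>
        a (fun j => v (Fin.castAdd q j)) * b (fun j => v (Fin.natAdd p j)) := by
      refine (a.cont.comp ?_).mul (b.cont.comp ?_) <;> fun_prop
    exact h

/-- The value of `tensor a b`. -/
theorem tensor_apply {d p q : ℕ} (a : Alt d p) (b : Alt d q)
    (v : Fin (p + q) → EuclideanSpace ℝ (Fin d)) :
    tensor a b v = a (fun j => v (Fin.castAdd q j)) * b (fun j => v (Fin.natAdd p j)) := rfl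

/-- The wedge product `a ∧ b`, with the normalization for which
`(a ∧ b) v` is the signed sum over all `(p, q)`-shuffles. -/
def wedge {d p q : ℕ} (a : Alt d p) (b : Alt d q) : Alt d (p + q) :=
  ((Nat.factorial p : ℂ) * (Nat.factorial q : ℂ))⁻¹ •
    ContinuousMultilinearMap.alternatization (tensor a b)

theorem tensor_add {d p q : ℕ} (a : Alt d p) (b b' : Alt d q) :
    tensor a (b + b') = tensor a b + tensor a b' := by
  ext v
  simp [tensor_apply, mul_add]

theorem tensor_smul {d p q : ℕ} (c : ℂ) (a : Alt d p) (b : Alt d q) :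
    tensor a (c • b) = c • tensor a b := by
  ext v
  simp [tensor_apply, mul_left_comm]

theorem wedge_add {d p q : ℕ} (a : Alt d p) (b b' : Alt d q) :
    wedge a (b + b') = wedge a b + wedge a b' := by
  simp only [wedge, tensor_add, map_add, smul_add]

theorem wedge_smul {d p q : ℕ} (c : ℂ) (a : Alt d p) (b : Alt d q) :
    wedge a (c • b) = c • wedge a b := by
  ext v
  simp only [wedge, tensor_smul, ContinuousAlternatingMap.smul_apply,
    ContinuousMultilinearMap.alternatization_apply_apply, _root_.smul_apply]
  rw [smul_comm c]
  congr 1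
  rw [Finset.smul_sum]
  exact Finset.sum_congr rfl fun σ _ => smul_comm _ _ _

/-! ### Differential forms and forms twisted by the orientation bundle

Let `Z` be a `d`-manifold. A section over an open set `W ⊆ Z` is represented by its extension
by zero to `Z`; restriction of sections is then multiplication by an indicator function. The sets
`W`, `W'` below are meant to be open. -/

section Forms

variable {d : ℕ} {Z : Type*} [TopologicalSpace Z]
  [ChartedSpace (EuclideanSpace ℝ (Fin d)) Z] [IsManifold (𝓡 d) ∞ Z]

/-- The expression, in the chart at `x₀`, of a differential form `w` (that is, the pull-back of
`w` by the inverse of the chart at `x₀`). The linear map `tangentCoordChange (𝓡 d) x₀ x x` is the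
derivative of the inverse of the chart at `x₀`, as a map to `TangentSpace (𝓡 d) x`. -/
def localRep {q : ℕ} (x₀ : Z) (w : Z → Alt d q) (y : EuclideanSpace ℝ (Fin d)) : Alt d q :=
  (w ((extChartAt (𝓡 d) x₀).symm y)).compContinuousLinearMap
    (tangentCoordChange (𝓡 d) x₀ ((extChartAt (𝓡 d) x₀).symm y) ((extChartAt (𝓡 d) x₀).symm y))

/-- The transition function of the orientation bundle of `Z`, from the frame of the chart
at `x₀` to the frame of the preferred chart at `x`, at the point `x`: the sign of the
Jacobian determinant. -/
def frameSign (d : ℕ) {Z : Type*} [TopologicalSpace Z]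
    [ChartedSpace (EuclideanSpace ℝ (Fin d)) Z] [IsManifold (𝓡 d) ∞ Z] (x₀ x : Z) : ℝ :=
  Real.sign (tangentCoordChange (𝓡 d) x₀ x x).det

/-- The expression in the chart at `x₀` of a form `β` with values in the orientation bundle of
`Z`. The orientation bundle is the real line bundle whose transition functions are the signs of
the Jacobian determinants of the changes of charts; the value `β x` is written in the frame
of the preferred chart at `x`. -/
def twistedRep {q : ℕ} (x₀ : Z) (β : Z → Alt d q) (y : EuclideanSpace ℝ (Fin d)) : Alt d q :=
  frameSign d x₀ ((extChartAt (𝓡 d) x₀).symm y) • localRep x₀ β y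

/-- The part of the image of the chart at `x₀` that corresponds to `W`. -/
def chartDomain (d : ℕ) {Z : Type*} [TopologicalSpace Z]
    [ChartedSpace (EuclideanSpace ℝ (Fin d)) Z] [IsManifold (𝓡 d) ∞ Z] (W : Set Z) (x₀ : Z) :
    Set (EuclideanSpace ℝ (Fin d)) :=
  (extChartAt (𝓡 d) x₀).target ∩ (extChartAt (𝓡 d) x₀).symm ⁻¹' W

theorem localRep_add {q : ℕ} (x₀ : Z) (w η : Z → Alt d q) :
    localRep x₀ (w + η) = localRep x₀ w + localRep x₀ η := rfl

theorem localRep_zero {q : ℕ} (x₀ : Z) : localRep x₀ (0 : Z → Alt d q) = 0 := rfl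

theorem localRep_smul {q : ℕ} (x₀ : Z) (f : Z → ℂ) (w : Z → Alt d q) :
    localRep x₀ (fun x => f x • w x)
      = fun y => f ((extChartAt (𝓡 d) x₀).symm y) • localRep x₀ w y := rfl

theorem localRep_const_smul {q : ℕ} (x₀ : Z) (c : ℂ) (w : Z → Alt d q) :
    localRep x₀ (c • w) = c • localRep x₀ w := rfl

theorem twistedRep_add {q : ℕ} (x₀ : Z) (w η : Z → Alt d q) :
    twistedRep x₀ (w + η) = twistedRep x₀ w + twistedRep x₀ η := by
  funext y
  simp only [twistedRep, localRep_add, Pi.add_apply, smul_add]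

theorem twistedRep_zero {q : ℕ} (x₀ : Z) : twistedRep x₀ (0 : Z → Alt d q) = 0 := by
  funext y
  simp only [twistedRep, localRep_zero, Pi.zero_apply, smul_zero]

theorem twistedRep_const_smul {q : ℕ} (x₀ : Z) (c : ℂ) (w : Z → Alt d q) :
    twistedRep x₀ (c • w) = c • twistedRep x₀ w := by
  funext y
  simp only [twistedRep, localRep_const_smul, Pi.smul_apply]
  rw [smul_comm]

/-- The sections over `W` of the sheaf of smooth complex valued differential `q`-forms. -/
def formSections (d : ℕ) {Z : Type*} [TopologicalSpace Z]
    [ChartedSpace (EuclideanSpace ℝ (Fin d)) Z] [IsManifold (𝓡 d) ∞ Z] (W : Set Z) (q : ℕ) :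
    Submodule ℂ (Z → Alt d q) where
  carrier := {w | (∀ x, x ∉ W → w x = 0) ∧
    ∀ x₀ : Z, ContDiffOn ℝ ∞ (localRep x₀ w) (chartDomain d W x₀)}
  add_mem' := by
    rintro a b ⟨ha, ha'⟩ ⟨hb, hb'⟩
    refine ⟨fun x hx => by simp [ha x hx, hb x hx], fun x₀ => ?_⟩
    rw [localRep_add]
    exact (ha' x₀).add (hb' x₀)
  zero_mem' := ⟨fun _ _ => rfl, fun x₀ => by
    rw [localRep_zero]
    exact contDiffOn_const⟩
  smul_mem' := by
    rintro c a ⟨ha, ha'⟩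
    refine ⟨fun x hx => by simp [ha x hx], fun x₀ => ?_⟩
    rw [localRep_const_smul]
    exact (ha' x₀).const_smul c

/-- The sections over `W` of the sheaf of smooth complex valued differential `q`-forms with
values in the orientation bundle. -/
def twistedSections (d : ℕ) {Z : Type*} [TopologicalSpace Z]
    [ChartedSpace (EuclideanSpace ℝ (Fin d)) Z] [IsManifold (𝓡 d) ∞ Z] (W : Set Z) (q : ℕ) :
    Submodule ℂ (Z → Alt d q) where
  carrier := {β | (∀ x, x ∉ W → β x = 0) ∧
    ∀ x₀ : Z, ContDiffOn ℝ ∞ (twistedRep x₀ β) (chartDomain d W x₀)}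
  add_mem' := by
    rintro a b ⟨ha, ha'⟩ ⟨hb, hb'⟩
    refine ⟨fun x hx => by simp [ha x hx, hb x hx], fun x₀ => ?_⟩
    rw [twistedRep_add]
    exact (ha' x₀).add (hb' x₀)
  zero_mem' := ⟨fun _ _ => rfl, fun x₀ => by
    rw [twistedRep_zero]
    exact contDiffOn_const⟩
  smul_mem' := by
    rintro c a ⟨ha, ha'⟩
    refine ⟨fun x hx => by simp [ha x hx], fun x₀ => ?_⟩
    rw [twistedRep_const_smul]
    exact (ha' x₀).const_smul c

/-- The de Rham differential of a form over `W`, computed at `x` in the preferred chart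
at `x`. -/
def dForm {q : ℕ} (W : Set Z) (w : Z → Alt d q) : Z → Alt d (q + 1) :=
  W.indicator fun x => extDeriv (localRep x w) (extChartAt (𝓡 d) x x)

/-- The de Rham differential of a form over `W` with values in the (flat) orientation bundle. -/
def dTwisted {q : ℕ} (W : Set Z) (β : Z → Alt d q) : Z → Alt d (q + 1) :=
  W.indicator fun x => extDeriv (twistedRep x β) (extChartAt (𝓡 d) x x)

theorem indicator_mem_formSections {q : ℕ} {W W' : Set Z} (h : W' ⊆ W) {w : Z → Alt d q}
    (hw : w ∈ formSections d W q) : W'.indicator w ∈ formSections d W' q := by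
  refine ⟨fun x hx => indicator_of_notMem hx _, fun x₀ => ?_⟩
  refine ((hw.2 x₀).mono (inter_subset_inter_right _ (preimage_mono h))).congr ?_
  intro y hy
  have hy' : (extChartAt (𝓡 d) x₀).symm y ∈ W' := hy.2
  unfold localRep
  rw [indicator_of_mem hy']

theorem smul_mem_formSections {q : ℕ} {W : Set Z} {f : Z → ℂ}
    (hf : ContMDiffOn (𝓡 d) 𝓘(ℝ, ℂ) ∞ f W) {w : Z → Alt d q}
    (hw : w ∈ formSections d W q) : (fun x => f x • w x) ∈ formSections d W q := by
  refine ⟨fun x hx => by simp [hw.1 x hx], fun x₀ => ?_⟩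
  rw [localRep_smul]
  refine ContDiffOn.fun_smul ?_ (hw.2 x₀)
  have h := (contMDiffOn_iff.1 hf).2 x₀ (f x₀)
  refine (h.mono ?_)
  intro y hy
  refine ⟨hy.1, hy.2, ?_⟩
  rw [mem_preimage, extChartAt_source]
  exact mem_univ _

/-! ### Orientations and integration -/

/-- An orientation of the `d`-manifold `Z`: a continuous section of the orientation bundle
with values `± 1`, i.e. at every point `x` one of the two orientations of the tangent space,
`sgn x = 1` meaning the orientation for which the preferred chart at `x` preserves
orientations, such that in every chart the orientation is locally constant. -/
structure ManifoldOrientation (d : ℕ) (Z : Type*) [TopologicalSpace Z]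
    [ChartedSpace (EuclideanSpace ℝ (Fin d)) Z] [IsManifold (𝓡 d) ∞ Z] where
  sgn : Z → ℝ
  sgn_eq : ∀ x, sgn x = 1 ∨ sgn x = -1
  continuous_sgn : ∀ x₀ : Z,
    ContinuousOn (fun x => frameSign d x₀ x * sgn x) (chartAt (EuclideanSpace ℝ (Fin d)) x₀).source

section Integration

variable [T2Space Z] [SigmaCompactSpace Z]

/-- A smooth partition of unity subordinate to the domains of the preferred charts. -/
def chartPartition (d : ℕ) (Z : Type*) [TopologicalSpace Z]
    [ChartedSpace (EuclideanSpace ℝ (Fin d)) Z] [IsManifold (𝓡 d) ∞ Z] [T2Space Z]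
    [SigmaCompactSpace Z] : SmoothPartitionOfUnity Z (𝓡 d) Z univ :=
  Classical.choose (SmoothPartitionOfUnity.exists_isSubordinate_chartAt_source (𝓡 d) Z)

theorem chartPartition_isSubordinate :
    (chartPartition d Z).IsSubordinate
      (fun x => (chartAt (EuclideanSpace ℝ (Fin d)) x).source) :=
  Classical.choose_spec (SmoothPartitionOfUnity.exists_isSubordinate_chartAt_source (𝓡 d) Z)

/-- For a top degree form `τ` with values in the orientation bundle (a density), the
coefficient of `dy₁ ⋯ dy_d` in the expression of `ρ τ` in the chart at `x₀`, where `ρ` is the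
member with index `x₀` of the partition of unity. -/
def densityPiece {q : ℕ} (τ : Z → Alt d q) (h : q = d) (x₀ : Z)
    (y : EuclideanSpace ℝ (Fin d)) : ℂ :=
  (chartPartition d Z x₀ ((extChartAt (𝓡 d) x₀).symm y) : ℂ) *
    twistedRep x₀ τ y (fun j => EuclideanSpace.single (Fin.cast h j) (1 : ℝ))

/-- Absolute integrability of the pieces of a density. -/
def DensityIntegrable {q : ℕ} (τ : Z → Alt d q) (h : q = d) : Prop :=
  ∀ x₀ : Z, IntegrableOn (densityPiece τ h x₀) (extChartAt (𝓡 d) x₀).target volume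

/-- The integral over `Z` of a top degree form with values in the orientation bundle (with
compact support, so that the sum below is finite). -/
def densityIntegral {q : ℕ} (τ : Z → Alt d q) (h : q = d) : ℂ :=
  ∑ᶠ x₀ : Z, ∫ y in (extChartAt (𝓡 d) x₀).target, densityPiece τ h x₀ y

/-- The density `μ ^ (s / 2) w` attached to a top degree form `w` on an oriented manifold. -/
def zetaDensity {q : ℕ} (o : ManifoldOrientation d Z) (μ : Z → ℝ) (w : Z → Alt d q) (s : ℂ) :
    Z → Alt d q :=
  fun x => ((o.sgn x : ℂ) * (μ x : ℂ) ^ (s / 2)) • w x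

/-- `HasI0 o μ w h c` means that `I₀(μ, w)` is defined and equal to `c`: the integral
`∫ μ ^ (s / 2) w` converges absolutely if the real part of `s` is large, it has a meromorphic
continuation `ζ` to the complex plane, the pole of `ζ` at `0` is at most simple, and
the residue of `ζ` at `0` is `c`. The form `w` of top degree is defined off the zero set of `μ`,
and extended by zero. -/
def HasI0 {q : ℕ} (o : ManifoldOrientation d Z) (μ : Z → ℝ) (w : Z → Alt d q) (h : q = d)
    (c : ℂ) : Prop :=
  ∃ (ζ : ℂ → ℂ) (a : ℝ), Meromorphic ζ ∧
    (∀ s : ℂ, a < s.re → DensityIntegrable (zetaDensity o μ w s) h ∧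
      ζ s = densityIntegral (zetaDensity o μ w s) h) ∧
    Tendsto (fun s => s * ζ s) (𝓝[≠] 0) (𝓝 c)

end Integration

/-! ### Morse–Bott functions and tame singularities -/

/-- `μ` is a nonnegative Morse–Bott function with zero set `S`, a submanifold of codimension
`m`: a smooth function with values in `[0, ∞)` vanishing exactly on `S` and whose Hessian
(the second derivative in a chart) has rank `m` at every point of `S`. -/
structure IsMorseBott (d : ℕ) {Z : Type*} [TopologicalSpace Z]
    [ChartedSpace (EuclideanSpace ℝ (Fin d)) Z] [IsManifold (𝓡 d) ∞ Z]
    (μ : Z → ℝ) (S : Set Z) (m : ℕ) : Prop where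
  smooth : ContMDiff (𝓡 d) 𝓘(ℝ, ℝ) ∞ μ
  nonneg : ∀ x, 0 ≤ μ x
  eq_zero_iff : ∀ x, μ x = 0 ↔ x ∈ S
  rank_hessian : ∀ x ∈ S, Module.finrank ℝ (LinearMap.range
    (fderiv ℝ (fderiv ℝ (μ ∘ (extChartAt (𝓡 d) x).symm))
      (extChartAt (𝓡 d) x x)).toLinearMap) = m

/-- The differential `dμ` at `x`, as an alternating form of degree one. -/
def differential (μ : Z → ℝ) (x : Z) : Alt d 1 :=
  ContinuousAlternatingMap.ofSubsingleton ℝ (EuclideanSpace ℝ (Fin d)) ℂ (0 : Fin 1)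
    (Complex.ofRealCLM.comp (mfderiv (𝓡 d) 𝓘(ℝ, ℝ) μ x : EuclideanSpace ℝ (Fin d) →L[ℝ] ℝ))

/-- `ExtendsSmoothly W S η`: the form `η` on `W \ S` is the restriction of a smooth form
on `W`. -/
def ExtendsSmoothly {q : ℕ} (W S : Set Z) (η : Z → Alt d q) : Prop :=
  ∃ ψ ∈ formSections d W q, ∀ x ∈ W \ S, ψ x = η x

theorem ExtendsSmoothly.add {q : ℕ} {W S : Set Z} {η η' : Z → Alt d q}
    (h : ExtendsSmoothly W S η) (h' : ExtendsSmoothly W S η') :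
    ExtendsSmoothly W S (fun x => η x + η' x) := by
  obtain ⟨ψ, hψ, e⟩ := h
  obtain ⟨ψ', hψ', e'⟩ := h'
  exact ⟨ψ + ψ', add_mem hψ hψ', fun x hx => by rw [Pi.add_apply, e x hx, e' x hx]⟩

theorem ExtendsSmoothly.const_smul {q : ℕ} {W S : Set Z} {η : Z → Alt d q} (c : ℂ)
    (h : ExtendsSmoothly W S η) : ExtendsSmoothly W S (fun x => c • η x) := by
  obtain ⟨ψ, hψ, e⟩ := h
  exact ⟨c • ψ, Submodule.smul_mem _ c hψ, fun x hx => by rw [Pi.smul_apply, e x hx]⟩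

theorem ExtendsSmoothly.smul {q : ℕ} {W S : Set Z} {η : Z → Alt d q}
    {f : Z → ℂ} (hf : ContMDiffOn (𝓡 d) 𝓘(ℝ, ℂ) ∞ f W)
    (h : ExtendsSmoothly W S η) : ExtendsSmoothly W S (fun x => f x • η x) := by
  obtain ⟨ψ, hψ, e⟩ := h
  exact ⟨_, smul_mem_formSections hf hψ, fun x hx => by rw [e x hx]⟩

theorem ExtendsSmoothly.restrict {q : ℕ} {W W' S : Set Z} (hW : W' ⊆ W) {η η' : Z → Alt d q}
    (h : ExtendsSmoothly W S η) (he : ∀ x ∈ W' \ S, η' x = η x) :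
    ExtendsSmoothly W' S η' := by
  obtain ⟨ψ, hψ, e⟩ := h
  exact ⟨_, indicator_mem_formSections hW hψ, fun x hx => by
    rw [indicator_of_mem hx.1, e x ⟨hW hx.1, hx.2⟩, he x hx]⟩

/-- The sections over `W` of the sheaf of `p`-forms with tame singularities along `S` (of
codimension `2 r`): smooth forms `w` on `W \ S` such that `μ ^ r w` and `μ ^ (r - 1) dμ ∧ w`
extend to smooth forms on `W`. -/
def tameSections (d : ℕ) {Z : Type*} [TopologicalSpace Z]
    [ChartedSpace (EuclideanSpace ℝ (Fin d)) Z] [IsManifold (𝓡 d) ∞ Z]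
    (μ : Z → ℝ) (S : Set Z) (r : ℕ) (W : Set Z) (p : ℕ) : Submodule ℂ (Z → Alt d p) where
  carrier := {w | w ∈ formSections d (W \ S) p ∧
    ExtendsSmoothly W S (fun x => (μ x : ℂ) ^ r • w x) ∧
    ExtendsSmoothly W S (fun x => (μ x : ℂ) ^ ((r : ℤ) - 1) • wedge (differential μ x) (w x))}
  add_mem' := by
    rintro a b ⟨h₁, h₂, h₃⟩ ⟨k₁, k₂, k₃⟩
    refine ⟨add_mem h₁ k₁, ?_, ?_⟩
    · simpa only [Pi.add_apply, smul_add] using h₂.add k₂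
    · simpa only [Pi.add_apply, wedge_add, smul_add] using h₃.add k₃
  zero_mem' := by
    refine ⟨zero_mem _, ⟨0, zero_mem _, fun x _ => by simp⟩, ⟨0, zero_mem _, fun x _ => ?_⟩⟩
    have : wedge (differential μ x) (0 : Alt d p) = 0 := by
      simpa using wedge_smul 0 (differential μ x) (0 : Alt d p)
    simp only [Pi.zero_apply, this, smul_zero]
  smul_mem' := by
    rintro c a ⟨h₁, h₂, h₃⟩
    refine ⟨Submodule.smul_mem _ c h₁, ?_, ?_⟩
    · simpa only [Pi.smul_apply, smul_comm c] using h₂.const_smul c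
    · simpa only [Pi.smul_apply, wedge_smul, smul_comm c] using h₃.const_smul c

theorem smul_mem_tameSections {μ : Z → ℝ} {S : Set Z} {r : ℕ}
    {W : Set Z} {p : ℕ} {f : Z → ℂ} (hf : ContMDiffOn (𝓡 d) 𝓘(ℝ, ℂ) ∞ f W) {w : Z → Alt d p}
    (hw : w ∈ tameSections d μ S r W p) :
    (fun x => f x • w x) ∈ tameSections d μ S r W p := by
  obtain ⟨h₁, h₂, h₃⟩ := hw
  refine ⟨smul_mem_formSections (hf.mono sdiff_subset) h₁, ?_, ?_⟩
  · have := h₂.smul hf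
    simp only [smul_comm (f _)] at this
    exact this
  · have := h₃.smul hf
    simpa only [smul_comm (f _), wedge_smul] using this

theorem indicator_mem_tameSections {μ : Z → ℝ} {S : Set Z} {r : ℕ}
    {W W' : Set Z} (h : W' ⊆ W) {p : ℕ} {w : Z → Alt d p}
    (hw : w ∈ tameSections d μ S r W p) : W'.indicator w ∈ tameSections d μ S r W' p := by
  obtain ⟨h₁, h₂, h₃⟩ := hw
  refine ⟨?_, h₂.restrict h fun x hx => by rw [indicator_of_mem hx.1],
    h₃.restrict h fun x hx => by rw [indicator_of_mem hx.1]⟩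
  have e : W'.indicator w = (W' \ S).indicator w := by
    funext x
    by_cases hx : x ∈ W'
    · by_cases hS : x ∈ S
      · rw [indicator_of_mem hx, indicator_of_notMem (fun hh => hh.2 hS),
          h₁.1 x fun hh => hh.2 hS]
      · rw [indicator_of_mem hx, indicator_of_mem (show x ∈ W' \ S from ⟨hx, hS⟩)]
    · rw [indicator_of_notMem hx, indicator_of_notMem fun hh => hx hh.1]
  rw [e]
  exact indicator_mem_formSections (sdiff_subset_sdiff_left h) h₁

end Forms

/-! ### Morphisms from tame forms to shifted twisted forms on the submanifold

`X` is an `n`-manifold, `Y` a `k`-manifold, `i : Y → X` the inclusion of a submanifold of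
codimension `2 r`. -/

section Residue

variable {n k : ℕ} {X Y : Type*} [TopologicalSpace X]
  [ChartedSpace (EuclideanSpace ℝ (Fin n)) X] [IsManifold (𝓡 n) ∞ X] [TopologicalSpace Y]
  [ChartedSpace (EuclideanSpace ℝ (Fin k)) Y] [IsManifold (𝓡 k) ∞ Y]

/-- The pull-back of a differential form by `i`. -/
def pullback {q : ℕ} (i : Y → X) (φ : X → Alt n q) (y : Y) : Alt k q :=
  (φ (i y)).compContinuousLinearMap
    (mfderiv (𝓡 k) (𝓡 n) i y : EuclideanSpace ℝ (Fin k) →L[ℝ] EuclideanSpace ℝ (Fin n))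

/-- The sections over `W` of the degree `p` part of the complex of twisted forms shifted by
`-m`: twisted forms of degree `q` with `q + m = p` (so this module is zero if `p < m`, and
otherwise there is only one `q`). -/
abbrev ShiftedSections (k : ℕ) {Y : Type*} [TopologicalSpace Y]
    [ChartedSpace (EuclideanSpace ℝ (Fin k)) Y] [IsManifold (𝓡 k) ∞ Y]
    (W : Set Y) (m p : ℕ) : Type _ :=
  (q : {q : ℕ // q + m = p}) → twistedSections k W q

/-- The differential `(-1) ^ m d` of the shifted complex, from degree `p` to
degree `p + 1`. -/
def shiftedD {W : Set Y} {m p : ℕ} (β : ShiftedSections k W m p) :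
    (q : {q : ℕ // q + m = p + 1}) → Y → Alt k q
  | ⟨0, _⟩ => 0
  | ⟨q + 1, h⟩ => (-1 : ℂ) ^ m • dTwisted W (β ⟨q, by omega⟩ : Y → Alt k q)

/-- A morphism of sheaves of graded modules over the sheaf of smooth complex valued functions
on `X`, from the sheaf of forms with tame singularities along `i Y` to the push-forward by `i`
of the complex of forms on `Y` with values in the orientation bundle, shifted
by `-2 r`. -/
@[ext]
structure TameMorphism (i : Y → X) (μ : X → ℝ) (r : ℕ) where
  /-- The map on sections of degree `p` over the open set `U`. -/
  app : ∀ (p : ℕ) (U : TopologicalSpace.Opens X),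
    tameSections n μ (range i) r (U : Set X) p →ₗ[ℂ]
      ShiftedSections k (i ⁻¹' (U : Set X)) (2 * r) p
  /-- Compatibility with restriction. -/
  app_restrict : ∀ (p : ℕ) (U V : TopologicalSpace.Opens X) (h : V ≤ U)
    (w : tameSections n μ (range i) r (U : Set X) p) (q : {q : ℕ // q + 2 * r = p}),
    (app p V ⟨(V : Set X).indicator w.1, indicator_mem_tameSections h w.2⟩ q : Y → Alt k q)
      = (i ⁻¹' (V : Set X)).indicator (app p U w q : Y → Alt k q)
  /-- Linearity over the smooth functions on `U`. -/
  app_smul : ∀ (p : ℕ) (U : TopologicalSpace.Opens X) (f : X → ℂ)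
    (hf : ContMDiffOn (𝓡 n) 𝓘(ℝ, ℂ) ∞ f (U : Set X))
    (w : tameSections n μ (range i) r (U : Set X) p) (q : {q : ℕ // q + 2 * r = p}),
    (app p U ⟨fun x => f x • w.1 x, smul_mem_tameSections hf w.2⟩ q : Y → Alt k q)
      = fun y => f (i y) • (app p U w q : Y → Alt k q) y

/-- The integral over `Y` of `β ∧ φ|_Y`, for `β` of degree `p` in the shifted complex of twisted
forms and `φ` a form of degree `l = n - p` on `X`. -/
def integralWedge [T2Space Y] [SigmaCompactSpace Y] {W : Set Y}
    {m p l : ℕ} (i : Y → X) (β : ShiftedSections k W m p) (φ : X → Alt n l)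
    (h : p + l = k + m) : ℂ :=
  if hp : m ≤ p then
    densityIntegral
      (fun y => wedge ((β ⟨p - m, Nat.sub_add_cancel hp⟩ : Y → Alt k (p - m)) y)
        (pullback i φ y)) (show p - m + l = k by omega)
  else 0

/-- The residue formula: `I₀(μ, w ∧ φ) = ∫_Y R(w) ∧ φ` for all global tame `p`-forms `w` and all
smooth `(n - p)`-forms `φ` with compact support on `X`. -/
def TameMorphism.IsResidue [T2Space X] [SigmaCompactSpace X]
    [T2Space Y] [SigmaCompactSpace Y] {i : Y → X} {μ : X → ℝ} {r : ℕ}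
    (R : TameMorphism (n := n) (k := k) i μ r) (o : ManifoldOrientation n X)
    (hn : n = k + 2 * r) : Prop :=
  ∀ (p l : ℕ) (h : p + l = n)
    (w : tameSections n μ (range i) r ((⊤ : TopologicalSpace.Opens X) : Set X) p)
    (φ : X → Alt n l), φ ∈ formSections n univ l → HasCompactSupport φ →
      HasI0 o μ (fun x => wedge (w.1 x) (φ x)) h
        (integralWedge i (R.app p ⊤ w) φ (h.trans hn))

/-- `R` is a morphism of complexes: on each open set `U`, the differential of a tame form is
tame, and `R` commutes with the differentials. -/
def TameMorphism.IsComplexMorphism {i : Y → X} {μ : X → ℝ} {r : ℕ}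
    (R : TameMorphism (n := n) (k := k) i μ r) : Prop :=
  ∀ (p : ℕ) (U : TopologicalSpace.Opens X)
    (w : tameSections n μ (range i) r (U : Set X) p),
    ∃ h : dForm ((U : Set X) \ range i) w.1 ∈ tameSections n μ (range i) r (U : Set X) (p + 1),
      ∀ (q : {q : ℕ // q + 2 * r = p + 1}),
        (R.app (p + 1) U ⟨_, h⟩ q : Y → Alt k q) = shiftedD (R.app p U w) q

end Residue

end TameResidue

end

/-!
The proof is by local computation in coordinates adapted to `μ`, together with a uniqueness
statement that allows the local results to be glued.

*Coordinates.* By the Morse lemma with parameters, near every point of `Y` there are charts in which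
`Y` is `0 × ℝᵏ` in `ℝᵐ × ℝᵏ` and `μ (x, y) = ‖x‖²` (`exists_morse_coordinates`,
`exists_isMorseChart`).

*Residue formula.* Let `ψ` and `χ` be the smooth extensions of `μ ^ r ω` and `μ ^ (r - 1) dμ ∧ ω`.
In such a chart, the density of `μ ^ (s / 2) ω ∧ φ` is `‖x‖ ^ (s - m) a (x, y)`, where `a` is the
smooth density of `ψ ∧ φ`. In polar coordinates its integral is a Mellin transform, and integration
by parts gives the meromorphic continuation, with residue `vol (S ^ (m - 1)) ∫ a (0, y) dy` at `s =
0` (`exists_meromorphic_integral_norm_fst_cpow`). The relation `dμ ∧ ψ = μ χ` implies, after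
restriction to lines normal to `Y`, that `dxₐ ∧ ψ = 0` at the points of `Y` for all normal
coordinates `xₐ`. Thus `ψ` is divisible by `dx₁ ∧ … ∧ dxₘ` there, and `a (0, y)` only depends on the
pull-back of `φ` to `Y`: it is the density of the product of this pull-back with the form obtained
by plugging the normal basis vectors into `ψ` (`wedge_append_eq_wedge_contract`,
`IsMorseChart.hasResidueOn`). The sign of the chart of `X` with respect to the orientation turns the
contracted form into a form twisted by the orientation bundle of `Y`. Off `Y`, the integral is an
entire function of `s`, so that there is no residue (`hasResidueOn_zero`).

*Uniqueness and gluing.* Test forms supported near a point of `Y` determine the value of a residue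
at this point (`HasResidueOn.unique`). Hence local residues glue to sections (`exists_residue`), and
taking residues is linear over smooth functions and compatible with restrictions, which gives the
morphism (`residueMorphism`). Multiplying by bump functions shows that every tame form is locally
the restriction of a global one, so that a morphism is determined by the residue formula
(`TameMorphism.eq_of_app_top`, `TameMorphism.IsResidue.eq`).

*Differential.* The form `dψ - r χ` extends `μ ^ r dω`, and differentiating once more gives the
extension of `μ ^ (r - 1) dμ ∧ dω` (`IsTameExtension.chartD`). Differentiating `dμ ∧ ψ = μ χ` in the
normal directions shows that contraction with the normal vectors carries `dψ - r χ` to the exterior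
derivative of the contraction of `ψ` (`IsTamePair.extDeriv_normalContract`). As the codimension is
even, no signs occur.

In codimension zero, `Y` is open in `X`; sections are extended by zero to `Y` and the residue is
zero.
-/

set_option linter.unusedSectionVars false

noncomputable section

namespace TameResidue

/-! ### Exterior algebra: the wedge product -/

instance finiteDimensional_alt (d q : ℕ) : FiniteDimensional ℝ (Alt d q) := by
  let f : Alt d q →ₗ[ℝ] MultilinearMap ℝ (fun _ : Fin q => EuclideanSpace ℝ (Fin d)) ℂ :=
    { toFun := fun a => a.toAlternatingMap.toMultilinearMap
      map_add' := fun _ _ => rfl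
      map_smul' := fun _ _ => rfl }
  refine Module.Finite.of_injective f fun a b h => ?_
  ext v
  exact congrArg (fun g : MultilinearMap ℝ _ ℂ => g v) h

theorem wedge_apply {d p q : ℕ} (a : Alt d p) (b : Alt d q)
    (v : Fin (p + q) → EuclideanSpace ℝ (Fin d)) :
    wedge a b v = ((Nat.factorial p : ℂ) * (Nat.factorial q : ℂ))⁻¹ *
      ∑ σ : Equiv.Perm (Fin (p + q)), ((Equiv.Perm.sign σ : ℤ) : ℂ) *
        (a (fun j => v (σ (Fin.castAdd q j))) * b (fun j => v (σ (Fin.natAdd p j)))) := by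
  rw [wedge, ContinuousAlternatingMap.smul_apply,
    ContinuousMultilinearMap.alternatization_apply_apply, smul_eq_mul]
  congr 1
  refine Finset.sum_congr rfl fun σ _ => ?_
  rw [tensor_apply, Units.smul_def, zsmul_eq_mul]
  rfl

/-- The wedge product as a sum over the permutations of a disjoint union. -/
theorem wedge_apply_sum {d p q : ℕ} (a : Alt d p) (b : Alt d q)
    (v : Fin p ⊕ Fin q → EuclideanSpace ℝ (Fin d)) :
    wedge a b (v ∘ finSumFinEquiv.symm) = ((Nat.factorial p : ℂ) * (Nat.factorial q : ℂ))⁻¹ *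
      ∑ σ : Equiv.Perm (Fin p ⊕ Fin q), ((Equiv.Perm.sign σ : ℤ) : ℂ) *
        (a (fun j => v (σ (Sum.inl j))) * b (fun j => v (σ (Sum.inr j)))) := by
  rw [wedge_apply]
  congr 1
  refine (Fintype.sum_equiv (finSumFinEquiv (m := p) (n := q)).permCongr _ _ fun σ => ?_).symm
  rw [Equiv.Perm.sign_permCongr]
  simp [Equiv.permCongr_apply]

theorem add_wedge {d p q : ℕ} (a a' : Alt d p) (b : Alt d q) :
    wedge (a + a') b = wedge a b + wedge a' b := by
  ext v
  simp only [wedge_apply, ContinuousAlternatingMap.add_apply, add_mul, mul_add,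
    Finset.sum_add_distrib]

theorem smul_wedge {d p q : ℕ} (c : ℂ) (a : Alt d p) (b : Alt d q) :
    wedge (c • a) b = c • wedge a b := by
  ext v
  simp only [wedge_apply, ContinuousAlternatingMap.smul_apply, smul_eq_mul, Finset.mul_sum]
  exact Finset.sum_congr rfl fun σ _ => by ring

theorem real_smul_wedge {d p q : ℕ} (c : ℝ) (a : Alt d p) (b : Alt d q) :
    wedge (c • a) b = c • wedge a b := by
  have := smul_wedge (c : ℂ) a b
  simpa only [Complex.coe_smul] using this

theorem wedge_real_smul {d p q : ℕ} (c : ℝ) (a : Alt d p) (b : Alt d q) :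
    wedge a (c • b) = c • wedge a b := by
  have := wedge_smul (c : ℂ) a b
  simpa only [Complex.coe_smul] using this

theorem zero_wedge {d p q : ℕ} (b : Alt d q) : wedge (0 : Alt d p) b = 0 := by
  simpa using smul_wedge 0 (0 : Alt d p) b

theorem wedge_zero {d p q : ℕ} (a : Alt d p) : wedge a (0 : Alt d q) = 0 := by
  simpa using wedge_smul 0 a (0 : Alt d q)

/-- Pull-back by a linear map is multiplicative. -/
theorem wedge_compContinuousLinearMap {d d' p q : ℕ} (a : Alt d p) (b : Alt d q)
    (g : EuclideanSpace ℝ (Fin d') →L[ℝ] EuclideanSpace ℝ (Fin d)) :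
    wedge (a.compContinuousLinearMap g) (b.compContinuousLinearMap g)
      = (wedge a b).compContinuousLinearMap g := by
  ext v
  simp only [wedge_apply, ContinuousAlternatingMap.compContinuousLinearMap_apply]
  rfl

/-- The complexification of a real linear form, as an alternating form of degree one. -/
def oneForm {d : ℕ} (a : EuclideanSpace ℝ (Fin d) →L[ℝ] ℝ) : Alt d 1 :=
  ContinuousAlternatingMap.ofSubsingleton ℝ (EuclideanSpace ℝ (Fin d)) ℂ (0 : Fin 1)
    (Complex.ofRealCLM.comp a)

theorem oneForm_apply {d : ℕ} (a : EuclideanSpace ℝ (Fin d) →L[ℝ] ℝ)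
    (v : Fin 1 → EuclideanSpace ℝ (Fin d)) : oneForm a v = (a (v 0) : ℂ) := rfl

/-- The wedge product with a linear form, by expansion along the position of the argument
of the linear form. -/
theorem wedge_oneForm_apply {d p : ℕ} (a : EuclideanSpace ℝ (Fin d) →L[ℝ] ℝ) (w : Alt d p)
    (v : Fin (p + 1) → EuclideanSpace ℝ (Fin d)) :
    wedge (oneForm a) w (v ∘ Fin.cast (add_comm 1 p))
      = ∑ i : Fin (p + 1), (-1 : ℂ) ^ (i : ℕ) * ((a (v i) : ℂ) * w (i.removeNth v)) := by
  -- Both sides are proportional to the alternatization of `a ⊗ w`; the right-hand side is already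
  -- alternating, so its own alternatization only multiplies it by `(p + 1)!`.
  let f : EuclideanSpace ℝ (Fin d) →L[ℝ] Alt d p := (Complex.ofRealCLM.comp a).smulRight w
  have hB : ∀ u : Fin (p + 1) → EuclideanSpace ℝ (Fin d),
      ContinuousAlternatingMap.alternatizeUncurryFin f u
        = ∑ i : Fin (p + 1), (-1 : ℂ) ^ (i : ℕ) * ((a (u i) : ℂ) * w (i.removeNth u)) := by
    intro u
    rw [ContinuousAlternatingMap.alternatizeUncurryFin_apply]
    refine Finset.sum_congr rfl fun i _ => ?_
    simp [f, zsmul_eq_mul]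
  set B := ContinuousAlternatingMap.alternatizeUncurryFin f with hBdef
  rw [← hB]
  let T : (Fin (p + 1) → EuclideanSpace ℝ (Fin d)) → ℂ :=
    fun u => (a (u 0) : ℂ) * w (fun j => u j.succ)
  have hT : ∀ u, B u = ∑ i : Fin (p + 1), ((Equiv.Perm.sign (Fin.cycleRange i)⁻¹ : ℤ) : ℂ) *
      T (u ∘ ((Fin.cycleRange i)⁻¹ : Equiv.Perm _)) := by
    intro u
    rw [hB]
    refine Finset.sum_congr rfl fun i _ => ?_
    rw [Equiv.Perm.sign_inv, Fin.sign_cycleRange]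
    have h0 : (Fin.cycleRange i)⁻¹ 0 = i := by
      rw [Equiv.Perm.inv_eq_iff_eq, Fin.cycleRange_self]
    have h1 : ∀ j : Fin p, (Fin.cycleRange i)⁻¹ j.succ = i.succAbove j := by
      intro j
      rw [Equiv.Perm.inv_eq_iff_eq, Fin.cycleRange_succAbove]
    simp only [T, Function.comp_apply, h0, h1]
    push_cast
    rfl
  have hsum : ∀ u, ∑ σ : Equiv.Perm (Fin (p + 1)), ((Equiv.Perm.sign σ : ℤ) : ℂ) * B (u ∘ σ)
      = ((p + 1 : ℕ) : ℂ) *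
        ∑ σ : Equiv.Perm (Fin (p + 1)), ((Equiv.Perm.sign σ : ℤ) : ℂ) * T (u ∘ σ) := by
    intro u
    simp only [hT, Finset.mul_sum]
    rw [Finset.sum_comm]
    have : ∀ i : Fin (p + 1), ∑ σ : Equiv.Perm (Fin (p + 1)), ((Equiv.Perm.sign σ : ℤ) : ℂ) *
        (((Equiv.Perm.sign (Fin.cycleRange i)⁻¹ : ℤ) : ℂ) *
          T ((u ∘ σ) ∘ ((Fin.cycleRange i)⁻¹ : Equiv.Perm _)))
        = ∑ σ : Equiv.Perm (Fin (p + 1)), ((Equiv.Perm.sign σ : ℤ) : ℂ) * T (u ∘ σ) := by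
      intro i
      refine Fintype.sum_equiv (Equiv.mulRight (Fin.cycleRange i)⁻¹) _ _ fun σ => ?_
      rw [Equiv.coe_mulRight, Equiv.Perm.sign_mul, Units.val_mul, Int.cast_mul, mul_assoc]
      rfl
    rw [Finset.sum_congr rfl fun i _ => this i]
    simp [Finset.sum_const, Finset.mul_sum]
  have hsum' : ∀ u, ∑ σ : Equiv.Perm (Fin (p + 1)), ((Equiv.Perm.sign σ : ℤ) : ℂ) * B (u ∘ σ)
      = ((p + 1).factorial : ℂ) * B u := by
    intro u
    have : ∀ σ : Equiv.Perm (Fin (p + 1)),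
        ((Equiv.Perm.sign σ : ℤ) : ℂ) * B (u ∘ σ) = B u := by
      intro σ
      have h := B.toAlternatingMap.map_perm u σ
      simp only [ContinuousAlternatingMap.coe_toAlternatingMap] at h
      rw [h, Units.smul_def, zsmul_eq_mul, ← mul_assoc, ← Int.cast_mul]
      simp
    rw [Finset.sum_congr rfl fun σ _ => this σ]
    simp [Fintype.card_perm]
  have key : ((p.factorial : ℂ)) * B v
      = ∑ σ : Equiv.Perm (Fin (p + 1)), ((Equiv.Perm.sign σ : ℤ) : ℂ) * T (v ∘ σ) := by
    have h := (hsum' v).symm.trans (hsum v)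
    rw [Nat.factorial_succ, Nat.cast_mul, mul_assoc] at h
    exact mul_left_cancel₀ (by exact_mod_cast Nat.succ_ne_zero p) h
  have hp : (p.factorial : ℂ) ≠ 0 := by exact_mod_cast p.factorial_ne_zero
  rw [wedge_apply, Nat.factorial_one, Nat.cast_one, one_mul, inv_mul_eq_iff_eq_mul₀ hp, key]
  refine Fintype.sum_equiv (finCongr (add_comm 1 p)).permCongr _ _ fun σ => ?_
  rw [Equiv.Perm.sign_permCongr]
  congr 2
  · congr 1
    funext j
    simp only [Function.comp_apply, Equiv.permCongr_apply]
    congr 3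
    ext
    simp [add_comm]

/-- Contracting `a ∧ w = 0` with a vector on which `a` is `1`. -/
theorem apply_eq_zero_of_wedge_oneForm_eq_zero {d p : ℕ}
    {a : EuclideanSpace ℝ (Fin d) →L[ℝ] ℝ} {w : Alt d p} (h : wedge (oneForm a) w = 0)
    {x : EuclideanSpace ℝ (Fin d)} (hx : a x = 1) {v : Fin p → EuclideanSpace ℝ (Fin d)}
    (hv : ∀ j, a (v j) = 0) : w v = 0 := by
  have h1 := wedge_oneForm_apply a w (Fin.cons x v)
  rw [h, Fin.sum_univ_succ] at h1
  simpa [hx, hv] using h1.symm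

theorem alt_comp_perm {d p : ℕ} {ι : Type*} (a : Alt d p) (v : ι → EuclideanSpace ℝ (Fin d))
    (g : Fin p → ι) (σ : Equiv.Perm (Fin p)) :
    a (fun j => v (g (σ j))) = ((Equiv.Perm.sign σ : ℤ) : ℂ) * a (fun j => v (g j)) := by
  have h := a.toAlternatingMap.map_perm (fun j => v (g j)) σ
  simp only [ContinuousAlternatingMap.coe_toAlternatingMap] at h
  rw [Units.smul_def, zsmul_eq_mul] at h
  exact h

theorem append_update_right {α : Type*} {m q : ℕ} (v : Fin m → α) (u : Fin q → α) (i : Fin q)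
    (z : α) : Fin.append v (Function.update u i z)
      = Function.update (Fin.append v u) (Fin.natAdd m i) z := by
  funext j
  refine Fin.addCases (fun j => ?_) (fun j => ?_) j
  · rw [Fin.append_left, Function.update_of_ne (by
      intro h; have := congrArg Fin.val h; simp at this; omega), Fin.append_left]
  · rw [Fin.append_right]
    by_cases hj : j = i
    · subst hj; simp
    · rw [Function.update_of_ne hj, Function.update_of_ne (by simpa using hj),
        Fin.append_right]

/-- Contraction of the first `m` arguments of a `p`-form with the vectors `v`. -/
def contract {d m q p : ℕ} (h : m + q = p) (v : Fin m → EuclideanSpace ℝ (Fin d)) (w : Alt d p) :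
    Alt d q where
  toFun u := w fun j => Fin.append v u (Fin.cast h.symm j)
  map_update_add' u i x y := by
    subst h
    rename_i inst
    rw [Subsingleton.elim inst (instDecidableEqFin q)]
    simp only [append_update_right]
    exact w.map_update_add _ _ _ _
  map_update_smul' u i c x := by
    subst h
    rename_i inst
    rw [Subsingleton.elim inst (instDecidableEqFin q)]
    simp only [append_update_right]
    exact w.map_update_smul _ _ _ _
  map_eq_zero_of_eq' u i j hu hij := by
    subst h
    refine w.map_eq_zero_of_eq _ (i := Fin.natAdd m i) (j := Fin.natAdd m j) ?_ (by simpa using hij)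
    simpa using hu
  cont := by
    refine w.cont.comp (continuous_pi fun j => ?_)
    subst h
    refine Fin.addCases (fun j => ?_) (fun j => ?_) j
    · simpa using continuous_const
    · simpa using continuous_apply j

theorem contract_apply {d m q p : ℕ} (h : m + q = p) (v : Fin m → EuclideanSpace ℝ (Fin d))
    (w : Alt d p) (u : Fin q → EuclideanSpace ℝ (Fin d)) :
    contract h v w u = w fun j => Fin.append v u (Fin.cast h.symm j) := rfl

/-- `contract` as a continuous linear map. -/
def contractCLM {d m q p : ℕ} (h : m + q = p) (v : Fin m → EuclideanSpace ℝ (Fin d)) :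
    Alt d p →L[ℝ] Alt d q :=
  LinearMap.toContinuousLinearMap
    { toFun := contract h v
      map_add' := fun _ _ => rfl
      map_smul' := fun _ _ => rfl }

/-- The sum over the permutations of a disjoint union that fix the first summand. -/
theorem sum_perm_fixing_inl {A B : Type*} [Fintype A] [Fintype B] [DecidableEq A] [DecidableEq B]
    (G : Equiv.Perm (A ⊕ B) → ℂ) :
    ∑ ρ : Equiv.Perm (A ⊕ B), (if ∀ a, ρ (Sum.inl a) = Sum.inl a then G ρ else 0)
      = ∑ τ : Equiv.Perm B, G (Equiv.Perm.sumCongr 1 τ) := by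
  rw [← Finset.sum_filter]
  symm
  refine Finset.sum_bij (fun τ _ => Equiv.Perm.sumCongr 1 τ) ?_ ?_ ?_ ?_
  · intro τ _
    simp
  · intro τ _ τ' _ h
    ext b
    have := congrArg (fun g : Equiv.Perm (A ⊕ B) => g (Sum.inr b)) h
    simpa using this
  · intro ρ hρ
    rw [Finset.mem_filter] at hρ
    obtain ⟨⟨ρ₁, ρ₂⟩, rfl⟩ := Equiv.Perm.mem_sumCongrHom_range_of_perm_mapsTo_inl (σ := ρ) (by
      rintro _ ⟨a, rfl⟩
      exact ⟨a, (hρ.2 a).symm⟩)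
    refine ⟨ρ₂, Finset.mem_univ _, ?_⟩
    ext x
    rcases x with a | b
    · simpa using (hρ.2 a).symm
    · simp
  · intro τ _
    rfl

/-- Let `F` be a function on the permutations of `(M ⊔ Q) ⊔ L` that is invariant under the
permutations of `M ⊔ Q` on the right and vanishes at `σ` unless the preimage of `M` under `σ` is
contained in `M ⊔ Q`. Then the sum of `F` reduces to the permutations that fix `M`. -/
theorem sum_perm_eq_sum_perm_fixing {M Q L : Type*} [Fintype M] [Fintype Q] [Fintype L]
    [DecidableEq M] [DecidableEq Q] [DecidableEq L]
    (F : Equiv.Perm ((M ⊕ Q) ⊕ L) → ℂ)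
    (hF : ∀ σ (ρ : Equiv.Perm (M ⊕ Q)), F (σ * Equiv.Perm.sumCongr ρ 1) = F σ)
    (hF0 : ∀ σ, (∃ a : M, ∀ z : M ⊕ Q, σ (Sum.inl z) ≠ Sum.inl (Sum.inl a)) → F σ = 0) :
    ((Fintype.card Q).factorial : ℂ) * ∑ σ, F σ = ((Fintype.card (M ⊕ Q)).factorial : ℂ) *
      ∑ τ : Equiv.Perm (Q ⊕ L), F ((Equiv.sumAssoc M Q L).symm.permCongr
        (Equiv.Perm.sumCongr 1 τ)) := by
  let P : Equiv.Perm ((M ⊕ Q) ⊕ L) → Prop :=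
    fun σ => ∀ a : M, σ (Sum.inl (Sum.inl a)) = Sum.inl (Sum.inl a)
  -- Sum `F (σ (ρ ⊔ 1))` over the pairs for which `σ (ρ ⊔ 1)` fixes `M`, in both orders.
  have e1 : ∑ ρ : Equiv.Perm (M ⊕ Q), ∑ σ : Equiv.Perm ((M ⊕ Q) ⊕ L),
      (if P (σ * Equiv.Perm.sumCongr ρ 1) then F (σ * Equiv.Perm.sumCongr ρ 1) else 0)
      = ((Fintype.card (M ⊕ Q)).factorial : ℂ) *
      ∑ τ : Equiv.Perm (Q ⊕ L), F ((Equiv.sumAssoc M Q L).symm.permCongr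
        (Equiv.Perm.sumCongr 1 τ)) := by
    have : ∀ ρ : Equiv.Perm (M ⊕ Q), ∑ σ : Equiv.Perm ((M ⊕ Q) ⊕ L),
        (if P (σ * Equiv.Perm.sumCongr ρ 1) then F (σ * Equiv.Perm.sumCongr ρ 1) else 0)
        = ∑ τ : Equiv.Perm (Q ⊕ L), F ((Equiv.sumAssoc M Q L).symm.permCongr
        (Equiv.Perm.sumCongr 1 τ)) := by
      intro ρ
      rw [← sum_perm_fixing_inl (A := M) (B := Q ⊕ L) fun σ =>
        F ((Equiv.sumAssoc M Q L).symm.permCongr σ)]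
      refine (Fintype.sum_equiv (Equiv.mulRight (Equiv.Perm.sumCongr ρ 1)) _
        (fun σ => if P σ then F σ else 0) fun σ => rfl).trans ?_
      refine (Fintype.sum_equiv (Equiv.sumAssoc M Q L).symm.permCongr _ _ fun σ => ?_).symm
      refine if_congr ?_ rfl rfl
      refine forall_congr' fun a => ?_
      simp only [Equiv.permCongr_apply, Equiv.symm_symm, Equiv.sumAssoc_apply_inl_inl]
      rw [Equiv.symm_apply_eq, Equiv.sumAssoc_apply_inl_inl]
    rw [Finset.sum_congr rfl fun ρ _ => this ρ, Finset.sum_const, Finset.card_univ,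
      Fintype.card_perm, nsmul_eq_mul]
  have e2 : ∀ σ : Equiv.Perm ((M ⊕ Q) ⊕ L), ∑ ρ : Equiv.Perm (M ⊕ Q),
      (if P (σ * Equiv.Perm.sumCongr ρ 1) then F (σ * Equiv.Perm.sumCongr ρ 1) else 0)
      = ((Fintype.card Q).factorial : ℂ) * F σ := by
    intro σ
    simp only [hF]
    by_cases h0 : ∃ a : M, ∀ z : M ⊕ Q, σ (Sum.inl z) ≠ Sum.inl (Sum.inl a)
    · simp [hF0 σ h0]
    push Not at h0
    choose z hz using h0
    have hzi : Function.Injective z := by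
      intro a b hab
      have := (hz a).symm.trans (hab ▸ hz b)
      simpa using this
    -- A permutation of `M ⊔ Q` that extends the injection `z`.
    obtain ⟨ρ₀, hρ₀⟩ : ∃ ρ₀ : Equiv.Perm (M ⊕ Q), ∀ a, ρ₀ (Sum.inl a) = z a := by
      let e : {x : M ⊕ Q // x ∈ range (Sum.inl : M → M ⊕ Q)} ≃ {x : M ⊕ Q // x ∈ range z} :=
        (Equiv.ofInjective _ Sum.inl_injective).symm.trans (Equiv.ofInjective z hzi)
      refine ⟨e.extendSubtype, fun a => ?_⟩
      rw [Equiv.extendSubtype_apply_of_mem e (Sum.inl a) ⟨a, rfl⟩]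
      have : (⟨Sum.inl a, ⟨a, rfl⟩⟩ : {x : M ⊕ Q // x ∈ range (Sum.inl : M → M ⊕ Q)})
          = Equiv.ofInjective _ Sum.inl_injective a := rfl
      rw [this, Equiv.trans_apply, Equiv.symm_apply_apply]
      rfl
    rw [← Equiv.sum_comp (Equiv.mulLeft ρ₀)]
    have hiff : ∀ ρ : Equiv.Perm (M ⊕ Q), P (σ * Equiv.Perm.sumCongr (ρ₀ * ρ) 1)
        ↔ ∀ a, ρ (Sum.inl a) = Sum.inl a := by
      intro ρ
      refine forall_congr' fun a => ?_
      rw [Equiv.Perm.mul_apply, Equiv.Perm.sumCongr_apply, Sum.map_inl, Equiv.Perm.mul_apply,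
        ← hz a, σ.injective.eq_iff, Sum.inl_injective.eq_iff, ← hρ₀, ρ₀.injective.eq_iff]
    simp only [Equiv.coe_mulLeft, hiff]
    rw [sum_perm_fixing_inl fun _ => F σ, Finset.sum_const, Finset.card_univ,
      Fintype.card_perm, nsmul_eq_mul]
  rw [← e1, Finset.sum_comm, Finset.sum_congr rfl fun σ _ => e2 σ, Finset.mul_sum]

/-- If `w` is divisible by the product of the linear forms dual to `v`, as expressed by the
vanishing of `a ∧ w` for these forms `a`, contracting `w ∧ φ` with `v` only affects `w`. -/
theorem wedge_append_eq_wedge_contract {d m q p l : ℕ} (h : m + q = p)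
    (v : Fin m → EuclideanSpace ℝ (Fin d)) (u : Fin (q + l) → EuclideanSpace ℝ (Fin d))
    (w : Alt d p) (φ : Alt d l) (a : Fin m → EuclideanSpace ℝ (Fin d) →L[ℝ] ℝ)
    (hw : ∀ j, wedge (oneForm (a j)) w = 0) (hav : ∀ j, a j (v j) = 1)
    (hav' : ∀ j j', j' ≠ j → a j (v j') = 0) (hau : ∀ j i, a j (u i) = 0)
    (hc : p + l = m + (q + l)) :
    wedge w φ (fun j => Fin.append v u (Fin.cast hc j)) = wedge (contract h v w) φ u := by
  subst h
  -- `b` lists the vectors `v`, `u`, indexed by a disjoint union, and `F` is the summand of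
  -- `(w ∧ φ) (v, u)` that belongs to a permutation.
  let b : (Fin m ⊕ Fin q) ⊕ Fin l → EuclideanSpace ℝ (Fin d) :=
    Sum.elim (Sum.elim v (fun j => u (Fin.castAdd l j))) (fun j => u (Fin.natAdd q j))
  let F : Equiv.Perm ((Fin m ⊕ Fin q) ⊕ Fin l) → ℂ := fun σ => ((Equiv.Perm.sign σ : ℤ) : ℂ) *
    (w (fun j => b (σ (Sum.inl (finSumFinEquiv.symm j)))) * φ (fun j => b (σ (Sum.inr j))))
  have hF : ∀ σ (ρ : Equiv.Perm (Fin m ⊕ Fin q)), F (σ * Equiv.Perm.sumCongr ρ 1) = F σ := by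
    intro σ ρ
    have := alt_comp_perm w (fun x => b (σ (Sum.inl x))) finSumFinEquiv.symm
      (finSumFinEquiv.permCongr ρ)
    rw [Equiv.Perm.sign_permCongr] at this
    simp only [Equiv.permCongr_apply, Equiv.symm_apply_apply] at this
    simp only [F, Equiv.Perm.sign_mul, Equiv.Perm.sign_sumCongr, Equiv.Perm.sign_one, mul_one,
      Equiv.Perm.mul_apply, Equiv.Perm.sumCongr_apply, Sum.map_inl, Sum.map_inr,
      Equiv.Perm.one_apply, this, Units.val_mul, Int.cast_mul]
    have hs : ((Equiv.Perm.sign ρ : ℤ) : ℂ) * ((Equiv.Perm.sign ρ : ℤ) : ℂ) = 1 := by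
      rw [← Int.cast_mul]; simp
    linear_combination (((Equiv.Perm.sign σ : ℤ) : ℂ) *
      (w (fun j => b (σ (Sum.inl (finSumFinEquiv.symm j)))) * φ (fun j => b (σ (Sum.inr j))))) * hs
  -- Unless all the vectors `v` are arguments of `w`, one of the forms `a c` vanishes on all
  -- arguments of `w`, and so does `w`.
  have hF0 : ∀ σ, (∃ a : Fin m, ∀ z : Fin m ⊕ Fin q, σ (Sum.inl z) ≠ Sum.inl (Sum.inl a)) →
      F σ = 0 := by
    rintro σ ⟨c, hc⟩
    have : w (fun j => b (σ (Sum.inl (finSumFinEquiv.symm j)))) = 0 := by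
      refine apply_eq_zero_of_wedge_oneForm_eq_zero (hw c) (hav c) fun j => ?_
      have hne := hc (finSumFinEquiv.symm j)
      rcases hx : σ (Sum.inl (finSumFinEquiv.symm j)) with (y | y) | y
      · exact hav' c y fun h => hne (by rw [hx, h])
      · exact hau c _
      · exact hau c _
    simp [F, this]
  have main := sum_perm_eq_sum_perm_fixing F hF hF0
  have e1 : wedge w φ (fun j => Fin.append v u (Fin.cast hc j))
      = (((m + q).factorial : ℂ) * (l.factorial : ℂ))⁻¹ * ∑ σ, F σ := by
    have := wedge_apply_sum w φ fun x => b (Sum.map finSumFinEquiv.symm id x)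
    have hb : (fun j => Fin.append v u (Fin.cast hc j))
        = (fun x => b (Sum.map finSumFinEquiv.symm id x)) ∘ finSumFinEquiv.symm := by
      funext j
      obtain ⟨x, rfl⟩ := finSumFinEquiv.surjective j
      rw [Function.comp_apply, Equiv.symm_apply_apply]
      rcases x with y | y
      · obtain ⟨z, rfl⟩ := finSumFinEquiv.surjective y
        rcases z with z | z
        · simp only [Sum.map_inl, b, Sum.elim_inl, finSumFinEquiv_apply_left,
            finSumFinEquiv_symm_apply_castAdd]
          rw [← Fin.append_left v u z]
          congr 1
        · simp only [Sum.map_inl, b, Sum.elim_inl, Sum.elim_inr, finSumFinEquiv_apply_left,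
            finSumFinEquiv_apply_right, finSumFinEquiv_symm_apply_natAdd]
          rw [← Fin.append_right v u]
          congr 1
      · simp only [Sum.map_inr, b, Sum.elim_inr, finSumFinEquiv_apply_right, id]
        rw [← Fin.append_right v u]
        congr 1
        ext
        simp [add_assoc]
    rw [hb, this]
    congr 1
    refine (Fintype.sum_equiv (Equiv.permCongr (Equiv.sumCongr finSumFinEquiv (Equiv.refl _)))
      _ _ fun σ => ?_).symm
    rw [Equiv.Perm.sign_permCongr]
    simp [F, Equiv.permCongr_apply]
  have e2 : wedge (contract rfl v w) φ u
      = ((q.factorial : ℂ) * (l.factorial : ℂ))⁻¹ * ∑ τ : Equiv.Perm (Fin q ⊕ Fin l),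
        F ((Equiv.sumAssoc _ _ _).symm.permCongr (Equiv.Perm.sumCongr 1 τ)) := by
    have := wedge_apply_sum (contract rfl v w) φ fun x => u (finSumFinEquiv x)
    have hu : (fun x => u (finSumFinEquiv x)) ∘ finSumFinEquiv.symm = u := by
      funext j; simp
    rw [hu] at this
    rw [this]
    congr 1
    refine Finset.sum_congr rfl fun τ _ => ?_
    have hb : ∀ y : Fin q ⊕ Fin l, b ((Equiv.sumAssoc _ _ _).symm (Sum.inr y))
        = u (finSumFinEquiv y) := by
      rintro (y | y) <;> rfl
    simp only [F, Equiv.Perm.sign_permCongr, Equiv.Perm.sign_sumCongr, Equiv.Perm.sign_one, one_mul]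
    congr 2
    · rw [contract_apply]
      congr 1
      funext j
      obtain ⟨x, rfl⟩ := finSumFinEquiv.surjective j
      rw [Equiv.symm_apply_apply]
      rcases x with y | y
      · simp [Equiv.permCongr_apply, b]
      · simp only [Equiv.permCongr_apply, Equiv.symm_symm, Equiv.sumAssoc_apply_inl_inr,
          Equiv.Perm.sumCongr_apply, Sum.map_inr, hb, finSumFinEquiv_apply_right, Fin.cast_eq_self,
          Fin.append_right]
    · congr 1
      funext j
      simp only [Equiv.permCongr_apply, Equiv.symm_symm, Equiv.sumAssoc_apply_inr,
        Equiv.Perm.sumCongr_apply, Sum.map_inr, hb]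
  rw [e1, e2]
  simp only [Fintype.card_sum, Fintype.card_fin] at main
  have h1 : ((m + q).factorial : ℂ) ≠ 0 := by exact_mod_cast Nat.factorial_ne_zero _
  have h2 : (q.factorial : ℂ) ≠ 0 := by exact_mod_cast Nat.factorial_ne_zero _
  have h3 : (l.factorial : ℂ) ≠ 0 := by exact_mod_cast Nat.factorial_ne_zero _
  field_simp
  linear_combination main

/-- The complex volume form of `ℝ ^ d`. -/
def volForm (d : ℕ) : Alt d d where
  toMultilinearMap := (Complex.ofRealLI.toLinearMap.compAlternatingMap
    (EuclideanSpace.basisFun (Fin d) ℝ).toBasis.det).toMultilinearMap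
  map_eq_zero_of_eq' := (Complex.ofRealLI.toLinearMap.compAlternatingMap
    (EuclideanSpace.basisFun (Fin d) ℝ).toBasis.det).map_eq_zero_of_eq'
  cont := by
    refine Complex.continuous_ofReal.comp (Continuous.matrix_det (continuous_matrix fun i j => ?_))
    simp only [Module.Basis.toMatrix_apply, OrthonormalBasis.coe_toBasis_repr_apply,
      EuclideanSpace.basisFun_repr]
    fun_prop

theorem volForm_single (d : ℕ) :
    volForm d (fun j => EuclideanSpace.single j (1 : ℝ)) = 1 := by
  have h := (EuclideanSpace.basisFun (Fin d) ℝ).toBasis.det_self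
  have e : ⇑(EuclideanSpace.basisFun (Fin d) ℝ).toBasis
      = fun j => EuclideanSpace.single j (1 : ℝ) := by
    funext j
    simp
  rw [e] at h
  exact congrArg Complex.ofReal h

/-- The wedge pairing in complementary degrees is nondegenerate. -/
theorem exists_wedge_ne_zero {d q l : ℕ} (h : q + l = d) {β : Alt d q} (hβ : β ≠ 0) :
    ∃ φ : Alt d l, wedge β φ (fun j => EuclideanSpace.single (Fin.cast h j) (1 : ℝ)) ≠ 0 := by
  let e : Fin d → EuclideanSpace ℝ (Fin d) := fun j => EuclideanSpace.single j 1
  obtain ⟨I, hI, hβI⟩ : ∃ I : Fin q → Fin d, Function.Injective I ∧ β (fun j => e (I j)) ≠ 0 := by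
    by_contra! hcon
    refine hβ (ContinuousAlternatingMap.toAlternatingMap_injective ?_)
    refine Module.Basis.ext_alternating (EuclideanSpace.basisFun (Fin d) ℝ).toBasis
      fun I hI => ?_
    have := hcon I hI
    simpa [e] using this
  -- Complete `I` to an enumeration of the basis.
  obtain ⟨σ₀, hσ₀⟩ : ∃ σ₀ : Fin q ⊕ Fin l ≃ Fin d, ∀ j, σ₀ (Sum.inl j) = I j := by
    have hcard : Fintype.card {x // x ∉ range I} = l := by
      rw [Fintype.card_subtype_compl, Fintype.card_fin]
      have : Fintype.card {x // x ∈ range I} = q := by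
        exact (Fintype.card_congr (Equiv.ofInjective I hI).symm).trans (Fintype.card_fin q)
      omega
    let J := (Fintype.equivFinOfCardEq hcard).symm
    refine ⟨Equiv.ofBijective (Sum.elim I fun j => (J j : Fin d)) ⟨?_, ?_⟩, fun j => rfl⟩
    · refine hI.sumElim (Subtype.val_injective.comp J.injective) fun a b hab => ?_
      exact (J b).2 ⟨a, hab⟩
    · intro x
      by_cases hx : x ∈ range I
      · obtain ⟨j, rfl⟩ := hx
        exact ⟨Sum.inl j, rfl⟩
      · exact ⟨Sum.inr (J.symm ⟨x, hx⟩), by simp⟩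
  let w : Fin q ⊕ Fin l → EuclideanSpace ℝ (Fin d) := fun x => e (σ₀ x)
  let φ : Alt d l := contract h (fun j => w (Sum.inl j)) (volForm d)
  have hstd : ∀ π : Fin q ⊕ Fin l ≃ Fin (q + l), ∀ η : Alt d (q + l),
      (η fun j => w (π.symm j)) ≠ 0 →
      η (fun j => EuclideanSpace.single (Fin.cast h j) (1 : ℝ)) ≠ 0 := by
    intro π η hne
    have := alt_comp_perm η e (Fin.cast h) ((π.symm.trans σ₀).trans (finCongr h).symm)
    intro h0
    apply hne
    have e1 : (fun j => w (π.symm j)) = fun j => e (Fin.cast h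
        (((π.symm.trans σ₀).trans (finCongr h).symm) j)) := by
      funext j; simp [w]
    rw [e1, this]
    have : (η fun j => e (Fin.cast h j)) = 0 := h0
    rw [this, mul_zero]
  have hw1 : β (fun j => w (Sum.inl j)) ≠ 0 := by simpa only [w, hσ₀] using hβI
  have hw2 : φ (fun j => w (Sum.inr j)) ≠ 0 := by
    have hv : volForm d (fun j => e j) ≠ 0 := by rw [volForm_single]; exact one_ne_zero
    have hperm := alt_comp_perm (volForm d) e id
      (((finCongr h).symm.trans finSumFinEquiv.symm).trans σ₀)
    have e1 : (fun j => Fin.append (fun j => w (Sum.inl j)) (fun j => w (Sum.inr j))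
        (Fin.cast h.symm j))
        = fun j => e ((((finCongr h).symm.trans finSumFinEquiv.symm).trans σ₀) j) := by
      funext j
      obtain ⟨x, hx⟩ := finSumFinEquiv.surjective (Fin.cast h.symm j)
      simp only [Equiv.trans_apply, finCongr_symm, finCongr_apply, ← hx, Equiv.symm_apply_apply]
      rcases x with x | x
      · rw [finSumFinEquiv_apply_left, Fin.append_left]
      · rw [finSumFinEquiv_apply_right, Fin.append_right]
    rw [contract_apply, e1]
    simp only [id] at hperm
    rw [hperm]
    refine mul_ne_zero ?_ hv
    simp
  have hc := mul_ne_zero hw1 hw2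
  refine ⟨φ, hstd finSumFinEquiv _ ?_⟩
  have hterm : ∀ σ : Equiv.Perm (Fin q ⊕ Fin l), ((Equiv.Perm.sign σ : ℤ) : ℂ) *
      (β (fun j => w (σ (Sum.inl j))) * φ (fun j => w (σ (Sum.inr j))))
      = if ∀ b, ∃ b', σ (Sum.inr b) = Sum.inr b' then
          β (fun j => w (Sum.inl j)) * φ (fun j => w (Sum.inr j)) else 0 := by
    intro σ
    split_ifs with hσ
    · obtain ⟨⟨ρ₁, ρ₂⟩, rfl⟩ := Equiv.Perm.mem_sumCongrHom_range_of_perm_mapsTo_inl (σ := σ) (by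
        rintro _ ⟨a, rfl⟩
        rcases hx : σ (Sum.inl a) with y | y
        · exact ⟨y, rfl⟩
        · exfalso
          choose g hg using hσ
          have hgi : Function.Injective g := by
            intro b b' hb
            have := (hg b).trans ((congrArg Sum.inr hb).trans (hg b').symm)
            simpa using this
          obtain ⟨b, rfl⟩ := Finite.surjective_of_injective hgi y
          have := hx.trans (hg b).symm
          simp at this)
      have h1 := alt_comp_perm β w Sum.inl ρ₁
      have h2 := alt_comp_perm φ w Sum.inr ρ₂
      simp only [Equiv.Perm.sumCongrHom_apply, Equiv.Perm.sumCongr_apply, Sum.map_inl, Sum.map_inr,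
        Equiv.Perm.sign_sumCongr, h1, h2, Units.val_mul, Int.cast_mul]
      have hs : ∀ {n : ℕ} (ρ : Equiv.Perm (Fin n)),
          ((Equiv.Perm.sign ρ : ℤ) : ℂ) * ((Equiv.Perm.sign ρ : ℤ) : ℂ) = 1 := by
        intro n ρ
        rw [← Int.cast_mul]; simp
      linear_combination (β (fun j => w (Sum.inl j)) * φ (fun j => w (Sum.inr j))) *
        (((Equiv.Perm.sign ρ₂ : ℤ) : ℂ) * ((Equiv.Perm.sign ρ₂ : ℤ) : ℂ) * hs ρ₁ + hs ρ₂)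
    · push Not at hσ
      obtain ⟨b, hb⟩ := hσ
      -- The argument `σ (inr b)` of the volume form occurs twice.
      have : φ (fun j => w (σ (Sum.inr j))) = 0 := by
        rcases hx : σ (Sum.inr b) with a | a
        · rw [contract_apply]
          refine (volForm d).map_eq_zero_of_eq _ (i := Fin.cast h (Fin.castAdd l a))
            (j := Fin.cast h (Fin.natAdd q b)) ?_ ?_
          · simp [hx]
          · intro hh
            have := congrArg Fin.val hh
            simp at this
            omega
        · exact absurd hx (hb a)
      rw [this, mul_zero, mul_zero]
  have := wedge_apply_sum β φ w
  change wedge β φ (w ∘ finSumFinEquiv.symm) ≠ 0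
  rw [this, Finset.sum_congr rfl fun σ _ => hterm σ, ← Finset.sum_filter, Finset.sum_const,
    nsmul_eq_mul]
  refine mul_ne_zero (inv_ne_zero (mul_ne_zero ?_ ?_)) (mul_ne_zero ?_ hc)
  · exact_mod_cast Nat.factorial_ne_zero _
  · exact_mod_cast Nat.factorial_ne_zero _
  · rw [Nat.cast_ne_zero]
    refine Finset.card_ne_zero_of_mem (a := 1) ?_
    simp

/-! ### Smooth functions with values in alternating forms -/

section SmoothAlt

variable {G : Type*} [NormedAddCommGroup G] [NormedSpace ℝ G]

/-- A function with values in alternating forms is smooth if its values on all tuples of vectors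
are. -/
theorem contDiffAt_alt_of_apply {d q : ℕ} {f : G → Alt d q} {z : G} {N : WithTop ℕ∞}
    (h : ∀ v, ContDiffAt ℝ N (fun z => f z v) z) : ContDiffAt ℝ N f z := by
  let ev : Alt d q →ₗ[ℝ] ((Fin q → Fin d) → ℂ) :=
    { toFun := fun a I => a fun j => EuclideanSpace.single (I j) (1 : ℝ)
      map_add' := fun _ _ => rfl
      map_smul' := fun _ _ => rfl }
  have hker : LinearMap.ker ev = ⊥ := by
    rw [LinearMap.ker_eq_bot]
    intro a b hab
    refine ContinuousAlternatingMap.toAlternatingMap_injective ?_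
    refine Module.Basis.ext_alternating (EuclideanSpace.basisFun (Fin d) ℝ).toBasis
      fun I _ => ?_
    simpa [ev] using congrFun hab I
  obtain ⟨g, hg⟩ := ev.exists_leftInverse_of_injective hker
  have e : f = fun z => (LinearMap.toContinuousLinearMap g) (ev (f z)) := by
    funext z
    exact (LinearMap.congr_fun hg (f z)).symm
  rw [e]
  exact (LinearMap.toContinuousLinearMap g).contDiff.contDiffAt.comp z
    (contDiffAt_pi.2 fun I => h _)

/-- Evaluation at a tuple of vectors. -/
def altApplyCLM {d q : ℕ} (v : Fin q → EuclideanSpace ℝ (Fin d)) : Alt d q →L[ℝ] ℂ :=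
  LinearMap.toContinuousLinearMap
    { toFun := fun a => a v
      map_add' := fun _ _ => rfl
      map_smul' := fun _ _ => rfl }

theorem contDiffAt_compContinuousLinearMap {d d' q : ℕ} {a : G → Alt d q}
    {g : G → EuclideanSpace ℝ (Fin d') →L[ℝ] EuclideanSpace ℝ (Fin d)} {z : G} {N : WithTop ℕ∞}
    (ha : ContDiffAt ℝ N a z) (hg : ContDiffAt ℝ N g z) :
    ContDiffAt ℝ N (fun z => (a z).compContinuousLinearMap (g z)) z := by
  refine contDiffAt_alt_of_apply fun v => ?_
  have h1 : ContDiffAt ℝ N (fun z =>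
      ContinuousAlternatingMap.toContinuousMultilinearMapCLM ℝ (a z)) z :=
    (ContinuousLinearMap.contDiff _).contDiffAt.comp z ha
  have h2 : ContDiffAt ℝ N (fun z =>
      ContinuousMultilinearMap.compContinuousLinearMapContinuousMultilinear ℝ
        (fun _ : Fin q => EuclideanSpace ℝ (Fin d')) (fun _ => EuclideanSpace ℝ (Fin d)) ℂ
        (fun _ => g z)) z :=
    (ContinuousMultilinearMap.contDiff _).contDiffAt.comp z (contDiffAt_pi.2 fun _ => hg)
  exact (ContinuousLinearMap.contDiff (ContinuousMultilinearMap.apply ℝ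
    (fun _ : Fin q => EuclideanSpace ℝ (Fin d')) ℂ v)).contDiffAt.comp z (h2.clm_apply h1)

theorem contDiffAt_wedge {d p q : ℕ} {a : G → Alt d p} {b : G → Alt d q} {z : G}
    {N : WithTop ℕ∞} (ha : ContDiffAt ℝ N a z) (hb : ContDiffAt ℝ N b z) :
    ContDiffAt ℝ N (fun z => wedge (a z) (b z)) z :=
  contDiffAt_alt_of_apply fun v => by
    simp only [wedge_apply]
    refine contDiffAt_const.mul (ContDiffAt.sum fun σ _ =>
      contDiffAt_const.mul (ContDiffAt.mul ?_ ?_))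
    · exact (altApplyCLM _).contDiff.contDiffAt.comp z ha
    · exact (altApplyCLM _).contDiff.contDiffAt.comp z hb

end SmoothAlt

/-! ### Expressions of forms in arbitrary charts -/

/-- A locally constant multiplicative character of the nonzero real numbers: the character `1`
gives ordinary forms, the sign gives forms with values in the orientation bundle. -/
structure IsSignChar (κ : ℝ → ℝ) : Prop where
  map_one : κ 1 = 1
  map_mul : ∀ a b, κ (a * b) = κ a * κ b
  eventually_eq : ∀ a, a ≠ 0 → ∀ᶠ b in 𝓝 a, κ b = κ a

theorem isSignChar_one : IsSignChar fun _ => 1 :=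
  ⟨rfl, fun _ _ => (mul_one 1).symm, fun _ _ => Eventually.of_forall fun _ => rfl⟩

theorem isSignChar_sign : IsSignChar Real.sign := by
  refine ⟨Real.sign_one, fun a b => ?_, fun a ha => ?_⟩
  · rcases lt_trichotomy a 0 with h | rfl | h
    · rcases lt_trichotomy b 0 with h' | rfl | h'
      · rw [Real.sign_of_neg h, Real.sign_of_neg h', Real.sign_of_pos (mul_pos_of_neg_of_neg h h')]
        norm_num
      · simp
      · rw [Real.sign_of_neg h, Real.sign_of_pos h', Real.sign_of_neg (mul_neg_of_neg_of_pos h h')]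
        norm_num
    · simp
    · rcases lt_trichotomy b 0 with h' | rfl | h'
      · rw [Real.sign_of_pos h, Real.sign_of_neg h', Real.sign_of_neg (mul_neg_of_pos_of_neg h h')]
        norm_num
      · simp
      · rw [Real.sign_of_pos h, Real.sign_of_pos h', Real.sign_of_pos (mul_pos h h')]
        norm_num
  · rcases lt_or_gt_of_ne ha with h | h
    · filter_upwards [Iio_mem_nhds h] with b hb
      rw [Real.sign_of_neg h, Real.sign_of_neg hb]
    · filter_upwards [Ioi_mem_nhds h] with b hb
      rw [Real.sign_of_pos h, Real.sign_of_pos hb]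

theorem IsSignChar.ne_zero {κ : ℝ → ℝ} (hκ : IsSignChar κ) {a : ℝ} (ha : a ≠ 0) : κ a ≠ 0 := by
  intro h
  have := hκ.map_mul a a⁻¹
  rw [mul_inv_cancel₀ ha, hκ.map_one, h, zero_mul] at this
  exact one_ne_zero this

section Charts

variable {d : ℕ} {Z : Type*} [TopologicalSpace Z]
  [ChartedSpace (EuclideanSpace ℝ (Fin d)) Z] [IsManifold (𝓡 d) ∞ Z]

/-- The smooth charts of the manifold `Z`. -/
abbrev smoothCharts (d : ℕ) (Z : Type*) [TopologicalSpace Z]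
    [ChartedSpace (EuclideanSpace ℝ (Fin d)) Z] [IsManifold (𝓡 d) ∞ Z] :
    Set (OpenPartialHomeomorph Z (EuclideanSpace ℝ (Fin d))) :=
  IsManifold.maximalAtlas (𝓡 d) ∞ Z

theorem chartAt_mem_smoothCharts (x : Z) :
    chartAt (EuclideanSpace ℝ (Fin d)) x ∈ smoothCharts d Z :=
  IsManifold.chart_mem_maximalAtlas x

theorem extChartAt_coe_eq (x : Z) :
    (extChartAt (𝓡 d) x : Z → EuclideanSpace ℝ (Fin d)) = chartAt _ x := by
  simp only [mfld_simps]

theorem extChartAt_symm_coe_eq (x : Z) :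
    ((extChartAt (𝓡 d) x).symm : EuclideanSpace ℝ (Fin d) → Z) = (chartAt _ x).symm := by
  simp only [mfld_simps]

theorem extChartAt_target_eq (x : Z) :
    (extChartAt (𝓡 d) x).target = (chartAt (EuclideanSpace ℝ (Fin d)) x).target := by
  simp only [mfld_simps]

variable {e e' : OpenPartialHomeomorph Z (EuclideanSpace ℝ (Fin d))}

/-- Changes of charts are smooth. -/
theorem contDiffAt_chart_comp_symm (he : e ∈ smoothCharts d Z) (he' : e' ∈ smoothCharts d Z)
    {z : EuclideanSpace ℝ (Fin d)} (hz : z ∈ e.target) (hz' : e.symm z ∈ e'.source) :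
    ContDiffAt ℝ ∞ (e' ∘ e.symm) z := by
  have h := ModelWithCorners.contDiffOn_extendCoordChange he he'
  simp only [mfld_simps] at h
  exact h.contDiffAt ((e.isOpen_inter_preimage_symm e'.open_source).mem_nhds ⟨hz, hz'⟩)

/-- Points near `z` in the target of a chart that come from an open set. -/
theorem eventually_mem_target (e : OpenPartialHomeomorph Z (EuclideanSpace ℝ (Fin d))) {U : Set Z}
    (hU : IsOpen U) {z : EuclideanSpace ℝ (Fin d)} (hz : z ∈ e.target) (hz' : e.symm z ∈ U) :
    ∀ᶠ y in 𝓝 z, y ∈ e.target ∧ e.symm y ∈ U :=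
  (e.isOpen_inter_preimage_symm hU).mem_nhds ⟨hz, hz'⟩

/-- The derivative at `z` of the inverse of the chart `e`, the tangent space at `e.symm z` being
identified with `ℝ ^ d` by the preferred chart. -/
def chartDeriv (e : OpenPartialHomeomorph Z (EuclideanSpace ℝ (Fin d)))
    (z : EuclideanSpace ℝ (Fin d)) : EuclideanSpace ℝ (Fin d) →L[ℝ] EuclideanSpace ℝ (Fin d) :=
  fderiv ℝ (chartAt (EuclideanSpace ℝ (Fin d)) (e.symm z) ∘ e.symm) z

/-- The derivative of a change of charts, from `e'` to `e`. -/
def transDeriv (e e' : OpenPartialHomeomorph Z (EuclideanSpace ℝ (Fin d)))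
    (z : EuclideanSpace ℝ (Fin d)) : EuclideanSpace ℝ (Fin d) →L[ℝ] EuclideanSpace ℝ (Fin d) :=
  fderiv ℝ (e ∘ e'.symm) z

theorem transDeriv_comp {e'' : OpenPartialHomeomorph Z (EuclideanSpace ℝ (Fin d))}
    (he : e ∈ smoothCharts d Z) (he' : e' ∈ smoothCharts d Z) (he'' : e'' ∈ smoothCharts d Z)
    {z : EuclideanSpace ℝ (Fin d)} (hz : z ∈ e'.target) (hz' : e'.symm z ∈ e.source)
    (hz'' : e'.symm z ∈ e''.source) :
    transDeriv e'' e' z = (transDeriv e'' e (e (e'.symm z))).comp (transDeriv e e' z) := by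
  have h1 : (e'' ∘ e'.symm) =ᶠ[𝓝 z] (e'' ∘ e.symm) ∘ (e ∘ e'.symm) := by
    filter_upwards [eventually_mem_target e' e.open_source hz hz'] with y hy
    simp only [Function.comp_apply, e.left_inv hy.2]
  rw [transDeriv, h1.fderiv_eq, fderiv_comp]
  · rfl
  · refine (contDiffAt_chart_comp_symm he he'' (e.map_source hz') ?_).differentiableAt (by simp)
    simpa only [Function.comp_apply, e.left_inv hz'] using hz''
  · exact (contDiffAt_chart_comp_symm he' he hz hz').differentiableAt (by simp)

theorem transDeriv_self {z : EuclideanSpace ℝ (Fin d)} (hz : z ∈ e.target) :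
    transDeriv e e z = ContinuousLinearMap.id ℝ _ := by
  have h1 : (e ∘ e.symm) =ᶠ[𝓝 z] id := by
    filter_upwards [e.open_target.mem_nhds hz] with y hy
    exact e.right_inv hy
  rw [transDeriv, h1.fderiv_eq, fderiv_id]

theorem transDeriv_det_ne_zero (he : e ∈ smoothCharts d Z) (he' : e' ∈ smoothCharts d Z)
    {z : EuclideanSpace ℝ (Fin d)} (hz : z ∈ e'.target) (hz' : e'.symm z ∈ e.source) :
    (transDeriv e e' z).det ≠ 0 := by
  intro h
  have h1 := transDeriv_comp he he' he' hz hz' (e'.map_target hz)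
  rw [transDeriv_self hz] at h1
  have h2 := congrArg ContinuousLinearMap.det h1
  rw [ContinuousLinearMap.det, ContinuousLinearMap.coe_id, LinearMap.det_id] at h2
  have h3 : ((transDeriv e' e (e (e'.symm z))).comp (transDeriv e e' z)).det
      = (transDeriv e' e (e (e'.symm z))).det * (transDeriv e e' z).det := by
    simp only [ContinuousLinearMap.det]
    exact LinearMap.det_comp _ _
  rw [h3, h, mul_zero] at h2
  exact one_ne_zero h2

theorem det_comp_clm (f g : EuclideanSpace ℝ (Fin d) →L[ℝ] EuclideanSpace ℝ (Fin d)) :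
    (f.comp g).det = f.det * g.det := by
  simp only [ContinuousLinearMap.det]
  exact LinearMap.det_comp _ _

theorem chartDeriv_eq_transDeriv (z : EuclideanSpace ℝ (Fin d)) :
    chartDeriv e z = transDeriv (chartAt _ (e.symm z)) e z := rfl

theorem chartDeriv_comp (he : e ∈ smoothCharts d Z) (he' : e' ∈ smoothCharts d Z)
    {z : EuclideanSpace ℝ (Fin d)} (hz : z ∈ e'.target) (hz' : e'.symm z ∈ e.source) :
    chartDeriv e' z = (chartDeriv e (e (e'.symm z))).comp (transDeriv e e' z) := by
  have := transDeriv_comp he he' (chartAt_mem_smoothCharts (e'.symm z)) hz hz'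
    (mem_chart_source _ _)
  rw [chartDeriv_eq_transDeriv, chartDeriv_eq_transDeriv, this, e.left_inv hz']

theorem chartDeriv_det_ne_zero (he : e ∈ smoothCharts d Z) {z : EuclideanSpace ℝ (Fin d)}
    (hz : z ∈ e.target) : (chartDeriv e z).det ≠ 0 :=
  transDeriv_det_ne_zero (chartAt_mem_smoothCharts _) he hz (mem_chart_source _ _)

theorem contDiffAt_transDeriv (he : e ∈ smoothCharts d Z) (he' : e' ∈ smoothCharts d Z)
    {z : EuclideanSpace ℝ (Fin d)} (hz : z ∈ e'.target) (hz' : e'.symm z ∈ e.source) :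
    ContDiffAt ℝ ∞ (transDeriv e e') z :=
  (contDiffAt_chart_comp_symm he' he hz hz').fderiv_right (m := ∞) (by simp)

/-- The expression of a form in the chart `e`, twisted by the character `κ`. -/
def chartRep (κ : ℝ → ℝ) {q : ℕ} (e : OpenPartialHomeomorph Z (EuclideanSpace ℝ (Fin d)))
    (w : Z → Alt d q) (z : EuclideanSpace ℝ (Fin d)) : Alt d q :=
  κ (chartDeriv e z).det • (w (e.symm z)).compContinuousLinearMap (chartDeriv e z)

theorem tangentCoordChange_eq_chartDeriv (x₀ : Z) {z : EuclideanSpace ℝ (Fin d)}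
    (hz : z ∈ (chartAt (EuclideanSpace ℝ (Fin d)) x₀).target) :
    tangentCoordChange (𝓡 d) x₀ ((chartAt _ x₀).symm z) ((chartAt _ x₀).symm z)
      = chartDeriv (chartAt _ x₀) z := by
  rw [tangentCoordChange_def, extChartAt_coe_eq, extChartAt_symm_coe_eq, extChartAt_coe_eq,
    (chartAt _ x₀).right_inv hz, ModelWithCorners.range_eq_univ, fderivWithin_univ]
  rfl

theorem localRep_eq_chartRep {q : ℕ} (x₀ : Z) (w : Z → Alt d q) {z : EuclideanSpace ℝ (Fin d)}
    (hz : z ∈ (chartAt (EuclideanSpace ℝ (Fin d)) x₀).target) :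
    localRep x₀ w z = chartRep (fun _ => 1) (chartAt _ x₀) w z := by
  rw [localRep, extChartAt_symm_coe_eq, tangentCoordChange_eq_chartDeriv x₀ hz, chartRep, one_smul]

theorem twistedRep_eq_chartRep {q : ℕ} (x₀ : Z) (w : Z → Alt d q) {z : EuclideanSpace ℝ (Fin d)}
    (hz : z ∈ (chartAt (EuclideanSpace ℝ (Fin d)) x₀).target) :
    twistedRep x₀ w z = chartRep Real.sign (chartAt _ x₀) w z := by
  rw [twistedRep, localRep, frameSign, extChartAt_symm_coe_eq,
    tangentCoordChange_eq_chartDeriv x₀ hz, chartRep]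

variable {κ : ℝ → ℝ}

/-- The change of charts for expressions of forms. -/
theorem chartRep_trans (hκ : IsSignChar κ) {q : ℕ} (he : e ∈ smoothCharts d Z)
    (he' : e' ∈ smoothCharts d Z) (w : Z → Alt d q) {z : EuclideanSpace ℝ (Fin d)}
    (hz : z ∈ e'.target) (hz' : e'.symm z ∈ e.source) :
    chartRep κ e' w z = κ (transDeriv e e' z).det •
      (chartRep κ e w (e (e'.symm z))).compContinuousLinearMap (transDeriv e e' z) := by
  rw [chartRep, chartDeriv_comp he he' hz hz', det_comp_clm, hκ.map_mul, chartRep, e.left_inv hz',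
    mul_comm, mul_smul]
  rfl

theorem eventually_signChar_transDeriv (hκ : IsSignChar κ) (he : e ∈ smoothCharts d Z)
    (he' : e' ∈ smoothCharts d Z) {z : EuclideanSpace ℝ (Fin d)}
    (hz : z ∈ e'.target) (hz' : e'.symm z ∈ e.source) :
    ∀ᶠ y in 𝓝 z, κ (transDeriv e e' y).det = κ (transDeriv e e' z).det :=
  (ContinuousLinearMap.continuous_det.continuousAt.comp
    (contDiffAt_transDeriv he he' hz hz').continuousAt).eventually
    (hκ.eventually_eq _ (transDeriv_det_ne_zero he he' hz hz'))

/-- Near `z` the sign in the change of charts is constant. -/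
theorem chartRep_trans_eventuallyEq (hκ : IsSignChar κ) {q : ℕ} (he : e ∈ smoothCharts d Z)
    (he' : e' ∈ smoothCharts d Z) (w : Z → Alt d q) {z : EuclideanSpace ℝ (Fin d)}
    (hz : z ∈ e'.target) (hz' : e'.symm z ∈ e.source) :
    chartRep κ e' w =ᶠ[𝓝 z] κ (transDeriv e e' z).det • fun y =>
      (chartRep κ e w ((e ∘ e'.symm) y)).compContinuousLinearMap (fderiv ℝ (e ∘ e'.symm) y) := by
  filter_upwards [eventually_mem_target e' e.open_source hz hz',
    eventually_signChar_transDeriv hκ he he' hz hz'] with y hy hy'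
  rw [chartRep_trans hκ he he' w hy.1 hy.2, hy']
  rfl

/-- Smoothness of a form at a point, in some chart. -/
def SmoothFormAt (κ : ℝ → ℝ) {q : ℕ} (w : Z → Alt d q) (x : Z) : Prop :=
  ∃ e ∈ smoothCharts d Z, x ∈ e.source ∧ ContDiffAt ℝ ∞ (chartRep κ e w) (e x)

/-- Smoothness of a form does not depend on the chart. -/
theorem SmoothFormAt.contDiffAt (hκ : IsSignChar κ) {q : ℕ} {w : Z → Alt d q} {x : Z}
    (h : SmoothFormAt κ w x) (he' : e' ∈ smoothCharts d Z) (hx : x ∈ e'.source) :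
    ContDiffAt ℝ ∞ (chartRep κ e' w) (e' x) := by
  obtain ⟨e, he, hxe, hs⟩ := h
  have hz := e'.map_source hx
  have hz' : e'.symm (e' x) ∈ e.source := by rwa [e'.left_inv hx]
  refine ContDiffAt.congr_of_eventuallyEq ?_ (chartRep_trans_eventuallyEq hκ he he' w hz hz')
  have h1 : ContDiffAt ℝ ∞ (fun y => chartRep κ e w ((e ∘ e'.symm) y)) (e' x) := by
    refine ContDiffAt.comp (g := chartRep κ e w) (e' x) ?_
      (contDiffAt_chart_comp_symm he' he hz hz')
    simpa only [Function.comp_apply, e'.left_inv hx] using hs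
  have h2 := contDiffAt_compContinuousLinearMap h1 (contDiffAt_transDeriv he he' hz hz')
  exact h2.const_smul (κ (transDeriv e e' (e' x)).det)

theorem SmoothFormAt.contDiffAt_symm (hκ : IsSignChar κ) {q : ℕ} {w : Z → Alt d q}
    {z : EuclideanSpace ℝ (Fin d)} (he' : e' ∈ smoothCharts d Z) (hz : z ∈ e'.target)
    (h : SmoothFormAt κ w (e'.symm z)) : ContDiffAt ℝ ∞ (chartRep κ e' w) z := by
  have := h.contDiffAt hκ he' (e'.map_target hz)
  rwa [e'.right_inv hz] at this

theorem SmoothFormAt.congr_of_eventuallyEq {q : ℕ} {w w' : Z → Alt d q} {x : Z}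
    (h : SmoothFormAt κ w x) (hw : w' =ᶠ[𝓝 x] w) : SmoothFormAt κ w' x := by
  obtain ⟨e, he, hxe, hs⟩ := h
  refine ⟨e, he, hxe, hs.congr_of_eventuallyEq ?_⟩
  have hc : Tendsto e.symm (𝓝 (e x)) (𝓝 x) := by
    have := e.continuousAt_symm (e.map_source hxe)
    rwa [ContinuousAt, e.left_inv hxe] at this
  filter_upwards [hc.eventually hw] with z hz
  rw [chartRep, hz, chartRep]

theorem mem_chartDomain_iff (W : Set Z) (x₀ : Z) (z : EuclideanSpace ℝ (Fin d)) :
    z ∈ chartDomain d W x₀ ↔ z ∈ (chartAt (EuclideanSpace ℝ (Fin d)) x₀).target ∧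
      (chartAt (EuclideanSpace ℝ (Fin d)) x₀).symm z ∈ W := by
  rw [chartDomain, extChartAt_target_eq, extChartAt_symm_coe_eq]
  rfl

theorem isOpen_chartDomain {W : Set Z} (hW : IsOpen W) (x₀ : Z) :
    IsOpen (chartDomain d W x₀) := by
  have : chartDomain d W x₀ = (chartAt (EuclideanSpace ℝ (Fin d)) x₀).target ∩
      (chartAt (EuclideanSpace ℝ (Fin d)) x₀).symm ⁻¹' W := by
    ext z; exact mem_chartDomain_iff W x₀ z
  rw [this]
  exact OpenPartialHomeomorph.isOpen_inter_preimage_symm _ hW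

theorem forall_contDiffOn_iff (hκ : IsSignChar κ) {q : ℕ} {W : Set Z} (hW : IsOpen W)
    {w : Z → Alt d q} {f : Z → EuclideanSpace ℝ (Fin d) → Alt d q}
    (hf : ∀ x₀, ∀ z ∈ (chartAt (EuclideanSpace ℝ (Fin d)) x₀).target,
      f x₀ z = chartRep κ (chartAt _ x₀) w z) :
    (∀ x₀, ContDiffOn ℝ ∞ (f x₀) (chartDomain d W x₀)) ↔ ∀ x ∈ W, SmoothFormAt κ w x := by
  constructor
  · intro h x hx
    refine ⟨_, chartAt_mem_smoothCharts x, mem_chart_source _ x, ?_⟩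
    have hx' : chartAt (EuclideanSpace ℝ (Fin d)) x x ∈ chartDomain d W x := by
      rw [mem_chartDomain_iff]
      refine ⟨mem_chart_target _ x, ?_⟩
      rwa [OpenPartialHomeomorph.left_inv _ (mem_chart_source _ x)]
    refine ((h x).contDiffAt ((isOpen_chartDomain hW x).mem_nhds hx')).congr_of_eventuallyEq ?_
    filter_upwards [(isOpen_chartDomain hW x).mem_nhds hx'] with z hz
    exact (hf x z ((mem_chartDomain_iff _ _ _).1 hz).1).symm
  · intro h x₀ z hz
    have hz' := (mem_chartDomain_iff _ _ _).1 hz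
    refine (ContDiffAt.congr_of_eventuallyEq ((h _ hz'.2).contDiffAt_symm hκ
      (chartAt_mem_smoothCharts x₀) hz'.1) ?_).contDiffWithinAt
    filter_upwards [(isOpen_chartDomain hW x₀).mem_nhds hz] with y hy
    exact hf x₀ y ((mem_chartDomain_iff _ _ _).1 hy).1

theorem mem_formSections_iff {q : ℕ} {W : Set Z} (hW : IsOpen W) {w : Z → Alt d q} :
    w ∈ formSections d W q ↔ (∀ x, x ∉ W → w x = 0) ∧ ∀ x ∈ W, SmoothFormAt (fun _ => 1) w x :=
  and_congr Iff.rfl (forall_contDiffOn_iff isSignChar_one hW fun x₀ _ hz =>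
    localRep_eq_chartRep x₀ w hz)

theorem mem_twistedSections_iff {q : ℕ} {W : Set Z} (hW : IsOpen W) {w : Z → Alt d q} :
    w ∈ twistedSections d W q ↔ (∀ x, x ∉ W → w x = 0) ∧ ∀ x ∈ W, SmoothFormAt Real.sign w x :=
  and_congr Iff.rfl (forall_contDiffOn_iff isSignChar_sign hW fun x₀ _ hz =>
    twistedRep_eq_chartRep x₀ w hz)

/-- The de Rham differential at a point, in the preferred chart. -/
def chartD (κ : ℝ → ℝ) {q : ℕ} (w : Z → Alt d q) (x : Z) : Alt d (q + 1) :=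
  extDeriv (chartRep κ (chartAt _ x) w) (chartAt (EuclideanSpace ℝ (Fin d)) x x)

theorem dForm_eq {q : ℕ} (W : Set Z) (w : Z → Alt d q) :
    dForm W w = W.indicator (chartD (fun _ => 1) w) := by
  unfold dForm
  congr 1
  funext x
  rw [extChartAt_coe_eq, chartD]
  refine Filter.EventuallyEq.extDeriv_eq ?_
  filter_upwards
    [(chartAt (EuclideanSpace ℝ (Fin d)) x).open_target.mem_nhds (mem_chart_target _ x)]
    with z hz
  exact localRep_eq_chartRep x w hz

theorem dTwisted_eq {q : ℕ} (W : Set Z) (w : Z → Alt d q) :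
    dTwisted W w = W.indicator (chartD Real.sign w) := by
  unfold dTwisted
  congr 1
  funext x
  rw [extChartAt_coe_eq, chartD]
  refine Filter.EventuallyEq.extDeriv_eq ?_
  filter_upwards
    [(chartAt (EuclideanSpace ℝ (Fin d)) x).open_target.mem_nhds (mem_chart_target _ x)]
    with z hz
  exact twistedRep_eq_chartRep x w hz

/-- The de Rham differential may be computed in any chart. -/
theorem chartRep_chartD (hκ : IsSignChar κ) {q : ℕ} {w : Z → Alt d q}
    (he : e ∈ smoothCharts d Z) {z : EuclideanSpace ℝ (Fin d)} (hz : z ∈ e.target)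
    (h : SmoothFormAt κ w (e.symm z)) :
    chartRep κ e (chartD κ w) z = extDeriv (chartRep κ e w) z := by
  set x := e.symm z with hx
  have hxs : e.symm z ∈ (chartAt (EuclideanSpace ℝ (Fin d)) x).source := mem_chart_source _ _
  have hc := chartAt_mem_smoothCharts (d := d) x
  have hp := extDeriv_pullback (f := chartAt (EuclideanSpace ℝ (Fin d)) x ∘ e.symm) (x := z)
    (r := ∞) ((h.contDiffAt hκ hc hxs).differentiableAt (by simp))
    (contDiffAt_chart_comp_symm he hc hz hxs) (by
      rw [minSmoothness_of_isRCLikeNormedField]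
      exact WithTop.coe_le_coe.2 (le_top (a := (2 : ℕ∞))))
  rw [(chartRep_trans_eventuallyEq hκ hc he w hz hxs).extDeriv_eq, extDeriv_smul, hp]
  rfl

theorem smoothFormAt_chartD (hκ : IsSignChar κ) {q : ℕ} {w : Z → Alt d q} {x : Z}
    (h : ∀ᶠ y in 𝓝 x, SmoothFormAt κ w y) : SmoothFormAt κ (chartD κ w) x := by
  set e := chartAt (EuclideanSpace ℝ (Fin d)) x
  have he : e ∈ smoothCharts d Z := chartAt_mem_smoothCharts x
  have hx : x ∈ e.source := mem_chart_source _ x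
  refine ⟨e, he, hx, ?_⟩
  have hc : Tendsto e.symm (𝓝 (e x)) (𝓝 x) := by
    have := e.continuousAt_symm (e.map_source hx)
    rwa [ContinuousAt, e.left_inv hx] at this
  have heq : chartRep κ e (chartD κ w) =ᶠ[𝓝 (e x)] extDeriv (chartRep κ e w) := by
    filter_upwards [hc.eventually h, e.open_target.mem_nhds (e.map_source hx)] with z hz hz'
    exact chartRep_chartD hκ he hz' hz
  refine ContDiffAt.congr_of_eventuallyEq ?_ heq
  have := (h.self_of_nhds.contDiffAt hκ he hx).fderiv_right (m := ∞) (by simp)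
  exact (ContinuousAlternatingMap.alternatizeUncurryFinCLM ℝ _ ℂ).contDiff.contDiffAt.comp _ this

theorem chartRep_wedge {p q : ℕ} (a : Z → Alt d p) (b : Z → Alt d q)
    (z : EuclideanSpace ℝ (Fin d)) :
    chartRep κ e (fun x => wedge (a x) (b x)) z
      = wedge (chartRep κ e a z) (chartRep (fun _ => 1) e b z) := by
  rw [chartRep, chartRep, chartRep, one_smul, real_smul_wedge, wedge_compContinuousLinearMap]

theorem SmoothFormAt.wedge (hκ : IsSignChar κ) {p q : ℕ} {a : Z → Alt d p} {b : Z → Alt d q}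
    {x : Z} (ha : SmoothFormAt κ a x) (hb : SmoothFormAt (fun _ => 1) b x) :
    SmoothFormAt κ (fun x => TameResidue.wedge (a x) (b x)) x := by
  have he := chartAt_mem_smoothCharts (d := d) x
  have hx := mem_chart_source (EuclideanSpace ℝ (Fin d)) x
  refine ⟨_, he, hx, ?_⟩
  have : chartRep κ (chartAt _ x) (fun x => TameResidue.wedge (a x) (b x)) = fun z =>
      TameResidue.wedge (chartRep κ (chartAt _ x) a z) (chartRep (fun _ => 1) (chartAt _ x) b z) :=
    funext fun z => chartRep_wedge a b z
  rw [this]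
  exact contDiffAt_wedge (ha.contDiffAt hκ he hx) (hb.contDiffAt isSignChar_one he hx)

theorem chartRep_smul {q : ℕ} (f : Z → ℂ) (w : Z → Alt d q) (z : EuclideanSpace ℝ (Fin d)) :
    chartRep κ e (fun x => f x • w x) z = f (e.symm z) • chartRep κ e w z := by
  rw [chartRep, chartRep, smul_comm]
  rfl

theorem chartRep_add {q : ℕ} (w w' : Z → Alt d q) :
    chartRep κ e (w + w') = chartRep κ e w + chartRep κ e w' := by
  funext z
  rw [chartRep, Pi.add_apply, Pi.add_apply, chartRep, chartRep, ← smul_add]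
  rfl

theorem chartRep_const_smul {q : ℕ} (c : ℂ) (w : Z → Alt d q) :
    chartRep κ e (c • w) = c • chartRep κ e w := by
  funext z
  exact chartRep_smul (fun _ => c) w z

theorem SmoothFormAt.add (hκ : IsSignChar κ) {q : ℕ} {w w' : Z → Alt d q} {x : Z}
    (h : SmoothFormAt κ w x) (h' : SmoothFormAt κ w' x) : SmoothFormAt κ (w + w') x := by
  obtain ⟨e, he, hx, hs⟩ := h
  refine ⟨e, he, hx, ?_⟩
  rw [chartRep_add]
  exact hs.add (h'.contDiffAt hκ he hx)

theorem SmoothFormAt.const_smul {q : ℕ} (c : ℂ) {w : Z → Alt d q} {x : Z}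
    (h : SmoothFormAt κ w x) : SmoothFormAt κ (c • w) x := by
  obtain ⟨e, he, hx, hs⟩ := h
  refine ⟨e, he, hx, ?_⟩
  rw [chartRep_const_smul]
  exact contDiffAt_const.smul hs

/-- A function that is smooth in the sense of manifolds is smooth in every chart. -/
theorem contDiffAt_comp_symm {F : Type*} [NormedAddCommGroup F] [NormedSpace ℝ F] {f : Z → F}
    {x : Z} (hf : ContMDiffAt (𝓡 d) 𝓘(ℝ, F) ∞ f x) (he : e ∈ smoothCharts d Z)
    (hx : x ∈ e.source) : ContDiffAt ℝ ∞ (f ∘ e.symm) (e x) := by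
  have h1 := contMDiffOn_symm_of_mem_maximalAtlas he
  have h2 : ContMDiffAt (𝓡 d) (𝓡 d) ∞ e.symm (e x) :=
    h1.contMDiffAt (e.open_target.mem_nhds (e.map_source hx))
  have h3 : ContMDiffAt (𝓡 d) 𝓘(ℝ, F) ∞ f (e.symm (e x)) := by rwa [e.left_inv hx]
  exact (h3.comp (e x) h2).contDiffAt

theorem SmoothFormAt.smul {q : ℕ} {f : Z → ℂ} {w : Z → Alt d q} {x : Z}
    (hf : ContMDiffAt (𝓡 d) 𝓘(ℝ, ℂ) ∞ f x) (h : SmoothFormAt κ w x) :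
    SmoothFormAt κ (fun x => f x • w x) x := by
  obtain ⟨e, he, hx, hs⟩ := h
  refine ⟨e, he, hx, ?_⟩
  have : chartRep κ e (fun x => f x • w x) = fun z => (f ∘ e.symm) z • chartRep κ e w z :=
    funext fun z => chartRep_smul f w z
  rw [this]
  exact (contDiffAt_comp_symm hf he hx).smul hs

end Charts

/-! ### Integration of densities in a chart -/

section Density

variable {d : ℕ} {Z : Type*} [TopologicalSpace Z]
  [ChartedSpace (EuclideanSpace ℝ (Fin d)) Z] [IsManifold (𝓡 d) ∞ Z]

/-- A top degree form is multiplied by the determinant under pull-back. -/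
theorem top_comp_apply {q : ℕ} (h : q = d) (η : Alt d q)
    (T : EuclideanSpace ℝ (Fin d) →L[ℝ] EuclideanSpace ℝ (Fin d)) :
    (η.compContinuousLinearMap T) (fun j => EuclideanSpace.single (Fin.cast h j) (1 : ℝ))
      = T.det * η (fun j => EuclideanSpace.single (Fin.cast h j) (1 : ℝ)) := by
  subst h
  set b := (EuclideanSpace.basisFun (Fin q) ℝ).toBasis
  have hb : (fun j => EuclideanSpace.single j (1 : ℝ)) = ⇑b := by funext j; simp [b]
  have key : ∀ f : EuclideanSpace ℝ (Fin q) [⋀^Fin q]→ₗ[ℝ] ℝ,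
      f (fun j => T (b j)) = T.det * f b := by
    intro f
    have h1 := f.eq_smul_basis_det b
    rw [h1, AlternatingMap.smul_apply, AlternatingMap.smul_apply]
    have h2 := b.det_comp T.toLinearMap b
    have h3 : b.det (fun j => T (b j)) = b.det (⇑T.toLinearMap ∘ b) := rfl
    rw [h3, h2, smul_eq_mul, smul_eq_mul, ContinuousLinearMap.det]
    ring
  have hre := key (Complex.reLm.compAlternatingMap η.toAlternatingMap)
  have him := key (Complex.imLm.compAlternatingMap η.toAlternatingMap)
  simp only [Fin.cast_eq_self, hb]
  apply Complex.ext
  · rw [Complex.re_ofReal_mul]; exact hre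
  · rw [Complex.im_ofReal_mul]; exact him

theorem real_sign_mul_self (a : ℝ) : Real.sign a * a = |a| := by
  rcases lt_trichotomy a 0 with h | rfl | h
  · rw [Real.sign_of_neg h, abs_of_neg h, neg_one_mul]
  · simp
  · rw [Real.sign_of_pos h, abs_of_pos h, one_mul]

/-- The coefficient of a density in the chart `e`. -/
def chartDensity {q : ℕ} (e : OpenPartialHomeomorph Z (EuclideanSpace ℝ (Fin d)))
    (τ : Z → Alt d q) (h : q = d) (z : EuclideanSpace ℝ (Fin d)) : ℂ :=
  chartRep Real.sign e τ z (fun j => EuclideanSpace.single (Fin.cast h j) (1 : ℝ))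

variable {e e' : OpenPartialHomeomorph Z (EuclideanSpace ℝ (Fin d))}

theorem chartDensity_eq_abs {q : ℕ} (τ : Z → Alt d q) (h : q = d)
    (z : EuclideanSpace ℝ (Fin d)) :
    chartDensity e τ h z = (|(chartDeriv e z).det| : ℝ) *
      τ (e.symm z) (fun j => EuclideanSpace.single (Fin.cast h j) (1 : ℝ)) := by
  rw [chartDensity, chartRep, ContinuousAlternatingMap.smul_apply, top_comp_apply,
    Complex.real_smul, ← mul_assoc, ← Complex.ofReal_mul, real_sign_mul_self]

theorem chartDensity_trans {q : ℕ} (τ : Z → Alt d q) (h : q = d) (he : e ∈ smoothCharts d Z)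
    (he' : e' ∈ smoothCharts d Z) {z : EuclideanSpace ℝ (Fin d)} (hz : z ∈ e'.target)
    (hz' : e'.symm z ∈ e.source) :
    chartDensity e' τ h z
      = |(transDeriv e e' z).det| • chartDensity e τ h (e (e'.symm z)) := by
  rw [chartDensity_eq_abs, chartDensity_eq_abs, e.left_inv hz', chartDeriv_comp he he' hz hz',
    det_comp_clm, abs_mul, Complex.ofReal_mul, Complex.real_smul]
  ring

theorem chartDensity_smul {q : ℕ} (f : Z → ℂ) (τ : Z → Alt d q) (h : q = d)
    (z : EuclideanSpace ℝ (Fin d)) :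
    chartDensity e (fun x => f x • τ x) h z = f (e.symm z) * chartDensity e τ h z := by
  rw [chartDensity, chartRep_smul]
  rfl

theorem chartDensity_eq_zero {q : ℕ} {τ : Z → Alt d q} (h : q = d)
    {z : EuclideanSpace ℝ (Fin d)} (hz : τ (e.symm z) = 0) : chartDensity e τ h z = 0 := by
  rw [chartDensity_eq_abs, hz]
  simp

variable [T2Space Z] [SigmaCompactSpace Z]

theorem densityPiece_eq {q : ℕ} (τ : Z → Alt d q) (h : q = d) (x₀ : Z)
    {z : EuclideanSpace ℝ (Fin d)}
    (hz : z ∈ (chartAt (EuclideanSpace ℝ (Fin d)) x₀).target) :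
    densityPiece τ h x₀ z = (chartPartition d Z x₀ ((chartAt _ x₀).symm z) : ℂ) *
      chartDensity (chartAt _ x₀) τ h z := by
  rw [densityPiece, extChartAt_symm_coe_eq, twistedRep_eq_chartRep x₀ τ hz]
  rfl

theorem densityPiece_add {q : ℕ} (τ τ' : Z → Alt d q) (h : q = d) (x₀ : Z) :
    densityPiece (τ + τ') h x₀ = densityPiece τ h x₀ + densityPiece τ' h x₀ := by
  funext y
  rw [densityPiece, twistedRep_add, Pi.add_apply, Pi.add_apply, ContinuousAlternatingMap.add_apply,
    mul_add]
  rfl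

theorem chartPartition_eq_zero (x₀ : Z) {x : Z}
    (hx : x ∉ (chartAt (EuclideanSpace ℝ (Fin d)) x₀).source) : chartPartition d Z x₀ x = 0 := by
  by_contra h
  exact hx (chartPartition_isSubordinate x₀ (subset_tsupport _ h))

theorem finite_chartPartition_ne_zero {K : Set Z} (hK : IsCompact K) :
    {x₀ | ∃ x ∈ K, chartPartition d Z x₀ x ≠ 0}.Finite := by
  refine ((chartPartition d Z).locallyFinite.finite_nonempty_inter_compact hK).subset ?_
  rintro x₀ ⟨x, hx, h⟩
  exact ⟨x, h, hx⟩

theorem densityPiece_eq_zero_of_forall {q : ℕ} {τ : Z → Alt d q} (h : q = d) {K : Set Z}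
    (hτ : ∀ x, x ∉ K → τ x = 0) {x₀ : Z} (hx₀ : ∀ x ∈ K, chartPartition d Z x₀ x = 0)
    {z : EuclideanSpace ℝ (Fin d)}
    (hz : z ∈ (chartAt (EuclideanSpace ℝ (Fin d)) x₀).target) : densityPiece τ h x₀ z = 0 := by
  rw [densityPiece_eq τ h x₀ hz]
  by_cases hx : (chartAt (EuclideanSpace ℝ (Fin d)) x₀).symm z ∈ K
  · rw [hx₀ _ hx, Complex.ofReal_zero, zero_mul]
  · rw [chartDensity_eq_zero h (hτ _ hx), mul_zero]

theorem densityIntegral_eq_sum {q : ℕ} {τ : Z → Alt d q} (h : q = d) {K : Set Z}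
    (hτ : ∀ x, x ∉ K → τ x = 0) {s : Finset Z}
    (hs : ∀ x₀, x₀ ∉ s → ∀ x ∈ K, chartPartition d Z x₀ x = 0) :
    densityIntegral τ h
      = ∑ x₀ ∈ s, ∫ y in (extChartAt (𝓡 d) x₀).target, densityPiece τ h x₀ y := by
  refine finsum_eq_sum_of_support_subset _ fun x₀ hx₀ => ?_
  by_contra hcon
  refine hx₀ ?_
  simp only [extChartAt_target_eq]
  exact setIntegral_eq_zero_of_forall_eq_zero fun z hz =>
    densityPiece_eq_zero_of_forall h hτ (hs x₀ hcon) hz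

theorem densityIntegral_add {q : ℕ} {τ τ' : Z → Alt d q} (h : q = d) {K : Set Z}
    (hK : IsCompact K) (hτ : ∀ x, x ∉ K → τ x = 0) (hτ' : ∀ x, x ∉ K → τ' x = 0)
    (hi : DensityIntegrable τ h) (hi' : DensityIntegrable τ' h) :
    DensityIntegrable (τ + τ') h ∧
      densityIntegral (τ + τ') h = densityIntegral τ h + densityIntegral τ' h := by
  refine ⟨fun x₀ => ?_, ?_⟩
  · rw [densityPiece_add]
    exact (hi x₀).add (hi' x₀)
  · have hs : ∀ x₀, x₀ ∉ (finite_chartPartition_ne_zero (d := d) hK).toFinset →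
        ∀ x ∈ K, chartPartition d Z x₀ x = 0 := by
      intro x₀ hx₀ x hx
      by_contra hne
      exact hx₀ ((Set.Finite.mem_toFinset _).2 ⟨x, hx, hne⟩)
    rw [densityIntegral_eq_sum h hτ hs, densityIntegral_eq_sum h hτ' hs,
      densityIntegral_eq_sum h (fun x hx => by rw [Pi.add_apply, hτ x hx, hτ' x hx, add_zero]) hs,
      ← Finset.sum_add_distrib]
    refine Finset.sum_congr rfl fun x₀ _ => ?_
    rw [densityPiece_add]
    exact integral_add (hi x₀) (hi' x₀)

theorem densityIntegral_zero {q : ℕ} (h : q = d) :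
    DensityIntegrable (0 : Z → Alt d q) h ∧ densityIntegral (0 : Z → Alt d q) h = 0 := by
  have h0 : ∀ x₀ : Z, densityPiece (0 : Z → Alt d q) h x₀ = 0 := by
    intro x₀
    funext y
    rw [densityPiece, twistedRep_zero]
    exact mul_zero _
  refine ⟨fun x₀ => ?_, ?_⟩
  · rw [h0]; exact integrableOn_zero
  · unfold densityIntegral
    simp only [h0]
    simp

/-- The integral of a density supported in a compact subset of the domain of a chart can be
computed in this chart. -/
theorem densityIntegral_eq_of_chart {q : ℕ} {τ : Z → Alt d q} (h : q = d)
    (he : e ∈ smoothCharts d Z) {K : Set Z} (hK : IsCompact K) (hKe : K ⊆ e.source)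
    (hτ : ∀ x, x ∉ K → τ x = 0) (hi : IntegrableOn (chartDensity e τ h) e.target) :
    DensityIntegrable τ h ∧ densityIntegral τ h = ∫ z in e.target, chartDensity e τ h z := by
  -- One piece of the integral, by a change of variables.
  have piece : ∀ x₀ : Z,
      IntegrableOn (densityPiece τ h x₀) (chartAt (EuclideanSpace ℝ (Fin d)) x₀).target ∧
      IntegrableOn (fun z => (chartPartition d Z x₀ (e.symm z) : ℂ) * chartDensity e τ h z)
        e.target ∧
      ∫ y in (chartAt (EuclideanSpace ℝ (Fin d)) x₀).target, densityPiece τ h x₀ y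
        = ∫ z in e.target, (chartPartition d Z x₀ (e.symm z) : ℂ) * chartDensity e τ h z := by
    intro x₀
    set c := chartAt (EuclideanSpace ℝ (Fin d)) x₀ with hc
    have hcs : c ∈ smoothCharts d Z := chartAt_mem_smoothCharts x₀
    set D := e.target ∩ e.symm ⁻¹' c.source
    have hD : IsOpen D := e.isOpen_inter_preimage_symm c.open_source
    have hder : ∀ z ∈ D, HasFDerivWithinAt (c ∘ e.symm) (transDeriv c e z) D z := fun z hz =>
      ((contDiffAt_chart_comp_symm he hcs hz.1 hz.2).differentiableAt
        (by simp)).hasFDerivAt.hasFDerivWithinAt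
    have hinj : InjOn (c ∘ e.symm) D := by
      intro z hz z' hz' hzz
      exact e.symm.injOn hz.1 hz'.1 (c.injOn hz.2 hz'.2 hzz)
    have himg : (c ∘ e.symm) '' D ⊆ c.target := by
      rintro _ ⟨z, hz, rfl⟩
      exact c.map_source hz.2
    have hzero : ∀ y ∈ c.target \ (c ∘ e.symm) '' D, densityPiece τ h x₀ y = 0 := by
      rintro y ⟨hy, hyD⟩
      rw [densityPiece_eq τ h x₀ hy, chartDensity_eq_zero h (hτ _ fun hyK => hyD ?_), mul_zero]
      refine ⟨e (c.symm y), ⟨e.map_source (hKe hyK), ?_⟩, ?_⟩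
      · rw [mem_preimage, e.left_inv (hKe hyK)]
        exact c.map_target hy
      · rw [Function.comp_apply, e.left_inv (hKe hyK), c.right_inv hy]
    have hmeas : MeasurableSet ((c ∘ e.symm) '' D) :=
      measurable_image_of_fderivWithin hD.measurableSet hder hinj
    have hpt : ∀ z ∈ D, |(transDeriv c e z).det| • densityPiece τ h x₀ ((c ∘ e.symm) z)
        = (chartPartition d Z x₀ (e.symm z) : ℂ) * chartDensity e τ h z := by
      intro z hz
      rw [densityPiece_eq τ h x₀ (himg ⟨z, hz, rfl⟩), chartDensity_trans τ h hcs he hz.1 hz.2,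
        Function.comp_apply, ← hc, c.left_inv hz.2, Complex.real_smul, Complex.real_smul]
      ring
    have hint : IntegrableOn (fun z => (chartPartition d Z x₀ (e.symm z) : ℂ) *
        chartDensity e τ h z) e.target := by
      refine Integrable.bdd_mul (c := 1) hi ?_ ?_
      · refine ContinuousOn.aestronglyMeasurable ?_ e.open_target.measurableSet
        exact Complex.continuous_ofReal.comp_continuousOn
          ((chartPartition d Z x₀).contMDiff.continuous.comp_continuousOn e.continuousOn_symm)
      · refine Eventually.of_forall fun z => ?_
        rw [Complex.norm_real, Real.norm_of_nonneg ((chartPartition d Z).nonneg x₀ _)]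
        exact (chartPartition d Z).le_one x₀ _
    have hDe : D ⊆ e.target := inter_subset_left
    refine ⟨?_, hint, ?_⟩
    · have h1 : IntegrableOn (densityPiece τ h x₀) ((c ∘ e.symm) '' D) := by
        rw [integrableOn_image_iff_integrableOn_abs_det_fderiv_smul volume hD.measurableSet
          hder hinj]
        exact (hint.mono_set hDe).congr_fun (fun z hz => (hpt z hz).symm) hD.measurableSet
      exact h1.of_forall_sdiff_eq_zero c.open_target.measurableSet hzero
    · rw [setIntegral_eq_of_subset_of_forall_sdiff_eq_zero c.open_target.measurableSet himg hzero,
        integral_image_eq_integral_abs_det_fderiv_smul volume hD.measurableSet hder hinj,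
        setIntegral_congr_fun hD.measurableSet hpt]
      refine (setIntegral_eq_of_subset_of_forall_sdiff_eq_zero e.open_target.measurableSet hDe
        ?_).symm
      rintro z ⟨hz, hzD⟩
      rw [chartPartition_eq_zero x₀ fun hmem => hzD ⟨hz, hmem⟩, Complex.ofReal_zero, zero_mul]
  refine ⟨fun x₀ => ?_, ?_⟩
  · rw [extChartAt_target_eq]
    exact (piece x₀).1
  set s := (finite_chartPartition_ne_zero (d := d) hK).toFinset
  have hs : ∀ x₀, x₀ ∉ s → ∀ x ∈ K, chartPartition d Z x₀ x = 0 := by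
    intro x₀ hx₀ x hx
    by_contra hne
    exact hx₀ ((Set.Finite.mem_toFinset _).2 ⟨x, hx, hne⟩)
  rw [densityIntegral_eq_sum h hτ hs]
  simp only [extChartAt_target_eq, (piece _).2.2]
  rw [← integral_finsetSum s fun x₀ _ => (piece x₀).2.1]
  refine setIntegral_congr_fun e.open_target.measurableSet fun z hz => ?_
  rw [← Finset.sum_mul]
  by_cases hx : e.symm z ∈ K
  · have h1 : ∑ x₀ ∈ s, chartPartition d Z x₀ (e.symm z) = 1 := by
      rw [← (chartPartition d Z).sum_eq_one (mem_univ (e.symm z))]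
      refine (finsum_eq_sum_of_support_subset _ fun x₀ hx₀ => ?_).symm
      by_contra hcon
      exact hx₀ (hs x₀ hcon _ hx)
    rw [← Complex.ofReal_sum, h1, Complex.ofReal_one, one_mul]
  · rw [chartDensity_eq_zero h (hτ _ hx), mul_zero]

/-! ### Elementary properties of the residue `I₀` -/

theorem zetaDensity_add {q : ℕ} (o : ManifoldOrientation d Z) (μ : Z → ℝ) (w w' : Z → Alt d q)
    (s : ℂ) : zetaDensity o μ (w + w') s = zetaDensity o μ w s + zetaDensity o μ w' s := by
  funext x
  simp only [zetaDensity, Pi.add_apply, smul_add]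

theorem HasI0.add {q : ℕ} {o : ManifoldOrientation d Z} {μ : Z → ℝ} {w w' : Z → Alt d q}
    {h : q = d} {c c' : ℂ} {K : Set Z} (hK : IsCompact K) (hw : ∀ x, x ∉ K → w x = 0)
    (hw' : ∀ x, x ∉ K → w' x = 0) (hc : HasI0 o μ w h c) (hc' : HasI0 o μ w' h c') :
    HasI0 o μ (w + w') h (c + c') := by
  obtain ⟨ζ, a, hζ, hi, hl⟩ := hc
  obtain ⟨ζ', a', hζ', hi', hl'⟩ := hc'
  refine ⟨ζ + ζ', max a a', fun x => (hζ x).add (hζ' x), fun s hs => ?_, ?_⟩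
  · obtain ⟨h1, h2⟩ := hi s (lt_of_le_of_lt (le_max_left _ _) hs)
    obtain ⟨h1', h2'⟩ := hi' s (lt_of_le_of_lt (le_max_right _ _) hs)
    rw [zetaDensity_add]
    have := densityIntegral_add h hK
      (fun x hx => by rw [zetaDensity, hw x hx, smul_zero])
      (fun x hx => by rw [zetaDensity, hw' x hx, smul_zero]) h1 h1'
    exact ⟨this.1, by rw [this.2, Pi.add_apply, h2, h2']⟩
  · refine (hl.add hl').congr fun s => ?_
    rw [Pi.add_apply, mul_add]

theorem hasI0_zero {q : ℕ} (o : ManifoldOrientation d Z) (μ : Z → ℝ) (h : q = d) :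
    HasI0 o μ (0 : Z → Alt d q) h 0 := by
  refine ⟨0, 0, fun x => MeromorphicAt.const 0 x, fun s _ => ?_, ?_⟩
  · have : zetaDensity o μ (0 : Z → Alt d q) s = 0 := by
      funext x
      simp [zetaDensity]
    rw [this]
    exact ⟨(densityIntegral_zero h).1, (densityIntegral_zero h).2.symm⟩
  · simp

/-- The residue is unique, by the identity theorem for meromorphic functions. -/
theorem HasI0.unique {q : ℕ} {o : ManifoldOrientation d Z} {μ : Z → ℝ} {w : Z → Alt d q}
    {h : q = d} {c c' : ℂ} (hc : HasI0 o μ w h c) (hc' : HasI0 o μ w h c') : c = c' := by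
  obtain ⟨ζ, a, hζ, hi, hl⟩ := hc
  obtain ⟨ζ', a', hζ', hi', hl'⟩ := hc'
  have hm : MeromorphicOn (ζ - ζ') univ := fun x _ => (hζ x).sub (hζ' x)
  set s₀ : ℂ := ((max a a' + 1 : ℝ) : ℂ)
  have h0 : meromorphicOrderAt (ζ - ζ') s₀ = ⊤ := by
    rw [meromorphicOrderAt_eq_top_iff]
    have hopen : IsOpen {s : ℂ | max a a' < s.re} :=
      isOpen_lt continuous_const Complex.continuous_re
    have hs₀ : s₀ ∈ {s : ℂ | max a a' < s.re} := by
      rw [mem_ofPred_eq, Complex.ofReal_re]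
      exact lt_add_one _
    filter_upwards [mem_nhdsWithin_of_mem_nhds (hopen.mem_nhds hs₀)] with s hs
    rw [Pi.sub_apply, (hi s (lt_of_le_of_lt (le_max_left _ _) hs)).2,
      (hi' s (lt_of_le_of_lt (le_max_right _ _) hs)).2, sub_self]
  have h1 : meromorphicOrderAt (ζ - ζ') 0 = ⊤ := by
    by_contra hne
    exact hm.meromorphicOrderAt_ne_top_of_isPreconnected isPreconnected_univ (mem_univ 0)
      (mem_univ s₀) hne h0
  rw [meromorphicOrderAt_eq_top_iff] at h1
  refine tendsto_nhds_unique hl (hl'.congr' ?_)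
  filter_upwards [h1] with s hs
  rw [Pi.sub_apply, sub_eq_zero] at hs
  rw [hs]

end Density

/-! ### Mellin transforms of smooth functions with compact support -/

section Mellin

theorem isBigO_atTop_of_hasCompactSupport {f : ℝ → ℂ} (hf : HasCompactSupport f) (a : ℝ) :
    f =O[atTop] fun t : ℝ => t ^ (-a) := by
  have h : f =ᶠ[atTop] fun _ => (0 : ℂ) := by
    obtain ⟨R, hR⟩ := hf.isCompact.isBounded.subset_closedBall 0
    filter_upwards [eventually_gt_atTop R] with t ht
    by_contra hne
    have := hR (subset_tsupport f hne)
    rw [mem_closedBall_zero_iff, Real.norm_eq_abs] at this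
    exact absurd ((le_abs_self t).trans this) (not_le.2 ht)
  exact h.trans_isBigO (Asymptotics.isBigO_zero _ _)

theorem isBigO_zero_of_continuous {f : ℝ → ℂ} (hf : Continuous f) :
    f =O[𝓝[>] 0] fun t : ℝ => t ^ (-(0 : ℝ)) := by
  simp only [neg_zero, Real.rpow_zero]
  exact ((hf.tendsto 0).mono_left nhdsWithin_le_nhds).isBigO_one ℝ

theorem mellinConvergent_of_hasCompactSupport {f : ℝ → ℂ} (hf : Continuous f)
    (hc : HasCompactSupport f) {s : ℂ} (hs : 0 < s.re) : MellinConvergent f s :=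
  mellinConvergent_of_isBigO_rpow (hf.locallyIntegrable.locallyIntegrableOn _)
    (isBigO_atTop_of_hasCompactSupport hc (s.re + 1)) (by linarith)
    (isBigO_zero_of_continuous hf) hs

theorem differentiableAt_mellin_of_hasCompactSupport {f : ℝ → ℂ} (hf : Continuous f)
    (hc : HasCompactSupport f) {s : ℂ} (hs : 0 < s.re) : DifferentiableAt ℂ (mellin f) s :=
  mellin_differentiableAt_of_isBigO_rpow (hf.locallyIntegrable.locallyIntegrableOn _)
    (isBigO_atTop_of_hasCompactSupport hc (s.re + 1)) (by linarith)
    (isBigO_zero_of_continuous hf) hs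

/-- Integration by parts; the right-hand side makes sense for `-1 < re s`, `s ≠ 0`. -/
theorem mellin_eq_neg_mellin_deriv_div {f : ℝ → ℂ} (hf : ContDiff ℝ ∞ f)
    (hc : HasCompactSupport f) {s : ℂ} (hs : 0 < s.re) :
    mellin f s = -mellin (deriv f) (s + 1) / s := by
  have hs0 : s ≠ 0 := by
    rintro rfl
    simp at hs
  have hf' : Continuous (deriv f) := hf.continuous_deriv (by simp)
  have h1 := mellinConvergent_of_hasCompactSupport hf.continuous hc hs
  have h2 := mellinConvergent_of_hasCompactSupport (s := s + 1) hf' hc.deriv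
    (by simp; linarith)
  have key := integral_Ioi_mul_deriv_eq_deriv_mul (a := 0) (a' := 0) (b' := 0)
    (u := fun t : ℝ => (t : ℂ) ^ s) (u' := fun t : ℝ => s * (t : ℂ) ^ (s - 1)) (v := f)
    (v' := deriv f) ?_ ?_ ?_ ?_ ?_ ?_
  · simp only [zero_sub, sub_zero] at key
    rw [eq_div_iff hs0]
    simp only [mellin, add_sub_cancel_right, smul_eq_mul]
    rw [key, neg_neg, mul_comm, ← integral_const_mul]
    simp only [mul_assoc]
  · intro x hx
    exact hasDerivAt_ofReal_cpow_const (ne_of_gt hx) hs0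
  · intro x _
    exact (hf.differentiable (by simp) x).hasDerivAt
  · refine h2.congr ?_
    exact Eventually.of_forall fun t => by simp
  · refine (h1.const_mul s).congr ?_
    exact Eventually.of_forall fun t => by simp [mul_assoc]
  · have : Tendsto (fun t : ℝ => (t : ℂ) ^ s * f t) (𝓝[>] 0) (𝓝 ((0 : ℝ) ^ s * f 0)) := by
      refine Tendsto.mono_left ?_ nhdsWithin_le_nhds
      exact ((Complex.continuous_ofReal_cpow_const hs).mul hf.continuous).tendsto 0
    simp only [Complex.ofReal_zero, Complex.zero_cpow hs0, zero_mul] at this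
    exact this
  · refine tendsto_nhds_of_eventually_eq ?_
    obtain ⟨R, hR⟩ := hc.isCompact.isBounded.subset_closedBall 0
    filter_upwards [eventually_gt_atTop R] with t ht
    have : f t = 0 := by
      by_contra hne
      have := hR (subset_tsupport f hne)
      rw [mem_closedBall_zero_iff, Real.norm_eq_abs] at this
      exact absurd ((le_abs_self t).trans this) (not_le.2 ht)
    simp [this]

/-- The expression for the Mellin transform of `f` given by `N` integrations by parts; it is
meromorphic on the half plane `-N < re s`. -/
def mellinByParts : ℕ → (ℝ → ℂ) → ℂ → ℂ
  | 0, f, s => mellin f s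
  | N + 1, f, s => -mellinByParts N (deriv f) (s + 1) / s

theorem meromorphicAt_mellinByParts (N : ℕ) {f : ℝ → ℂ} (hf : ContDiff ℝ ∞ f)
    (hc : HasCompactSupport f) {s : ℂ} (hs : -(N : ℝ) < s.re) :
    MeromorphicAt (mellinByParts N f) s := by
  induction N generalizing f s with
  | zero =>
    have ho : IsOpen {z : ℂ | 0 < z.re} := isOpen_lt continuous_const Complex.continuous_re
    have hs' : 0 < s.re := by simpa using hs
    have hd : DifferentiableOn ℂ (mellin f) {z : ℂ | 0 < z.re} := fun z hz =>
      (differentiableAt_mellin_of_hasCompactSupport hf.continuous hc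
        hz).differentiableWithinAt
    exact (hd.analyticAt (ho.mem_nhds hs')).meromorphicAt
  | succ N ih =>
    have h := ih (f := deriv f) (s := s + 1) (contDiff_infty_iff_deriv.1 hf).2 hc.deriv
      (by push_cast at hs; simp; linarith)
    have h' : MeromorphicAt (fun z => mellinByParts N (deriv f) (z + 1)) s :=
      h.comp_analyticAt (f := mellinByParts N (deriv f)) (g := fun z => z + 1)
        (analyticAt_id.add analyticAt_const)
    exact h'.neg.div (MeromorphicAt.id s)

theorem mellinByParts_succ (N : ℕ) {f : ℝ → ℂ} (hf : ContDiff ℝ ∞ f)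
    (hc : HasCompactSupport f) {s : ℂ} (hs : -(N : ℝ) < s.re) :
    mellinByParts (N + 1) f s = mellinByParts N f s := by
  induction N generalizing f s with
  | zero => exact (mellin_eq_neg_mellin_deriv_div hf hc (by simpa using hs)).symm
  | succ N ih =>
    change -mellinByParts (N + 1) (deriv f) (s + 1) / s = -mellinByParts N (deriv f) (s + 1) / s
    rw [ih (contDiff_infty_iff_deriv.1 hf).2 hc.deriv (by push_cast at hs; simp; linarith)]

theorem mellinByParts_eq_of_le {N M : ℕ} (h : N ≤ M) {f : ℝ → ℂ} (hf : ContDiff ℝ ∞ f)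
    (hc : HasCompactSupport f) {s : ℂ} (hs : -(N : ℝ) < s.re) :
    mellinByParts M f s = mellinByParts N f s := by
  induction M, h using Nat.le_induction with
  | base => rfl
  | succ M hM ih =>
    rw [mellinByParts_succ M hf hc, ih]
    have : (N : ℝ) ≤ M := by exact_mod_cast hM
    linarith

/-- The Mellin transform of a smooth function `f` with compact support has a meromorphic
continuation, with at most a simple pole at `0`, where its residue is `f 0`. -/
theorem exists_meromorphic_mellin {f : ℝ → ℂ} (hf : ContDiff ℝ ∞ f) (hc : HasCompactSupport f) :
    ∃ ζ : ℂ → ℂ, Meromorphic ζ ∧ (∀ s : ℂ, 0 < s.re → ζ s = mellin f s) ∧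
      Tendsto (fun s => s * ζ s) (𝓝[≠] 0) (𝓝 (f 0)) := by
  have hfl : ∀ s : ℂ, -((⌊-s.re⌋₊ + 1 : ℕ) : ℝ) < s.re := fun s => by
    have := Nat.lt_floor_add_one (-s.re)
    push_cast
    linarith
  -- Near every point, the continuation is one of the functions `mellinByParts N f`.
  have hloc : ∀ (N : ℕ) (s₀ : ℂ), -(N : ℝ) < s₀.re →
      ∀ᶠ s in 𝓝 s₀, mellinByParts (⌊-s.re⌋₊ + 1) f s = mellinByParts N f s := by
    intro N s₀ h
    filter_upwards [(isOpen_lt continuous_const Complex.continuous_re).mem_nhds h] with s hs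
    rcases le_total N (⌊-s.re⌋₊ + 1) with hle | hle
    · exact mellinByParts_eq_of_le hle hf hc hs
    · exact (mellinByParts_eq_of_le hle hf hc (hfl s)).symm
  -- The number of integrations by parts is chosen large enough for convergence at each point.
  refine ⟨fun s => mellinByParts (⌊-s.re⌋₊ + 1) f s, fun s₀ => ?_, fun s hs => ?_, ?_⟩
  · refine (meromorphicAt_mellinByParts _ hf hc (hfl s₀)).congr ?_
    exact ((hloc _ s₀ (hfl s₀)).filter_mono nhdsWithin_le_nhds).mono fun _ h => h.symm
  · exact mellinByParts_eq_of_le (Nat.zero_le _) hf hc (by simpa using hs)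
  · have h1 : Tendsto (fun s : ℂ => -mellin (deriv f) (s + 1)) (𝓝[≠] 0)
        (𝓝 (-mellin (deriv f) (0 + 1))) := by
      refine Tendsto.mono_left ?_ nhdsWithin_le_nhds
      have hd := (differentiableAt_mellin_of_hasCompactSupport (s := 0 + 1)
        (hf.continuous_deriv (by simp)) hc.deriv (by simp)).continuousAt
      exact (ContinuousAt.comp (f := fun s : ℂ => s + 1) (x := 0) hd (by fun_prop)).neg
    have h2 : -mellin (deriv f) (0 + 1) = f 0 := by
      rw [mellin]
      have := hc.integral_Ioi_deriv_eq (hf.of_le (by simp)) 0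
      simp [this]
    rw [h2] at h1
    refine h1.congr' ?_
    have h3 := (hloc 1 0 (by simp)).filter_mono (nhdsWithin_le_nhds (s := {0}ᶜ))
    filter_upwards [h3, self_mem_nhdsWithin] with s hs hs0
    have hs0' : s ≠ 0 := hs0
    rw [hs]
    change _ = s * (-mellin (deriv f) (s + 1) / s)
    field_simp

end Mellin

/-! ### Zeta functions of powers of the norm -/

section Radial

theorem contDiff_integral_of_hasCompactSupport {P G F : Type*} [NormedAddCommGroup P]
    [NormedSpace ℝ P] [NormedAddCommGroup G] [NormedSpace ℝ G] [MeasurableSpace G] [BorelSpace G]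
    [NormedAddCommGroup F] [NormedSpace ℝ F]
    (ν : Measure G) [IsLocallyFiniteMeasure ν] {b : P → G → F} {K : Set G} (hK : IsCompact K)
    (hb : ContDiff ℝ ∞ (fun q : P × G => b q.1 q.2)) (h0 : ∀ p x, x ∉ K → b p x = 0) :
    ContDiff ℝ ∞ fun p => ∫ x, b p x ∂ν := by
  have hg : ContDiff ℝ ∞ (fun q : P × G => b q.1 (-q.2)) :=
    hb.comp (contDiff_fst.prodMk contDiff_snd.neg)
  have key := contDiffOn_convolution_right_with_param_comp (n := (⊤ : ℕ∞)) (𝕜 := ℝ) (μ := ν)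
    (ContinuousLinearMap.lsmul ℝ ℝ) (s := (univ : Set P)) (v := fun _ => (0 : G))
    (f := fun _ => (1 : ℝ)) (g := fun p x => b p (-x)) (k := -K) contDiffOn_const isOpen_univ
    hK.neg ?_ (locallyIntegrable_const 1) ?_
  · rw [contDiffOn_univ] at key
    convert key using 2 with p
    simp [convolution_def]
  · intro p x _ hx
    exact h0 p (-x) (by simpa using hx)
  · exact hg.contDiffOn

/-- If `ν` is concentrated on the unit ball, no support condition is needed: the integrand can be
multiplied by a cut-off function. -/
theorem contDiff_integral_of_ae_mem_closedBall {P G F : Type*} [NormedAddCommGroup P]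
    [NormedSpace ℝ P] [NormedAddCommGroup G] [NormedSpace ℝ G] [FiniteDimensional ℝ G]
    [HasContDiffBump G] [MeasurableSpace G] [BorelSpace G] [NormedAddCommGroup F] [NormedSpace ℝ F]
    (ν : Measure G) [IsLocallyFiniteMeasure ν] (hν : ∀ᵐ x ∂ν, x ∈ Metric.closedBall (0 : G) 1)
    {b : P → G → F} (hb : ContDiff ℝ ∞ (fun q : P × G => b q.1 q.2)) :
    ContDiff ℝ ∞ fun p => ∫ x, b p x ∂ν := by
  let χ : ContDiffBump (0 : G) := ⟨1, 2, one_pos, one_lt_two⟩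
  have key := contDiff_integral_of_hasCompactSupport ν (b := fun p x => χ x • b p x)
    (K := Metric.closedBall 0 2) (isCompact_closedBall _ _) ?_ ?_
  · convert key using 2 with p
    refine integral_congr_ae (hν.mono fun x hx => ?_)
    simp [χ.one_of_mem_closedBall hx]
  · exact (χ.contDiff.comp contDiff_snd).smul hb
  · intro t x hx
    have : χ x = 0 := by
      by_contra hne
      have := subset_tsupport χ (show x ∈ Function.support χ from hne)
      rw [χ.tsupport_eq] at this
      exact hx this
    simp [this]

variable {m : ℕ}

local notation "E" => EuclideanSpace ℝ (Fin m)

/-- Integration in polar coordinates. -/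
theorem integral_eq_integral_Ioi_integral_sphere (hm : 0 < m) {F : E → ℂ} (hF : Integrable F) :
    ∫ x, F x = ∫ t in Ioi (0 : ℝ), (t ^ (m - 1) : ℝ) •
      ∫ θ : Metric.sphere (0 : E) 1, F (t • (θ : E)) ∂(volume : Measure E).toSphere := by
  have : Nonempty (Fin m) := ⟨⟨0, hm⟩⟩
  have : Nontrivial E := inferInstance
  have hd : Module.finrank ℝ E = m := by simp
  have hmp := (volume : Measure E).measurePreserving_homeomorphUnitSphereProd
  have hme := (homeomorphUnitSphereProd E).measurableEmbedding
  set G : Metric.sphere (0 : E) 1 × Ioi (0 : ℝ) → ℂ := fun p => F ((p.2 : ℝ) • (p.1 : E)) with hG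
  have hGF : ∀ x : ({0}ᶜ : Set E), G (homeomorphUnitSphereProd E x) = F x := by
    intro x
    have hx : ‖(x : E)‖ ≠ 0 := norm_ne_zero_iff.2 x.2
    simp only [hG, homeomorphUnitSphereProd_apply_snd_coe, homeomorphUnitSphereProd_apply_fst_coe]
    rw [smul_smul, mul_inv_cancel₀ hx, one_smul]
  have hGi : Integrable G ((volume : Measure E).toSphere.prod
      (.volumeIoiPow (Module.finrank ℝ E - 1))) := by
    rw [← hmp.integrable_comp_emb hme]
    have : G ∘ homeomorphUnitSphereProd E = F ∘ Subtype.val := funext hGF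
    rw [this, ← integrableOn_iff_comap_subtypeVal (measurableSet_singleton _).compl]
    exact hF.integrableOn
  calc ∫ x, F x = ∫ x : ({(0)}ᶜ : Set E), F x.1 ∂((volume : Measure E).comap (↑)) := by
        rw [integral_subtype_comap (measurableSet_singleton _).compl F, restrict_compl_singleton]
    _ = ∫ x, G x ∂(volume : Measure E).toSphere.prod
          (.volumeIoiPow (Module.finrank ℝ E - 1)) := by
        rw [← hmp.integral_comp hme]
        exact integral_congr_ae (Eventually.of_forall fun x => (hGF x).symm)
    _ = ∫ t : Ioi (0 : ℝ), ∫ θ, G (θ, t) ∂(volume : Measure E).toSphere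
          ∂(.volumeIoiPow (Module.finrank ℝ E - 1)) := integral_prod_symm _ hGi
    _ = _ := by
      rw [hd]
      simp only [Measure.volumeIoiPow, ENNReal.ofReal]
      rw [integral_withDensity_eq_integral_smul,
        integral_subtype_comap measurableSet_Ioi fun t : ℝ => Real.toNNReal (t ^ (m - 1)) •
          ∫ θ : Metric.sphere (0 : E) 1, F (t • (θ : E)) ∂(volume : Measure E).toSphere,
        setIntegral_congr_fun measurableSet_Ioi fun x hx => ?_]
      · simp only [NNReal.smul_def]
        rw [Real.coe_toNNReal _ (pow_nonneg (le_of_lt hx) _)]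
      · exact (measurable_subtype_coe.pow_const _).real_toNNReal

theorem continuous_norm_cpow {V : Type*} [NormedAddCommGroup V] {s : ℂ} (hs : 0 < s.re) :
    Continuous fun x : V => (‖x‖ : ℂ) ^ s :=
  (Complex.continuous_ofReal_cpow_const hs).comp continuous_norm

/-- The average over spheres of radius `t` of a smooth function is a smooth function of `t`. -/
theorem contDiff_integral_sphere {h : E → ℂ} (hh : ContDiff ℝ ∞ h) :
    ContDiff ℝ ∞ fun t : ℝ => ∫ θ : Metric.sphere (0 : E) 1, h (t • (θ : E))
      ∂(volume : Measure E).toSphere := by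
  have hme : MeasurableEmbedding (Subtype.val : Metric.sphere (0 : E) 1 → E) :=
    MeasurableEmbedding.subtype_coe Metric.isClosed_sphere.measurableSet
  have key := contDiff_integral_of_ae_mem_closedBall (P := ℝ)
    ((volume : Measure E).toSphere.map Subtype.val) (b := fun t x => h (t • x))
    (hme.ae_map_iff.2 (Eventually.of_forall fun θ => Metric.sphere_subset_closedBall θ.2))
    (hh.comp (contDiff_fst.smul contDiff_snd))
  convert key using 2 with t
  rw [hme.integral_map]

theorem integrable_norm_cpow_mul {h : E → ℂ} (hh : Continuous h) (hc : HasCompactSupport h)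
    {s : ℂ} (hs : 0 < s.re) : Integrable fun x => (‖x‖ : ℂ) ^ s * h x :=
  ((continuous_norm_cpow hs).mul hh).integrable_of_hasCompactSupport hc.mul_left

/-- The function `s ↦ ∫ ‖x‖ ^ (s - m) h x` has a meromorphic continuation with at most a simple
pole at `0`, where its residue is the volume of the sphere multiplied by `h 0`. -/
theorem exists_meromorphic_integral_norm_cpow (hm : 0 < m) {h : E → ℂ} (hh : ContDiff ℝ ∞ h)
    (hc : HasCompactSupport h) :
    ∃ ζ : ℂ → ℂ, Meromorphic ζ ∧
      (∀ s : ℂ, (m : ℝ) < s.re → ζ s = ∫ x, (‖x‖ : ℂ) ^ (s - m) * h x) ∧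
      Tendsto (fun s => s * ζ s) (𝓝[≠] 0)
        (𝓝 (((volume : Measure E).toSphere.real univ : ℂ) * h 0)) := by
  -- In polar coordinates, the integral is the Mellin transform of the spherical average `f` of `h`.
  set f : ℝ → ℂ := fun t => ∫ θ : Metric.sphere (0 : E) 1, h (t • (θ : E))
      ∂(volume : Measure E).toSphere with hf
  have hfs : ContDiff ℝ ∞ f := contDiff_integral_sphere hh
  have hfc : HasCompactSupport f := by
    obtain ⟨R, hR⟩ := hc.isCompact.isBounded.subset_closedBall 0
    refine HasCompactSupport.intro (isCompact_closedBall (0 : ℝ) R) fun t ht => ?_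
    have : ∀ θ : Metric.sphere (0 : E) 1, h (t • (θ : E)) = 0 := by
      intro θ
      by_contra hne
      have h1 := hR (subset_tsupport h hne)
      have h2 : ‖(θ : E)‖ = 1 := mem_sphere_zero_iff_norm.1 θ.2
      rw [mem_closedBall_zero_iff, norm_smul, h2, mul_one] at h1
      exact ht (mem_closedBall_zero_iff.2 h1)
    simp [hf, this]
  obtain ⟨ζ, h1, h2, h3⟩ := exists_meromorphic_mellin hfs hfc
  refine ⟨ζ, h1, fun s hs => ?_, ?_⟩
  · have hm' : (0 : ℝ) < m := by exact_mod_cast hm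
    rw [h2 s (hm'.trans hs), integral_eq_integral_Ioi_integral_sphere hm
      (integrable_norm_cpow_mul hh.continuous hc (by simpa using hs)), mellin]
    refine setIntegral_congr_fun measurableSet_Ioi fun t ht => ?_
    have ht0 : 0 < t := ht
    have h4 : ∀ θ : Metric.sphere (0 : E) 1, ‖t • (θ : E)‖ = t := fun θ => by
      rw [norm_smul, mem_sphere_zero_iff_norm.1 θ.2, mul_one, Real.norm_of_nonneg ht0.le]
    simp only [h4, hf, smul_eq_mul, Complex.real_smul]
    rw [integral_const_mul, ← mul_assoc]
    congr 1
    push_cast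
    rw [← Complex.cpow_natCast, ← Complex.cpow_add _ _ (Complex.ofReal_ne_zero.2 ht0.ne')]
    congr 1
    push_cast [Nat.cast_sub (Nat.one_le_iff_ne_zero.2 hm.ne')]
    ring
  · convert h3 using 2
    simp [hf]

/-- For a smooth function `a` with compact support on `ℝᵐ × ℝᵏ`, the function
`s ↦ ∫ ‖x‖ ^ (s - m) a (x, y)` has a meromorphic continuation with at most a simple
pole at `0`, where its residue is the volume of the sphere multiplied by `∫ a (0, y)`. -/
theorem exists_meromorphic_integral_norm_fst_cpow {k : ℕ} (hm : 0 < m)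
    {a : E × EuclideanSpace ℝ (Fin k) → ℂ} (ha : ContDiff ℝ ∞ a) (hc : HasCompactSupport a) :
    ∃ ζ : ℂ → ℂ, Meromorphic ζ ∧
      (∀ s : ℂ, (m : ℝ) < s.re → (Integrable fun z => (‖z.1‖ : ℂ) ^ (s - m) * a z) ∧
        ζ s = ∫ z, (‖z.1‖ : ℂ) ^ (s - m) * a z) ∧
      Tendsto (fun s => s * ζ s) (𝓝[≠] 0)
        (𝓝 (((volume : Measure E).toSphere.real univ : ℂ) * ∫ y, a (0, y))) := by
  have hK1 : IsCompact (Prod.fst '' tsupport a) := hc.isCompact.image continuous_fst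
  have hK2 : IsCompact (Prod.snd '' tsupport a) := hc.isCompact.image continuous_snd
  have h0 : ∀ x y, a (x, y) ≠ 0 → x ∈ Prod.fst '' tsupport a ∧ y ∈ Prod.snd '' tsupport a :=
    fun x y h => ⟨⟨_, subset_tsupport a h, rfl⟩, ⟨_, subset_tsupport a h, rfl⟩⟩
  have hh : ContDiff ℝ ∞ fun x => ∫ y, a (x, y) :=
    contDiff_integral_of_hasCompactSupport (b := fun x y => a (x, y)) volume hK2 ha
      fun x y hy => by
        by_contra h
        exact hy (h0 x y h).2
  have hhc : HasCompactSupport fun x => ∫ y, a (x, y) := by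
    refine HasCompactSupport.intro hK1 fun x hx => ?_
    have : ∀ y, a (x, y) = 0 := fun y => by
      by_contra h
      exact hx (h0 x y h).1
    simp [this]
  obtain ⟨ζ, h1, h2, h3⟩ := exists_meromorphic_integral_norm_cpow hm hh hhc
  refine ⟨ζ, h1, fun s hs => ?_, h3⟩
  have hi : Integrable fun z : E × EuclideanSpace ℝ (Fin k) => (‖z.1‖ : ℂ) ^ (s - m) * a z :=
    (((continuous_norm_cpow (by simpa using hs)).comp continuous_fst).mul
      ha.continuous).integrable_of_hasCompactSupport hc.mul_left
  refine ⟨hi, ?_⟩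
  rw [h2 s hs]
  have := integral_prod _ hi
  rw [← Measure.volume_eq_prod] at this
  rw [this]
  refine integral_congr_ae (Eventually.of_forall fun x => ?_)
  simp only
  rw [integral_const_mul]

end Radial

/-! ### The Morse lemma with parameters, for nonnegative functions -/

section Morse

-- Instance search for iterated spaces of continuous linear maps needs the depth that Mathlib uses.
set_option maxSynthPendingDepth 3
/-- The inverse function theorem, with smoothness of the inverse on the whole target. -/
theorem exists_openPartialHomeomorph_of_contDiffOn {V V' : Type*} [NormedAddCommGroup V]
    [NormedSpace ℝ V] [CompleteSpace V] [NormedAddCommGroup V'] [NormedSpace ℝ V']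
    {f : V → V'} {U : Set V} (hU : IsOpen U) (hf : ContDiffOn ℝ ∞ f U) {a : V} (ha : a ∈ U)
    {f' : V ≃L[ℝ] V'} (hf' : HasFDerivAt f (f' : V →L[ℝ] V') a) :
    ∃ Ψ : OpenPartialHomeomorph V V', a ∈ Ψ.source ∧ Ψ.source ⊆ U ∧ (∀ x, Ψ x = f x) ∧
      ContDiffOn ℝ ∞ Ψ.symm Ψ.target := by
  have hfa : ∀ x ∈ U, ContDiffAt ℝ ∞ f x := fun x hx => hf.contDiffAt (hU.mem_nhds hx)
  let Φ := (hfa a ha).toOpenPartialHomeomorph f hf' (by simp)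
  let W : Set V := U ∩ fderiv ℝ f ⁻¹' range ((↑) : (V ≃L[ℝ] V') → (V →L[ℝ] V'))
  have hW : W ∈ 𝓝 a := by
    refine inter_mem (hU.mem_nhds ha) ?_
    have hc : ContinuousAt (fderiv ℝ f) a :=
      ((hfa a ha).fderiv_right (m := ∞) (by simp)).continuousAt
    refine hc ?_
    rw [hf'.fderiv]
    exact ContinuousLinearEquiv.nhds f'
  refine ⟨Φ.restr W, ⟨(hfa a ha).mem_toOpenPartialHomeomorph_source hf' (by simp),
    mem_interior_iff_mem_nhds.2 hW⟩, fun x hx => (interior_subset hx.2).1, fun x => rfl,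
    fun b hb => ?_⟩
  have hm : (Φ.restr W).symm b ∈ W :=
    interior_subset ((Φ.restr W).map_target hb).2
  obtain ⟨g', hg'⟩ := hm.2
  have hs := hfa _ hm.1
  refine ((Φ.restr W).contDiffAt_symm (f₀' := g') hb ?_ hs).contDiffWithinAt
  rw [hg']
  exact (hs.differentiableAt (by simp)).hasFDerivAt

variable {E F : Type*} [NormedAddCommGroup E] [InnerProductSpace ℝ E] [FiniteDimensional ℝ E]
  [NormedAddCommGroup F] [NormedSpace ℝ F] [FiniteDimensional ℝ F]

/-- The smooth square root of operators near `1`, which preserves self-adjoint operators. It is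
obtained from the inverse function theorem, as the derivative of `a ↦ a * a` at `1` is `2`. -/
theorem exists_contDiffOn_sqrt (E : Type*) [NormedAddCommGroup E] [InnerProductSpace ℝ E]
    [FiniteDimensional ℝ E] : ∃ (r : (E →L[ℝ] E) → (E →L[ℝ] E)) (U : Set (E →L[ℝ] E)),
      IsOpen U ∧ 1 ∈ U ∧ r 1 = 1 ∧ ContDiffOn ℝ ∞ r U ∧ ∀ a ∈ U, r a * r a = a ∧
        (ContinuousLinearMap.adjoint a = a → ContinuousLinearMap.adjoint (r a) = r a) := by
  have hsq : ContDiff ℝ ∞ fun a : E →L[ℝ] E => a * a := contDiff_id.mul contDiff_id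
  let two : (E →L[ℝ] E) ≃L[ℝ] (E →L[ℝ] E) :=
    ContinuousLinearEquiv.smulLeft (Units.mk0 (2 : ℝ) two_ne_zero)
  have hd : HasFDerivAt (fun a : E →L[ℝ] E => a * a)
      (two : (E →L[ℝ] E) →L[ℝ] (E →L[ℝ] E)) 1 := by
    have := (hasFDerivAt_id (𝕜 := ℝ) (1 : E →L[ℝ] E)).mul' (hasFDerivAt_id (1 : E →L[ℝ] E))
    refine this.congr_fderiv ?_
    ext1 h
    change (1 : E →L[ℝ] E) * h + h * 1 = (2 : ℝ) • h
    rw [one_mul, mul_one, two_smul]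
  obtain ⟨Ψ, h1, -, hΨ, hs⟩ :=
    exists_openPartialHomeomorph_of_contDiffOn isOpen_univ hsq.contDiffOn (mem_univ _) hd
  have hΨ1 : Ψ 1 = 1 := by rw [hΨ, mul_one]
  have hr1 : Ψ.symm 1 = 1 := by
    conv_lhs => rw [← hΨ1]
    exact Ψ.left_inv h1
  have hadj1 : ContinuousLinearMap.adjoint (1 : E →L[ℝ] E) = 1 := star_one (E →L[ℝ] E)
  have hc : ContinuousOn (fun a => ContinuousLinearMap.adjoint (Ψ.symm a)) Ψ.target :=
    ContinuousLinearMap.adjoint.continuous.comp_continuousOn Ψ.symm.continuousOn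
  refine ⟨Ψ.symm, Ψ.target ∩ (fun a => ContinuousLinearMap.adjoint (Ψ.symm a)) ⁻¹' Ψ.source,
    hc.isOpen_inter_preimage Ψ.open_target Ψ.open_source, ⟨?_, ?_⟩, hr1,
    hs.mono inter_subset_left, fun a ha => ?_⟩
  · have := Ψ.map_source h1
    rwa [hΨ1] at this
  · rw [mem_preimage, hr1, hadj1]
    exact h1
  · have hsq' : Ψ.symm a * Ψ.symm a = a := by rw [← hΨ]; exact Ψ.right_inv ha.1
    refine ⟨hsq', fun hadj => ?_⟩
    -- The adjoint of the square root is a square root of `a` too, and square roots near `1`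
    -- are unique.
    refine Ψ.injOn ha.2 (Ψ.map_target ha.1) ?_
    rw [hΨ, hΨ, hsq']
    have : ContinuousLinearMap.adjoint (Ψ.symm a * Ψ.symm a) =
        ContinuousLinearMap.adjoint (Ψ.symm a) * ContinuousLinearMap.adjoint (Ψ.symm a) :=
      star_mul _ _
    rw [← this, hsq', hadj]

/-- A positive definite symmetric operator is of the form `Pᵀ P`. -/
theorem exists_continuousLinearEquiv_inner_eq (A : E →L[ℝ] E)
    (hA : (A : E →ₗ[ℝ] E).IsSymmetric) (hpos : ∀ x, 0 ≤ inner ℝ (A x) x)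
    (hinj : ∀ x, A x = 0 → x = 0) :
    ∃ P : E ≃L[ℝ] E, ∀ x y, inner ℝ (A x) y = inner ℝ (P x) (P y) := by
  -- `P` is the positive square root of `A`, defined in an eigenvector basis.
  set b := hA.eigenvectorBasis rfl with hb
  set l := hA.eigenvalues rfl with hl
  have hAb : ∀ i, A (b i) = l i • b i := fun i => hA.apply_eigenvectorBasis rfl i
  have hl0 : ∀ i, 0 < l i := by
    intro i
    have h1 : b i ≠ 0 := b.orthonormal.ne_zero i
    refine lt_of_le_of_ne ?_ fun h => h1 (hinj _ ?_)
    · have := hpos (b i)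
      rwa [hAb, inner_smul_left, real_inner_self_eq_norm_sq, b.orthonormal.1 i, one_pow,
        mul_one] at this
    · rw [hAb, ← h, zero_smul]
  have hAi : ∀ x i, inner ℝ (A x) (b i) = l i * inner ℝ x (b i) := by
    intro x i
    have := hA x (b i)
    simp only [ContinuousLinearMap.coe_coe] at this
    rw [this, hAb, inner_smul_right]
  let P : E →ₗ[ℝ] E :=
    { toFun := fun x => ∑ i, (Real.sqrt (l i) * inner ℝ (b i) x) • b i
      map_add' := fun x y => by
        simp only [inner_add_right, mul_add, add_smul, Finset.sum_add_distrib]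
      map_smul' := fun c x => by
        simp only [inner_smul_right, RingHom.id_apply, Finset.smul_sum, smul_smul]
        exact Finset.sum_congr rfl fun i _ => by ring_nf }
  have hP : ∀ x y, inner ℝ (A x) y = inner ℝ (P x) (P y) := by
    intro x y
    have h1 : ∀ x i, inner ℝ (P x) (b i) = Real.sqrt (l i) * inner ℝ (b i) x := by
      intro x i
      change inner ℝ (∑ j, (Real.sqrt (l j) * inner ℝ (b j) x) • b j) (b i) = _
      rw [sum_inner, Finset.sum_eq_single i]
      · rw [inner_smul_left, real_inner_self_eq_norm_sq, b.orthonormal.1 i]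
        simp
      · intro j _ hj
        rw [inner_smul_left, b.orthonormal.2 hj, mul_zero]
      · simp
    rw [← b.sum_inner_mul_inner, ← b.sum_inner_mul_inner]
    refine Finset.sum_congr rfl fun i _ => ?_
    rw [hAi, h1, real_inner_comm (P y), h1]
    have := Real.mul_self_sqrt (hl0 i).le
    rw [real_inner_comm (b i) x]
    linear_combination (-(inner ℝ (b i) x * inner ℝ (b i) y)) * this
  have hPinj : Function.Injective P := by
    rw [injective_iff_map_eq_zero]
    intro x hx
    apply hinj
    have : inner ℝ (A x) (A x) = (0 : ℝ) := by rw [hP, hx, inner_zero_left]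
    exact inner_self_eq_zero.1 this
  exact ⟨(LinearEquiv.ofInjectiveEndo P hPinj).toContinuousLinearEquiv, hP⟩

/-- Integration of the second order Taylor formula on a segment. -/
theorem eq_integral_of_eq_zero {g : ℝ → ℝ} (hg : ContDiff ℝ ∞ g) (h0 : g 0 = 0)
    (h1 : deriv g 0 = 0) : g 1 = ∫ t in (0 : ℝ)..1, (1 - t) * deriv (deriv g) t := by
  have hg' : ContDiff ℝ ∞ (deriv g) := (contDiff_infty_iff_deriv.1 hg).2
  have hd : ∀ t ∈ uIcc (0 : ℝ) 1, HasDerivAt (fun t => (1 - t) * deriv g t + g t)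
      ((1 - t) * deriv (deriv g) t) t := by
    intro t _
    have e1 := ((hasDerivAt_id t).const_sub 1).mul (hg'.differentiable (by simp) t).hasDerivAt
    have e2 := (hg.differentiable (by simp) t).hasDerivAt
    refine (e1.add e2).congr_deriv ?_
    simp
  rw [intervalIntegral.integral_eq_sub_of_hasDerivAt hd]
  · simp [h0, h1]
  · refine Continuous.intervalIntegrable ?_ _ _
    exact (continuous_const.sub continuous_id).mul (hg'.continuous_deriv (by simp))

/-- The second derivative of `G` in the directions of `E`. -/
def hessFst (G : E × F → ℝ) (z : E × F) : E →L[ℝ] E →L[ℝ] ℝ :=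
  (fderiv ℝ (fderiv ℝ G) z).bilinearComp (.inl ℝ E F) (.inl ℝ E F)

theorem contDiff_hessFst {G : E × F → ℝ} (hG : ContDiff ℝ ∞ G) : ContDiff ℝ ∞ (hessFst G) := by
  have h1 : ContDiff ℝ ∞ (fderiv ℝ (fderiv ℝ G)) :=
    (contDiff_infty_iff_fderiv.1 (contDiff_infty_iff_fderiv.1 hG).2).2
  rw [contDiff_clm_apply_iff]
  intro u
  rw [contDiff_clm_apply_iff]
  intro v
  exact (h1.clm_apply contDiff_const).clm_apply contDiff_const

/-- The remainder in Taylor's formula in the directions of `E`. -/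
def taylorForm (G : E × F → ℝ) (z : E × F) : E →L[ℝ] E →L[ℝ] ℝ :=
  ∫ t in Ioc (0 : ℝ) 1, (1 - t) • hessFst G (t • z.1, z.2)

theorem contDiff_taylorForm {G : E × F → ℝ} (hG : ContDiff ℝ ∞ G) :
    ContDiff ℝ ∞ (taylorForm G) := by
  refine contDiff_integral_of_ae_mem_closedBall (P := E × F) (volume.restrict (Ioc (0 : ℝ) 1))
    (b := fun z t => (1 - t) • hessFst G (t • z.1, z.2)) ?_ ?_
  · filter_upwards [ae_restrict_mem measurableSet_Ioc] with t ht
    rw [mem_closedBall_zero_iff, Real.norm_of_nonneg ht.1.le]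
    exact ht.2
  · refine (contDiff_const.sub contDiff_snd).smul ((contDiff_hessFst hG).comp ?_)
    exact (contDiff_snd.smul (contDiff_fst.comp contDiff_fst)).prodMk
      (contDiff_snd.comp contDiff_fst)

theorem integrable_taylorForm {G : E × F → ℝ} (hG : ContDiff ℝ ∞ G) (z : E × F) :
    IntegrableOn (fun t : ℝ => (1 - t) • hessFst G (t • z.1, z.2)) (Ioc 0 1) := by
  have : Continuous fun t : ℝ => (1 - t) • hessFst G (t • z.1, z.2) :=
    (continuous_const.sub continuous_id).smul ((contDiff_hessFst hG).continuous.comp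
      (by fun_prop))
  exact this.integrableOn_Ioc

theorem taylorForm_apply {G : E × F → ℝ} (hG : ContDiff ℝ ∞ G) (z : E × F) (u v : E) :
    taylorForm G z u v = ∫ t in (0 : ℝ)..1,
      (1 - t) * fderiv ℝ (fderiv ℝ G) (t • z.1, z.2) (u, 0) (v, 0) := by
  have h1 := integrable_taylorForm hG z
  have e1 := ContinuousLinearMap.integral_apply h1 u
  have e2 := ContinuousLinearMap.integral_apply
    (h1.apply_continuousLinearMap u) v
  rw [intervalIntegral.integral_of_le zero_le_one, taylorForm, e1, e2]
  rfl

theorem taylorForm_symm {G : E × F → ℝ} (hG : ContDiff ℝ ∞ G) (z : E × F) (u v : E) :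
    taylorForm G z u v = taylorForm G z v u := by
  rw [taylorForm_apply hG, taylorForm_apply hG]
  congr 1
  funext t
  rw [(hG.contDiffAt.isSymmSndFDerivAt (n := ∞) (by simpa using ENat.LEInfty.out)).eq]

theorem taylorForm_zero {G : E × F → ℝ} (hG : ContDiff ℝ ∞ G) (y : F) (u v : E) :
    taylorForm G (0, y) u v = 2⁻¹ * fderiv ℝ (fderiv ℝ G) (0, y) (u, 0) (v, 0) := by
  rw [taylorForm_apply hG]
  simp only [smul_zero]
  rw [intervalIntegral.integral_mul_const]
  congr 1
  rw [intervalIntegral.integral_sub (by simp) (by simp)]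
  norm_num

/-- A function that vanishes to second order along `0 × F` is a quadratic form in the first
variable, with coefficients depending on the point. -/
theorem taylor_formula {G : E × F → ℝ} (hG : ContDiff ℝ ∞ G) (h0 : ∀ y, G (0, y) = 0)
    (h1 : ∀ y, fderiv ℝ G (0, y) = 0) (z : E × F) : G z = taylorForm G z z.1 z.1 := by
  have hline : ∀ t : ℝ, HasDerivAt (fun t : ℝ => ((t • z.1, z.2) : E × F)) (z.1, 0) t := by
    intro t
    have := (hasDerivAt_id t).smul_const z.1
    rw [one_smul] at this
    exact this.prodMk (hasDerivAt_const t z.2)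
  have hlineS : ContDiff ℝ ∞ (fun t : ℝ => ((t • z.1, z.2) : E × F)) :=
    (contDiff_id.smul contDiff_const).prodMk contDiff_const
  have hG' : ContDiff ℝ ∞ (fderiv ℝ G) := (contDiff_infty_iff_fderiv.1 hG).2
  have d1 : ∀ t : ℝ, HasDerivAt (fun t : ℝ => G (t • z.1, z.2))
      (fderiv ℝ G (t • z.1, z.2) (z.1, 0)) t := fun t =>
    (hG.differentiable (by simp) _).hasFDerivAt.comp_hasDerivAt t (hline t)
  have d2 : ∀ t : ℝ, HasDerivAt (fun t : ℝ => fderiv ℝ G (t • z.1, z.2) (z.1, 0))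
      (fderiv ℝ (fderiv ℝ G) (t • z.1, z.2) (z.1, 0) (z.1, 0)) t := fun t => by
    have := ((hG'.differentiable (by simp) _).hasFDerivAt.comp_hasDerivAt t (hline t))
    have h2 := this.clm_apply (hasDerivAt_const t ((z.1, 0) : E × F))
    simpa using h2
  have e1 : deriv (fun t : ℝ => G (t • z.1, z.2)) =
      fun t => fderiv ℝ G (t • z.1, z.2) (z.1, 0) := funext fun t => (d1 t).deriv
  have key := eq_integral_of_eq_zero (hG.comp hlineS) (by simp [h0])
    (by rw [show (G ∘ fun t : ℝ => ((t • z.1, z.2) : E × F)) = fun t : ℝ => G (t • z.1, z.2)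
          from rfl, e1]; simp [h1])
  rw [taylorForm_apply hG]
  rw [show (G ∘ fun t : ℝ => ((t • z.1, z.2) : E × F)) = fun t : ℝ => G (t • z.1, z.2)
          from rfl, e1] at key
  simp only [one_smul, fun t => (d2 t).deriv] at key
  exact key

/-- The Morse lemma with parameters: near a point of `0 × F`, a nonnegative smooth function
vanishing on `0 × F` whose Hessian in the directions of `E` is nondegenerate is the square of the
norm of the first component of a system of coordinates which extends the second projection. -/
theorem exists_morse_coordinates {G : E × F → ℝ} (hG : ContDiff ℝ ∞ G) (h0 : ∀ y, G (0, y) = 0)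
    (hG0 : ∀ z, 0 ≤ G z) (b₀ : F)
    (hinj : ∀ u, (∀ v, fderiv ℝ (fderiv ℝ G) (0, b₀) (u, 0) (v, 0) = 0) → u = 0) :
    ∃ Ψ : OpenPartialHomeomorph (E × F) (E × F), (0, b₀) ∈ Ψ.source ∧
      ContDiffOn ℝ ∞ Ψ Ψ.source ∧ ContDiffOn ℝ ∞ Ψ.symm Ψ.target ∧
      ∀ z ∈ Ψ.source, (Ψ z).2 = z.2 ∧ G z = ‖(Ψ z).1‖ ^ 2 ∧ (z.1 = 0 → (Ψ z).1 = 0) := by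
  have h1 : ∀ y, fderiv ℝ G (0, y) = 0 := fun y => by
    refine IsLocalMin.fderiv_eq_zero (Eventually.of_forall fun z => ?_)
    rw [h0]
    exact hG0 z
  -- `A z` is the self-adjoint operator for which `G z = ⟪A z x, x⟫`, where `z = (x, y)`.
  let D : (E →L[ℝ] ℝ) →ₗ[ℝ] E :=
    { toFun := fun l => (InnerProductSpace.toDual ℝ E).symm l
      map_add' := fun _ _ => map_add _ _ _
      map_smul' := fun c l => by simp }
  set toOp : (E →L[ℝ] E →L[ℝ] ℝ) →L[ℝ] (E →L[ℝ] E) :=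
    ContinuousLinearMap.compL ℝ E (E →L[ℝ] ℝ) E (LinearMap.toContinuousLinearMap D) with htoOp
  have hop : ∀ B u v, inner ℝ (toOp B u) v = B u v := fun B u v =>
    InnerProductSpace.toDual_symm_apply (𝕜 := ℝ) (x := v) (y := B u)
  set A : E × F → E →L[ℝ] E := fun z => toOp (taylorForm G z) with hA
  have hAs : ContDiff ℝ ∞ A := toOp.contDiff.comp (contDiff_taylorForm hG)
  have hAi : ∀ z u v, inner ℝ (A z u) v = taylorForm G z u v := fun z u v => hop _ u v
  have hsymm : ∀ z u v, inner ℝ (A z u) v = inner ℝ u (A z v) := fun z u v => by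
    rw [hAi, real_inner_comm, hAi, taylorForm_symm hG]
  -- `t² ⟪A (t u, b₀) u, u⟫ = G (t u, b₀) ≥ 0`; divide by `t²` and let `t` tend to `0`.
  have hpos : ∀ u, 0 ≤ inner ℝ (A (0, b₀) u) u := by
    intro u
    have hc : Continuous fun t : ℝ => inner ℝ (A (t • u, b₀) u) u := by
      have : Continuous fun t : ℝ => A (t • u, b₀) := hAs.continuous.comp (by fun_prop)
      fun_prop
    have hlim : Tendsto (fun t : ℝ => inner ℝ (A (t • u, b₀) u) u) (𝓝[≠] 0)
        (𝓝 (inner ℝ (A (0, b₀) u) u)) := by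
      have := (hc.tendsto 0).mono_left (nhdsWithin_le_nhds (s := {0}ᶜ))
      simpa using this
    refine ge_of_tendsto hlim ?_
    filter_upwards [self_mem_nhdsWithin] with t ht
    have ht' : t ≠ 0 := ht
    have h2 := hG0 (t • u, b₀)
    rw [taylor_formula hG h0 h1, ← hAi] at h2
    simp only [map_smul, inner_smul_left, inner_smul_right] at h2
    have h3 : (0 : ℝ) < t * t := mul_self_pos.2 ht'
    refine le_of_mul_le_mul_left (a := t * t) ?_ h3
    simpa [mul_assoc] using h2
  have hA0 : ∀ u, A (0, b₀) u = 0 → u = 0 := by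
    intro u hu
    apply hinj
    intro v
    have h2 := hAi (0, b₀) u v
    rw [hu, inner_zero_left, taylorForm_zero hG] at h2
    linarith
  obtain ⟨P, hP⟩ := exists_continuousLinearEquiv_inner_eq (A (0, b₀))
    (fun u v => hsymm _ u v) hpos hA0
  obtain ⟨r, U, hU, h1U, hr1, hr, hrU⟩ := exists_contDiffOn_sqrt E
  -- `A` in the coordinates given by `P`, so that `A'` is the identity at `(0, b₀)`.
  set Q : E →L[ℝ] E := (P.symm : E →L[ℝ] E) with hQ
  set A' : E × F → E →L[ℝ] E := fun z =>
    (ContinuousLinearMap.adjoint Q) ∘L (A z) ∘L Q with hA'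
  have hA's : ContDiff ℝ ∞ A' := contDiff_const.clm_comp (hAs.clm_comp contDiff_const)
  have hA'i : ∀ z u v, inner ℝ (A' z u) v = inner ℝ (A z (Q u)) (Q v) := fun z u v => by
    simp only [hA', ContinuousLinearMap.comp_apply, ContinuousLinearMap.adjoint_inner_left]
  have hA'0 : A' (0, b₀) = 1 := by
    ext1 u
    refine ext_inner_right ℝ fun v => ?_
    rw [hA'i, hP]
    simp [hQ]
  have hA'adj : ∀ z, ContinuousLinearMap.adjoint (A' z) = A' z := by
    intro z
    ext1 u
    refine ext_inner_right ℝ fun v => ?_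
    rw [ContinuousLinearMap.adjoint_inner_left, real_inner_comm, hA'i, hA'i, hsymm,
      real_inner_comm]
  set W : Set (E × F) := A' ⁻¹' U with hW
  have hWo : IsOpen W := hU.preimage hA's.continuous
  have hW0 : (0, b₀) ∈ W := by
    change A' (0, b₀) ∈ U
    rwa [hA'0]
  -- `A = Bᵀ B` near `(0, b₀)`, so that `G z = ‖B z x‖²` and `(x, y) ↦ (B z x, y)` are the
  -- coordinates.
  set B : E × F → E →L[ℝ] E := fun z => r (A' z) ∘L (P : E →L[ℝ] E) with hB
  have hBs : ContDiffOn ℝ ∞ B W :=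
    (hr.comp hA's.contDiffOn (fun z hz => hz)).clm_comp contDiffOn_const
  have hBn : ∀ z ∈ W, ∀ u, ‖B z u‖ ^ 2 = inner ℝ (A z u) u := by
    intro z hz u
    obtain ⟨h2, h3⟩ := hrU _ hz
    have h4 : inner ℝ (r (A' z) (P u)) (r (A' z) (P u)) = inner ℝ (A' z (P u)) (P u) := by
      conv_rhs => rw [← h2]
      rw [mul_apply_eq_comp, ← ContinuousLinearMap.adjoint_inner_right,
        h3 (hA'adj z), real_inner_comm]
    rw [← real_inner_self_eq_norm_sq]
    simp only [hB, ContinuousLinearMap.comp_apply, ContinuousLinearEquiv.coe_coe]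
    rw [h4, hA'i]
    simp [hQ]
  set Φ : E × F → E × F := fun z => (B z z.1, z.2) with hΦ
  have hΦs : ContDiffOn ℝ ∞ Φ W :=
    (hBs.clm_apply contDiff_fst.contDiffOn).prodMk contDiff_snd.contDiffOn
  have hB0 : B (0, b₀) = (P : E →L[ℝ] E) := by
    simp only [hB, hA'0, hr1]
    ext1 u
    rfl
  have hΦd : HasFDerivAt Φ ((P.prodCongr (ContinuousLinearEquiv.refl ℝ F) :
      (E × F) ≃L[ℝ] (E × F)) : (E × F) →L[ℝ] (E × F)) (0, b₀) := by
    have hBd : HasFDerivAt B (fderiv ℝ B (0, b₀)) (0, b₀) :=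
      ((hBs.contDiffAt (hWo.mem_nhds hW0)).differentiableAt (by simp)).hasFDerivAt
    have := (hBd.clm_apply (hasFDerivAt_fst (p := ((0 : E), b₀)))).prodMk
      (hasFDerivAt_snd (p := ((0 : E), b₀)))
    refine this.congr_fderiv ?_
    ext u <;> simp [hB0]
  obtain ⟨Ψ, h4, h5, h6, h7⟩ :=
    exists_openPartialHomeomorph_of_contDiffOn hWo hΦs hW0 hΦd
  have h6' : (Ψ : E × F → E × F) = Φ := funext h6
  refine ⟨Ψ, h4, ?_, h7, fun z hz => ?_⟩
  · rw [h6']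
    exact hΦs.mono h5
  · rw [h6]
    refine ⟨rfl, ?_, ?_⟩
    · simp only [hΦ]
      rw [hBn z (h5 hz), hAi]
      exact taylor_formula hG h0 h1 z
    · intro h
      simp [hΦ, h]

end Morse

/-! ### Morse charts -/

section Split

variable {m k n : ℕ}

/-- The isometry `ℝⁿ ≃ ℝᵐ × ℝᵏ`, the product having the Euclidean norm. -/
def splitIsometry (h : m + k = n) : EuclideanSpace ℝ (Fin n) ≃ₗᵢ[ℝ]
    WithLp 2 (EuclideanSpace ℝ (Fin m) × EuclideanSpace ℝ (Fin k)) :=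
  (LinearIsometryEquiv.piLpCongrLeft 2 ℝ ℝ ((finCongr h.symm).trans finSumFinEquiv.symm)).trans
    (PiLp.sumPiLpEquivProdLpPiLp 2 _)

/-- The identification of `ℝⁿ` with `ℝᵐ × ℝᵏ`, for `n = m + k`. -/
def split (h : m + k = n) : EuclideanSpace ℝ (Fin n) ≃L[ℝ]
    EuclideanSpace ℝ (Fin m) × EuclideanSpace ℝ (Fin k) :=
  (splitIsometry h).toContinuousLinearEquiv.trans (WithLp.prodContinuousLinearEquiv 2 ℝ _ _)

theorem measurePreserving_split (h : m + k = n) : MeasurePreserving (split h) :=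
  (WithLp.volume_preserving_ofLp _ _).comp (splitIsometry h).measurePreserving

theorem split_fst_apply (h : m + k = n) (z : EuclideanSpace ℝ (Fin n)) (a : Fin m) :
    (split h z).1 a = z (Fin.cast h (Fin.castAdd k a)) := rfl

theorem split_snd_apply (h : m + k = n) (z : EuclideanSpace ℝ (Fin n)) (b : Fin k) :
    (split h z).2 b = z (Fin.cast h (Fin.natAdd m b)) := rfl

theorem split_single_castAdd (h : m + k = n) (a : Fin m) :
    split h (EuclideanSpace.single (Fin.cast h (Fin.castAdd k a)) 1) =
      (EuclideanSpace.single a 1, 0) := by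
  refine Prod.ext ?_ ?_
  · ext j
    rw [split_fst_apply]
    simp [Fin.ext_iff]
  · ext j
    rw [split_snd_apply]
    have : ¬ m + (j : ℕ) = a := by omega
    simp [Fin.ext_iff, this]

theorem split_single_natAdd (h : m + k = n) (b : Fin k) :
    split h (EuclideanSpace.single (Fin.cast h (Fin.natAdd m b)) 1) =
      (0, EuclideanSpace.single b 1) := by
  refine Prod.ext ?_ ?_
  · ext j
    rw [split_fst_apply]
    have : ¬ (j : ℕ) = m + b := by omega
    simp [Fin.ext_iff, this]
  · ext j
    rw [split_snd_apply]
    simp [Fin.ext_iff]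

end Split

section MorseChart

variable {m k n : ℕ} {X Y : Type*} [TopologicalSpace X]
  [ChartedSpace (EuclideanSpace ℝ (Fin n)) X] [IsManifold (𝓡 n) ∞ X] [TopologicalSpace Y]
  [ChartedSpace (EuclideanSpace ℝ (Fin k)) Y] [IsManifold (𝓡 k) ∞ Y]

theorem trans_mem_smoothCharts {e : OpenPartialHomeomorph X (EuclideanSpace ℝ (Fin n))}
    (he : e ∈ smoothCharts n X)
    {g : OpenPartialHomeomorph (EuclideanSpace ℝ (Fin n)) (EuclideanSpace ℝ (Fin n))}
    (hg : ContDiffOn ℝ ∞ g g.source) (hg' : ContDiffOn ℝ ∞ g.symm g.target) :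
    e.trans g ∈ smoothCharts n X := by
  rw [smoothCharts, IsManifold.mem_maximalAtlas_iff_contMDiffOn]
  constructor
  · refine ContMDiffOn.comp (t := g.source) (contMDiffOn_iff_contDiffOn.2 hg)
      ((contMDiffOn_of_mem_maximalAtlas he).mono ?_) ?_
    · intro x hx
      exact ((OpenPartialHomeomorph.trans_source e g).subset hx).1
    · intro x hx
      exact ((OpenPartialHomeomorph.trans_source e g).subset hx).2
  · change ContMDiffOn _ _ _ (e.symm ∘ g.symm) _
    refine ContMDiffOn.comp (t := e.target) (contMDiffOn_symm_of_mem_maximalAtlas he)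
      ((contMDiffOn_iff_contDiffOn.2 hg').mono ?_) ?_
    · intro x hx
      exact ((OpenPartialHomeomorph.trans_target e g).subset hx).1
    · intro x hx
      exact ((OpenPartialHomeomorph.trans_target e g).subset hx).2

theorem restr_mem_smoothCharts {e : OpenPartialHomeomorph X (EuclideanSpace ℝ (Fin n))}
    (he : e ∈ smoothCharts n X) {s : Set X} (hs : IsOpen s) : e.restr s ∈ smoothCharts n X :=
  restr_mem_maximalAtlas _ he hs

/-- An embedding of a `k`-manifold in an `(m + k)`-manifold is, in suitable charts, the inclusion
of `0 × ℝᵏ` in `ℝᵐ × ℝᵏ`. -/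
theorem exists_slice_chart (h : m + k = n) {i : Y → X} (hi : IsSmoothEmbedding (𝓡 k) (𝓡 n) ∞ i)
    (y₀ : Y) : ∃ e ∈ smoothCharts n X, ∃ f ∈ smoothCharts k Y, y₀ ∈ f.source ∧
      (∀ y, i y ∈ e.source ↔ y ∈ f.source) ∧ ∀ y ∈ f.source, split h (e (i y)) = (0, f y) := by
  have hI := hi.isImmersion.isImmersionAt y₀
  set e₀ := hI.codChart
  set f₀ := hI.domChart
  let L₀ := hI.equiv
  have hfd : FiniteDimensional ℝ (EuclideanSpace ℝ (Fin k) × hI.complement) :=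
    L₀.symm.toLinearEquiv.finiteDimensional
  have hfd' : FiniteDimensional ℝ hI.complement :=
    Module.Finite.of_surjective (LinearMap.snd ℝ (EuclideanSpace ℝ (Fin k)) hI.complement)
      LinearMap.snd_surjective
  have hr : Module.finrank ℝ hI.complement = Module.finrank ℝ (EuclideanSpace ℝ (Fin m)) := by
    have := L₀.toLinearEquiv.finrank_eq
    simp only [Module.finrank_prod, finrank_euclideanSpace, Fintype.card_fin] at this ⊢
    omega
  let T : hI.complement ≃L[ℝ] EuclideanSpace ℝ (Fin m) := ContinuousLinearEquiv.ofFinrankEq hr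
  -- Mathlib's immersion charts place the submanifold in the first factor; `L` swaps the factors.
  let L : EuclideanSpace ℝ (Fin n) ≃L[ℝ] EuclideanSpace ℝ (Fin n) :=
    L₀.symm.trans ((((ContinuousLinearEquiv.refl ℝ _).prodCongr T).trans
      (ContinuousLinearEquiv.prodComm ℝ _ _)).trans (split h).symm)
  have hL : ∀ y, split h (L (L₀ (y, 0))) = (0, y) := by
    intro y
    simp [L]
  -- As `i` is a topological embedding, the chart of `X` can be shrunk to meet `Y` exactly in the
  -- domain of the chart of `Y`.
  obtain ⟨V, hV, hVf⟩ := hi.isEmbedding.isInducing.isOpen_iff.1 f₀.open_source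
  set g := L.toHomeomorph.toOpenPartialHomeomorph
  have heg : e₀.trans g ∈ smoothCharts n X :=
    trans_mem_smoothCharts hI.codChart_mem_maximalAtlas L.contDiff.contDiffOn
      L.symm.contDiff.contDiffOn
  refine ⟨(e₀.trans g).restr V, restr_mem_smoothCharts heg hV, f₀, hI.domChart_mem_maximalAtlas,
    hI.mem_domChart_source, fun y => ?_, fun y hy => ?_⟩
  · rw [OpenPartialHomeomorph.restr_source, hV.interior_eq, OpenPartialHomeomorph.trans_source]
    constructor
    · rintro ⟨-, h2⟩
      rw [← hVf]
      exact h2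
    · intro hy
      refine ⟨⟨hI.source_subset_preimage_source hy, trivial⟩, ?_⟩
      rw [← hVf] at hy
      exact hy
  · have h0 : f₀ y ∈ (f₀.extend (𝓡 k)).target := by simpa using f₀.map_source hy
    have h1 := hI.writtenInCharts h0
    have h2 : e₀ (i y) = L₀ (f₀ y, 0) := by
      have h3 : (f₀.symm (f₀ y)) = y := f₀.left_inv hy
      simpa [f₀, e₀, h3] using h1
    change split h (L (e₀ (i y))) = _
    rw [h2, hL]

/-- The Hessian of a composite function at a critical point. -/
theorem fderiv_fderiv_comp_of_fderiv_eq_zero {V V' : Type*} [NormedAddCommGroup V]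
    [NormedSpace ℝ V] [NormedAddCommGroup V'] [NormedSpace ℝ V'] {g : V → ℝ} {τ : V' → V} {z : V'}
    (hτ : ContDiffAt ℝ ∞ τ z) (hg : ContDiffAt ℝ ∞ g (τ z)) (h0 : fderiv ℝ g (τ z) = 0)
    (u v : V') : fderiv ℝ (fderiv ℝ (g ∘ τ)) z u v =
      fderiv ℝ (fderiv ℝ g) (τ z) (fderiv ℝ τ z u) (fderiv ℝ τ z v) := by
  have h1 : ∀ᶠ z' in 𝓝 z, DifferentiableAt ℝ τ z' := by
    have : ContDiffAt ℝ 1 τ z := hτ.of_le (by simp)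
    exact (this.eventually (by simp)).mono fun _ h => h.differentiableAt (by simp)
  have h2 : ∀ᶠ z' in 𝓝 z, DifferentiableAt ℝ g (τ z') := by
    have : ContDiffAt ℝ 1 g (τ z) := hg.of_le (by simp)
    exact hτ.continuousAt.eventually
      ((this.eventually (by simp)).mono fun _ h => h.differentiableAt (by simp))
  have h3 : fderiv ℝ (g ∘ τ) =ᶠ[𝓝 z] fun z' => (fderiv ℝ g (τ z')).comp (fderiv ℝ τ z') := by
    filter_upwards [h1, h2] with z' e1 e2
    exact fderiv_comp z' e2 e1
  have h4 : HasFDerivAt (fderiv ℝ τ) (fderiv ℝ (fderiv ℝ τ) z) z :=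
    ((hτ.fderiv_right (m := ∞) (by simp)).differentiableAt (by simp)).hasFDerivAt
  have h5 : HasFDerivAt (fderiv ℝ g) (fderiv ℝ (fderiv ℝ g) (τ z)) (τ z) :=
    ((hg.fderiv_right (m := ∞) (by simp)).differentiableAt (by simp)).hasFDerivAt
  have h6 : HasFDerivAt (fun z' => fderiv ℝ g (τ z'))
      ((fderiv ℝ (fderiv ℝ g) (τ z)).comp (fderiv ℝ τ z)) z :=
    h5.comp z (hτ.differentiableAt (by simp)).hasFDerivAt
  rw [h3.fderiv_eq, (h6.clm_comp h4).fderiv, h0]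
  simp

/-- A pair of charts of `X` and of `Y`, in which `i` is the inclusion of `0 × ℝᵏ` in `ℝᵐ × ℝᵏ` and
`μ (x, y) = ‖x‖²`. -/
structure IsMorseChart (h : m + k = n) (i : Y → X) (μ : X → ℝ)
    (e : OpenPartialHomeomorph X (EuclideanSpace ℝ (Fin n)))
    (f : OpenPartialHomeomorph Y (EuclideanSpace ℝ (Fin k))) : Prop where
  mem_left : e ∈ smoothCharts n X
  mem_right : f ∈ smoothCharts k Y
  mem_iff : ∀ y, i y ∈ e.source ↔ y ∈ f.source
  split_apply : ∀ y ∈ f.source, split h (e (i y)) = (0, f y)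
  eq_norm_sq : ∀ x ∈ e.source, μ x = ‖(split h (e x)).1‖ ^ 2

/-- Every point of `Y` lies in a Morse chart: slice coordinates are corrected by the Morse lemma
with parameters. -/
theorem exists_isMorseChart (h : m + k = n) {i : Y → X}
    (hi : IsSmoothEmbedding (𝓡 k) (𝓡 n) ∞ i) {μ : X → ℝ} (hμ : IsMorseBott n μ (range i) m)
    (y₀ : Y) : ∃ e f, IsMorseChart h i μ e f ∧ y₀ ∈ f.source := by
  obtain ⟨e₁, he₁, f₁, hf₁, hy₀, hmem, happ⟩ := exists_slice_chart h hi y₀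
  set S := split h with hS
  set x₀ := i y₀ with hx₀
  have hx₀e : x₀ ∈ e₁.source := (hmem y₀).2 hy₀
  set z₀ := S (e₁ x₀) with hz₀
  have hz₀' : z₀ = (0, f₁ y₀) := happ y₀ hy₀
  set g : EuclideanSpace ℝ (Fin m) × EuclideanSpace ℝ (Fin k) → ℝ :=
    fun z => μ (e₁.symm (S.symm z)) with hg
  set W := (S.symm ⁻¹' e₁.target) ∩ (Prod.snd ⁻¹' f₁.target) with hW
  have hWo : IsOpen W := (e₁.open_target.preimage S.symm.continuous).inter
    (f₁.open_target.preimage continuous_snd)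
  have hz₀W : z₀ ∈ W := by
    refine ⟨?_, ?_⟩
    · rw [mem_preimage, hz₀, S.symm_apply_apply]
      exact e₁.map_source hx₀e
    · rw [mem_preimage, hz₀']
      exact f₁.map_source hy₀
  have hgs : ∀ z ∈ W, ContDiffAt ℝ ∞ g z := by
    intro z hz
    have h1 := contDiffAt_comp_symm (f := μ) (x := e₁.symm (S.symm z))
      hμ.smooth.contMDiffAt he₁ (e₁.map_target hz.1)
    rw [e₁.right_inv hz.1] at h1
    exact h1.comp z S.symm.contDiff.contDiffAt
  have hg0 : ∀ y ∈ f₁.target, g (0, y) = 0 := by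
    intro y hy
    have h1 := happ _ (f₁.map_target hy)
    rw [f₁.right_inv hy] at h1
    have h2 : S.symm (0, y) = e₁ (i (f₁.symm y)) := by rw [← h1, S.symm_apply_apply]
    simp only [hg]
    rw [h2, e₁.left_inv ((hmem _).2 (f₁.map_target hy)), hμ.eq_zero_iff]
    exact mem_range_self _
  -- A cut-off makes `g` a globally defined smooth function.
  obtain ⟨ε, hε, hεW⟩ := Metric.isOpen_iff.1 hWo z₀ hz₀W
  let χ : ContDiffBump z₀ := ⟨ε / 4, ε / 2, by positivity, by linarith⟩
  have hχW : ∀ z, χ z ≠ 0 → z ∈ W := fun z hz => by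
    have : z ∈ Function.support χ := hz
    rw [χ.support_eq] at this
    exact hεW (Metric.ball_subset_ball (by change ε / 2 ≤ ε; linarith) this)
  have hχW' : tsupport χ ⊆ W := by
    rw [χ.tsupport_eq]
    exact (Metric.closedBall_subset_ball (by change ε / 2 < ε; linarith)).trans hεW
  set G := fun z => χ z * g z with hG
  have hGs : ContDiff ℝ ∞ G := by
    rw [contDiff_iff_contDiffAt]
    intro z
    by_cases hz : z ∈ tsupport χ
    · exact χ.contDiff.contDiffAt.mul (hgs z (hχW' hz))
    · refine (contDiffAt_const (c := (0 : ℝ))).congr_of_eventuallyEq ?_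
      filter_upwards [notMem_tsupport_iff_eventuallyEq.1 hz] with z' hz'
      simp [hG, hz']
  have hG0 : ∀ y, G (0, y) = 0 := by
    intro y
    by_cases hy : χ ((0 : EuclideanSpace ℝ (Fin m)), y) = 0
    · simp [hG, hy]
    · simp [hG, hg0 y (hχW _ hy).2]
  have hGn : ∀ z, 0 ≤ G z := fun z => mul_nonneg χ.nonneg (hμ.nonneg _)
  have hGg : G =ᶠ[𝓝 z₀] g := by
    filter_upwards [χ.eventuallyEq_one] with z hz
    simp [hG, hz]
  have hG1 : ∀ y, fderiv ℝ G (0, y) = 0 := fun y => by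
    refine IsLocalMin.fderiv_eq_zero (Eventually.of_forall fun z => ?_)
    rw [hG0]
    exact hGn z
  -- The rank of the Hessian is given in the preferred chart `c`; the coordinate change `τ` carries
  -- it over to the slice coordinates.
  set c := chartAt (EuclideanSpace ℝ (Fin n)) x₀ with hc
  have hcm : c ∈ smoothCharts n X := chartAt_mem_smoothCharts x₀
  have hx₀c : x₀ ∈ c.source := mem_chart_source _ _
  set τ : EuclideanSpace ℝ (Fin m) × EuclideanSpace ℝ (Fin k) → EuclideanSpace ℝ (Fin n) :=
    fun z => (c ∘ e₁.symm) (S.symm z) with hτ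
  have he₁s : e₁.symm (S.symm z₀) = x₀ := by
    rw [hz₀, S.symm_apply_apply, e₁.left_inv hx₀e]
  have hτz : τ z₀ = c x₀ := by
    simp only [hτ, Function.comp_apply, he₁s]
  have hce : ContDiffAt ℝ ∞ (c ∘ e₁.symm) (S.symm z₀) :=
    contDiffAt_chart_comp_symm he₁ hcm hz₀W.1 (by rw [he₁s]; exact hx₀c)
  have hτs : ContDiffAt ℝ ∞ τ z₀ := hce.comp z₀ S.symm.contDiff.contDiffAt
  have hμc : ContDiffAt ℝ ∞ (μ ∘ c.symm) (τ z₀) := by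
    rw [hτz]
    exact contDiffAt_comp_symm hμ.smooth.contMDiffAt hcm hx₀c
  have hμ0 : fderiv ℝ (μ ∘ c.symm) (τ z₀) = 0 := by
    refine IsLocalMin.fderiv_eq_zero (Eventually.of_forall fun z => ?_)
    rw [hτz, Function.comp_apply, c.left_inv hx₀c, (hμ.eq_zero_iff x₀).2 (mem_range_self _)]
    exact hμ.nonneg _
  have hgτ : G =ᶠ[𝓝 z₀] (μ ∘ c.symm) ∘ τ := by
    have h1 : ∀ᶠ z in 𝓝 z₀, z ∈ W := hWo.mem_nhds hz₀W
    have h2 : ∀ᶠ z in 𝓝 z₀, e₁.symm (S.symm z) ∈ c.source := by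
      have h3 : ContinuousAt (fun z => e₁.symm (S.symm z)) z₀ :=
        ContinuousAt.comp (f := S.symm) (e₁.continuousAt_symm hz₀W.1) S.symm.continuous.continuousAt
      refine h3 (c.open_source.mem_nhds ?_)
      simp only [he₁s]
      exact hx₀c
    filter_upwards [hGg, h2] with z e1 e2
    rw [e1]
    simp only [hg, hτ, Function.comp_apply]
    rw [c.left_inv e2]
  set T := fderiv ℝ τ z₀ with hT
  have hTb : Function.Bijective T := by
    have h1 : T = (fderiv ℝ (c ∘ e₁.symm) (S.symm z₀)).comp
        (S.symm : _ →L[ℝ] EuclideanSpace ℝ (Fin n)) := by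
      rw [hT, hτ]
      have := fderiv_comp z₀ (hce.differentiableAt (by simp)) S.symm.differentiableAt
      rw [S.symm.fderiv] at this
      exact this
    have h2 : (fderiv ℝ (c ∘ e₁.symm) (S.symm z₀)).det ≠ 0 := by
      have := chartDeriv_det_ne_zero he₁ (z := S.symm z₀) hz₀W.1
      rwa [chartDeriv, he₁s] at this
    have h3 : Function.Bijective (fderiv ℝ (c ∘ e₁.symm) (S.symm z₀)) := by
      have h4 := LinearEquiv.bijective (LinearMap.equivOfDetNeZero
        (fderiv ℝ (c ∘ e₁.symm) (S.symm z₀) : EuclideanSpace ℝ (Fin n) →ₗ[ℝ] _) h2)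
      exact h4
    rw [h1]
    exact h3.comp S.symm.bijective
  set H₀ := fderiv ℝ (fderiv ℝ (μ ∘ c.symm)) (c x₀) with hH₀
  have hHess : ∀ u v, fderiv ℝ (fderiv ℝ G) z₀ u v = H₀ (T u) (T v) := by
    intro u v
    have : fderiv ℝ G =ᶠ[𝓝 z₀] fderiv ℝ ((μ ∘ c.symm) ∘ τ) := hgτ.fderiv
    rw [this.fderiv_eq, fderiv_fderiv_comp_of_fderiv_eq_zero hτs hμc hμ0, hτz]
  have hrank : Module.finrank ℝ (LinearMap.range H₀.toLinearMap) = m :=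
    hμ.rank_hessian x₀ (mem_range_self _)
  -- The Hessian vanishes in the directions of `0 × ℝᵏ`.
  have hHsnd : ∀ w, fderiv ℝ (fderiv ℝ G) z₀ (0, w) = 0 := by
    intro w
    have hG' : ContDiff ℝ ∞ (fderiv ℝ G) := (contDiff_infty_iff_fderiv.1 hGs).2
    have h1 : HasFDerivAt (fun y : EuclideanSpace ℝ (Fin k) =>
        ((0, y) : EuclideanSpace ℝ (Fin m) × EuclideanSpace ℝ (Fin k)))
        (ContinuousLinearMap.inr ℝ _ _) (f₁ y₀) := hasFDerivAt_prodMk_right _ _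
    have h2 := (hG'.differentiable (by simp) (0, f₁ y₀)).hasFDerivAt.comp (f₁ y₀) h1
    have h3 : (fderiv ℝ G) ∘ (fun y : EuclideanSpace ℝ (Fin k) =>
        ((0, y) : EuclideanSpace ℝ (Fin m) × EuclideanSpace ℝ (Fin k))) = fun _ => 0 :=
      funext fun y => hG1 y
    rw [h3] at h2
    have h4 := h2.unique (hasFDerivAt_const _ _)
    rw [hz₀']
    exact DFunLike.congr_fun h4 w
  have hkerT : ∀ u, fderiv ℝ (fderiv ℝ G) z₀ u = 0 → T u ∈ LinearMap.ker H₀.toLinearMap := by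
    intro u hu
    rw [LinearMap.mem_ker]
    ext1 v'
    obtain ⟨v, rfl⟩ := hTb.2 v'
    have := hHess u v
    rw [hu] at this
    exact this.symm
  -- The kernel of the Hessian has dimension `n - m = k`, hence it is exactly `0 × ℝᵏ`.
  have hinj : ∀ u, (∀ v, fderiv ℝ (fderiv ℝ G) (0, f₁ y₀) (u, 0) (v, 0) = 0) → u = 0 := by
    intro u hu
    rw [← hz₀'] at hu
    let N : EuclideanSpace ℝ (Fin k) →ₗ[ℝ] LinearMap.ker H₀.toLinearMap :=
      LinearMap.codRestrict _ (T.toLinearMap ∘ₗ LinearMap.inr ℝ _ _)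
        fun w => hkerT _ (hHsnd w)
    have hNi : Function.Injective N := by
      intro w w' hww
      have h1 : T (0, w) = T (0, w') := congrArg Subtype.val hww
      exact (Prod.ext_iff.1 (hTb.1 h1)).2
    have hfr : Module.finrank ℝ (EuclideanSpace ℝ (Fin k)) =
        Module.finrank ℝ (LinearMap.ker H₀.toLinearMap) := by
      have := LinearMap.finrank_range_add_finrank_ker H₀.toLinearMap
      rw [hrank] at this
      simp only [finrank_euclideanSpace, Fintype.card_fin] at this ⊢
      omega
    have hNs := (LinearMap.injective_iff_surjective_of_finrank_eq_finrank hfr).1 hNi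
    have hu0 : fderiv ℝ (fderiv ℝ G) z₀ (u, 0) = 0 := by
      refine ContinuousLinearMap.ext fun v => ?_
      have h1 : v = (v.1, 0) + (0, v.2) := by simp
      rw [h1, map_add, hu]
      rw [(hGs.contDiffAt.isSymmSndFDerivAt (n := ∞) (by simpa using ENat.LEInfty.out)).eq, hHsnd]
      simp
    obtain ⟨w, hw⟩ := hNs ⟨_, hkerT _ hu0⟩
    have h1 : T (0, w) = T (u, 0) := congrArg Subtype.val hw
    exact (Prod.ext_iff.1 (hTb.1 h1)).1.symm
  obtain ⟨Ψ, hΨ0, hΨs, hΨs', hΨ⟩ := exists_morse_coordinates hGs hG0 hGn (f₁ y₀) hinj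
  set Ψ' := Ψ.restr (Metric.ball z₀ (ε / 4)) with hΨ'
  have hΨ'src : Ψ'.source = Ψ.source ∩ Metric.ball z₀ (ε / 4) := by
    rw [hΨ', OpenPartialHomeomorph.restr_source, Metric.isOpen_ball.interior_eq]
  set γ := (S.toHomeomorph.toOpenPartialHomeomorph.trans Ψ').trans
    S.symm.toHomeomorph.toOpenPartialHomeomorph with hγ
  have hγsrc : ∀ z, z ∈ γ.source ↔ S z ∈ Ψ'.source := by
    intro z
    simp [hγ]
  have hγs : ContDiffOn ℝ ∞ γ γ.source := by
    refine S.symm.contDiff.comp_contDiffOn ((hΨs.comp S.contDiff.contDiffOn ?_))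
    intro z hz
    have := (hγsrc z).1 hz
    rw [hΨ'src] at this
    exact this.1
  have hγs' : ContDiffOn ℝ ∞ γ.symm γ.target := by
    refine S.symm.contDiff.comp_contDiffOn ((hΨs'.comp S.contDiff.contDiffOn ?_))
    intro z hz
    have h1 : S z ∈ Ψ'.target := by
      have : z ∈ γ.target := hz
      simpa [hγ] using this
    rw [hΨ', OpenPartialHomeomorph.restr_target] at h1
    exact h1.1
  set e := e₁.trans γ with he
  have hsrc : ∀ x, x ∈ e.source ↔ x ∈ e₁.source ∧ S (e₁ x) ∈ Ψ'.source := by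
    intro x
    rw [he, OpenPartialHomeomorph.trans_source]
    exact and_congr_right fun _ => hγsrc _
  have hea : ∀ x, S (e x) = Ψ (S (e₁ x)) := fun x => S.apply_symm_apply _
  have hpre : IsOpen (i ⁻¹' e.source) := e.open_source.preimage hi.isEmbedding.continuous
  refine ⟨e, f₁.restr (i ⁻¹' e.source), ⟨trans_mem_smoothCharts he₁ hγs hγs',
    restr_mem_smoothCharts hf₁ hpre, fun y => ?_, fun y hy => ?_, fun x hx => ?_⟩, ?_⟩
  · rw [OpenPartialHomeomorph.restr_source, hpre.interior_eq]
    exact ⟨fun hy => ⟨(hmem y).1 ((hsrc _).1 hy).1, hy⟩, fun hy => hy.2⟩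
  · rw [OpenPartialHomeomorph.restr_source, hpre.interior_eq] at hy
    have h1 := ((hsrc _).1 hy.2).2
    rw [hΨ'src] at h1
    obtain ⟨h2, -, h3⟩ := hΨ _ h1.1
    rw [hea]
    rw [happ y hy.1] at h2 h3 ⊢
    exact Prod.ext (h3 rfl) h2
  · have h1 := (hsrc _).1 hx
    rw [hΨ'src] at h1
    rw [hea, ← (hΨ _ h1.2.1).2.1]
    have h2 : χ (S (e₁ x)) = 1 := χ.one_of_mem_closedBall (Metric.ball_subset_closedBall h1.2.2)
    simp only [hG, h2, one_mul, hg]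
    rw [S.symm_apply_apply, e₁.left_inv h1.1]
  · rw [OpenPartialHomeomorph.restr_source, hpre.interior_eq]
    refine ⟨hy₀, (hsrc _).2 ⟨hx₀e, ?_⟩⟩
    rw [hΨ'src]
    refine ⟨?_, Metric.mem_ball_self (by positivity)⟩
    change z₀ ∈ _
    rw [hz₀']
    exact hΨ0

end MorseChart

/-! ### Forms, orientations and pull-backs in charts -/

section ChartForms

variable {d : ℕ} {Z : Type*} [TopologicalSpace Z]
  [ChartedSpace (EuclideanSpace ℝ (Fin d)) Z] [IsManifold (𝓡 d) ∞ Z]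
  {e : OpenPartialHomeomorph Z (EuclideanSpace ℝ (Fin d))} {κ : ℝ → ℝ}

/-- The form on the domain of the chart `f` whose expression in this chart is `ρ`. -/
def formOfChart (κ : ℝ → ℝ) {q : ℕ} (f : OpenPartialHomeomorph Z (EuclideanSpace ℝ (Fin d)))
    (ρ : EuclideanSpace ℝ (Fin d) → Alt d q) (y : Z) : Alt d q :=
  κ (transDeriv f (chartAt _ y) (chartAt _ y y)).det •
    (ρ (f y)).compContinuousLinearMap (transDeriv f (chartAt _ y) (chartAt _ y y))

theorem chartRep_formOfChart (hκ : IsSignChar κ) {q : ℕ} (he : e ∈ smoothCharts d Z)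
    (ρ : EuclideanSpace ℝ (Fin d) → Alt d q) {z : EuclideanSpace ℝ (Fin d)} (hz : z ∈ e.target) :
    chartRep κ e (formOfChart κ e ρ) z = ρ z := by
  set c := chartAt (EuclideanSpace ℝ (Fin d)) (e.symm z)
  have hc : c ∈ smoothCharts d Z := chartAt_mem_smoothCharts _
  have hx : e.symm z ∈ c.source := mem_chart_source _ _
  have h1 : (transDeriv e c (c (e.symm z))).comp (chartDeriv e z) =
      ContinuousLinearMap.id ℝ _ := by
    have h2 := transDeriv_comp (e := c) (e' := e) (e'' := e) hc he he hz hx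
      (e.map_target hz)
    rw [← chartDeriv_eq_transDeriv] at h2
    rw [← transDeriv_self hz]
    exact h2.symm
  have h3 := det_comp_clm (transDeriv e c (c (e.symm z))) (chartDeriv e z)
  rw [h1] at h3
  rw [chartRep, formOfChart]
  have h4 : ((κ (transDeriv e c (c (e.symm z))).det •
      (ρ (e (e.symm z))).compContinuousLinearMap (transDeriv e c (c (e.symm z)))
      ).compContinuousLinearMap (chartDeriv e z)) = κ (transDeriv e c (c (e.symm z))).det •
      (ρ z).compContinuousLinearMap ((transDeriv e c (c (e.symm z))).comp (chartDeriv e z)) := by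
    rw [e.right_inv hz]
    rfl
  rw [h4, h1, smul_smul, mul_comm, ← hκ.map_mul, ← h3]
  have h5 : (ContinuousLinearMap.id ℝ (EuclideanSpace ℝ (Fin d))).det = 1 := by
    simp [ContinuousLinearMap.det]
  rw [h5, hκ.map_one, one_smul]
  rfl

theorem smoothFormAt_formOfChart (hκ : IsSignChar κ) {q : ℕ} (he : e ∈ smoothCharts d Z)
    {ρ : EuclideanSpace ℝ (Fin d) → Alt d q} {y : Z} (hy : y ∈ e.source)
    (hρ : ContDiffAt ℝ ∞ ρ (e y)) : SmoothFormAt κ (formOfChart κ e ρ) y := by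
  refine ⟨e, he, hy, hρ.congr_of_eventuallyEq ?_⟩
  filter_upwards [e.open_target.mem_nhds (e.map_source hy)] with z hz
  exact chartRep_formOfChart hκ he ρ hz

/-- A form is determined at a point by its expression in a chart. -/
theorem eq_of_chartRep_eq (hκ : IsSignChar κ) {q : ℕ} (he : e ∈ smoothCharts d Z)
    {w w' : Z → Alt d q} {z : EuclideanSpace ℝ (Fin d)} (hz : z ∈ e.target)
    (h : chartRep κ e w z = chartRep κ e w' z) : w (e.symm z) = w' (e.symm z) := by
  have hd := chartDeriv_det_ne_zero he hz
  rw [chartRep, chartRep] at h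
  have h1 := smul_right_injective _ (hκ.ne_zero hd) h
  have hsurj : Function.Surjective (chartDeriv e z) := by
    have h2 := LinearEquiv.surjective (LinearMap.equivOfDetNeZero
      (chartDeriv e z : EuclideanSpace ℝ (Fin d) →ₗ[ℝ] _) hd)
    exact h2
  ext v
  choose g hg using fun j => hsurj (v j)
  have h2 := DFunLike.congr_fun h1 g
  simp only [ContinuousAlternatingMap.compContinuousLinearMap_apply] at h2
  rwa [show (⇑(chartDeriv e z) ∘ g) = v from funext hg] at h2

/-- The sign of an orientation in a chart: `1` where the chart preserves orientations. -/
def chartSign (o : ManifoldOrientation d Z)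
    (e : OpenPartialHomeomorph Z (EuclideanSpace ℝ (Fin d))) (z : EuclideanSpace ℝ (Fin d)) : ℝ :=
  Real.sign (chartDeriv e z).det * o.sgn (e.symm z)

theorem chartSign_eq_one_or {o : ManifoldOrientation d Z} (he : e ∈ smoothCharts d Z)
    {z : EuclideanSpace ℝ (Fin d)} (hz : z ∈ e.target) :
    chartSign o e z = 1 ∨ chartSign o e z = -1 := by
  have h1 : Real.sign (chartDeriv e z).det = 1 ∨ Real.sign (chartDeriv e z).det = -1 :=
    (Real.sign_apply_eq_of_ne_zero _ (chartDeriv_det_ne_zero he hz)).symm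
  rw [chartSign]
  rcases h1 with h1 | h1 <;> rcases o.sgn_eq (e.symm z) with h2 | h2 <;> rw [h1, h2] <;> norm_num

theorem eventually_chartSign_eq (o : ManifoldOrientation d Z) (he : e ∈ smoothCharts d Z)
    {z : EuclideanSpace ℝ (Fin d)} (hz : z ∈ e.target) :
    ∀ᶠ z' in 𝓝 z, chartSign o e z' = chartSign o e z := by
  set c := chartAt (EuclideanSpace ℝ (Fin d)) (e.symm z)
  have hc : c ∈ smoothCharts d Z := chartAt_mem_smoothCharts _
  have hx : e.symm z ∈ c.source := mem_chart_source _ _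
  have h1 : ContinuousAt (fun z' => frameSign d (e.symm z) (e.symm z') * o.sgn (e.symm z')) z := by
    have h2 := (o.continuous_sgn (e.symm z)).continuousAt (c.open_source.mem_nhds hx)
    exact ContinuousAt.comp (f := e.symm) h2 (e.continuousAt_symm hz)
  have h3 : (fun z' => (frameSign d (e.symm z) (e.symm z') * o.sgn (e.symm z')) *
      Real.sign (transDeriv c e z').det) =ᶠ[𝓝 z] chartSign o e := by
    filter_upwards [eventually_mem_target e c.open_source hz hx] with z' hz'
    rw [frameSign, chartSign, chartDeriv_comp hc he hz'.1 hz'.2, det_comp_clm,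
      isSignChar_sign.map_mul]
    have h4 := tangentCoordChange_eq_chartDeriv (e.symm z) (z := c (e.symm z'))
      (c.map_source hz'.2)
    rw [c.left_inv hz'.2] at h4
    rw [h4]
    ring
  have h5 : ContinuousAt (chartSign o e) z := by
    refine ContinuousAt.congr (h1.mul ?_) h3
    have := eventually_signChar_transDeriv isSignChar_sign hc he hz hx
    exact (continuousAt_const (y := Real.sign (transDeriv c e z).det)).congr
      (this.mono fun _ h => h.symm)
  filter_upwards [h5.eventually (Metric.ball_mem_nhds _ one_pos),
    e.open_target.mem_nhds hz] with z' hz' hzt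
  rw [Real.dist_eq] at hz'
  rcases chartSign_eq_one_or (o := o) he hz with h6 | h6 <;>
    rcases chartSign_eq_one_or (o := o) he hzt with h7 | h7 <;> rw [h6, h7] at hz' ⊢ <;>
    norm_num at hz'

theorem mfderiv_comp_chartDeriv {F : Type*} [NormedAddCommGroup F] [NormedSpace ℝ F] {g : Z → F}
    (hg : ContMDiff (𝓡 d) 𝓘(ℝ, F) ∞ g) (he : e ∈ smoothCharts d Z)
    {z : EuclideanSpace ℝ (Fin d)} (hz : z ∈ e.target) :
    (mfderiv (𝓡 d) 𝓘(ℝ, F) g (e.symm z) : EuclideanSpace ℝ (Fin d) →L[ℝ] F).comp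
      (chartDeriv e z) = fderiv ℝ (g ∘ e.symm) z := by
  set c := chartAt (EuclideanSpace ℝ (Fin d)) (e.symm z)
  have hc : c ∈ smoothCharts d Z := chartAt_mem_smoothCharts _
  have hx : e.symm z ∈ c.source := mem_chart_source _ _
  have h1 : mfderiv (𝓡 d) 𝓘(ℝ, F) g (e.symm z) = fderiv ℝ (g ∘ c.symm) (c (e.symm z)) := by
    refine (hg.mdifferentiable (by simp) _).mfderiv.trans ?_
    rw [ModelWithCorners.range_eq_univ, fderivWithin_univ]
    rfl
  have h2 : DifferentiableAt ℝ (g ∘ c.symm) ((c ∘ e.symm) z) :=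
    (contDiffAt_comp_symm hg.contMDiffAt hc hx).differentiableAt (by simp)
  have h3 : DifferentiableAt ℝ (c ∘ e.symm) z :=
    (contDiffAt_chart_comp_symm he hc hz hx).differentiableAt (by simp)
  have h4 : g ∘ e.symm =ᶠ[𝓝 z] (g ∘ c.symm) ∘ (c ∘ e.symm) := by
    filter_upwards [eventually_mem_target e c.open_source hz hx] with z' hz'
    simp only [Function.comp_apply]
    rw [c.left_inv hz'.2]
  rw [h4.fderiv_eq, fderiv_comp z h2 h3, h1]
  rfl

theorem chartRep_differential {μ : Z → ℝ} (hμ : ContMDiff (𝓡 d) 𝓘(ℝ, ℝ) ∞ μ)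
    (he : e ∈ smoothCharts d Z) {z : EuclideanSpace ℝ (Fin d)} (hz : z ∈ e.target) :
    chartRep (fun _ => 1) e (differential μ) z = oneForm (fderiv ℝ (μ ∘ e.symm) z) := by
  rw [chartRep, one_smul, ← mfderiv_comp_chartDeriv hμ he hz]
  rfl

theorem contDiffAt_oneForm {a : EuclideanSpace ℝ (Fin d) → EuclideanSpace ℝ (Fin d) →L[ℝ] ℝ}
    {z : EuclideanSpace ℝ (Fin d)} (ha : ContDiffAt ℝ ∞ a z) :
    ContDiffAt ℝ ∞ (fun z => oneForm (a z)) z := by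
  refine contDiffAt_alt_of_apply fun v => ?_
  simp only [oneForm_apply]
  exact Complex.ofRealCLM.contDiff.contDiffAt.comp z (ha.clm_apply contDiffAt_const)

theorem smoothFormAt_differential {μ : Z → ℝ} (hμ : ContMDiff (𝓡 d) 𝓘(ℝ, ℝ) ∞ μ) (x : Z) :
    SmoothFormAt (fun _ => 1) (differential (d := d) μ) x := by
  set e := chartAt (EuclideanSpace ℝ (Fin d)) x
  have he : e ∈ smoothCharts d Z := chartAt_mem_smoothCharts x
  have hx : x ∈ e.source := mem_chart_source _ x
  refine ⟨e, he, hx, ?_⟩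
  have h1 : ContDiffAt ℝ ∞ (fderiv ℝ (μ ∘ e.symm)) (e x) :=
    (contDiffAt_comp_symm hμ.contMDiffAt he hx).fderiv_right (by simp)
  refine (contDiffAt_oneForm h1).congr_of_eventuallyEq ?_
  filter_upwards [e.open_target.mem_nhds (e.map_source hx)] with z hz
  exact chartRep_differential hμ he hz

end ChartForms

section Pullback

variable {n k : ℕ} {X Y : Type*} [TopologicalSpace X]
  [ChartedSpace (EuclideanSpace ℝ (Fin n)) X] [IsManifold (𝓡 n) ∞ X] [TopologicalSpace Y]
  [ChartedSpace (EuclideanSpace ℝ (Fin k)) Y] [IsManifold (𝓡 k) ∞ Y]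

/-- The pull-back of a form in charts in which `i` is the map `J`. -/
theorem chartRep_pullback_of_eventually {i : Y → X} (hi : ContMDiff (𝓡 k) (𝓡 n) ∞ i) {q : ℕ}
    (φ : X → Alt n q)
    {e : OpenPartialHomeomorph X (EuclideanSpace ℝ (Fin n))} (he : e ∈ smoothCharts n X)
    {f : OpenPartialHomeomorph Y (EuclideanSpace ℝ (Fin k))} (hf : f ∈ smoothCharts k Y)
    {J : EuclideanSpace ℝ (Fin k) → EuclideanSpace ℝ (Fin n)}
    {b : EuclideanSpace ℝ (Fin k)} (hb : b ∈ f.target)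
    (hJd : DifferentiableAt ℝ J b)
    (hJ : ∀ᶠ b in 𝓝 b, J b ∈ e.target ∧ e.symm (J b) = i (f.symm b)) :
    chartRep (fun _ => 1) f (pullback i φ) b =
      (chartRep (fun _ => 1) e φ (J b)).compContinuousLinearMap (fderiv ℝ J b) := by
  set y := f.symm b with hy
  set c := chartAt (EuclideanSpace ℝ (Fin n)) (i y) with hc
  set c' := chartAt (EuclideanSpace ℝ (Fin k)) y with hc'
  have hcm : c ∈ smoothCharts n X := chartAt_mem_smoothCharts _
  have hcm' : c' ∈ smoothCharts k Y := chartAt_mem_smoothCharts _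
  have hx : i y ∈ c.source := mem_chart_source _ _
  have hyc : y ∈ c'.source := mem_chart_source _ _
  obtain ⟨hJt, hJe⟩ := hJ.self_of_nhds
  have h1 : mfderiv (𝓡 k) (𝓡 n) i y = fderiv ℝ (c ∘ i ∘ c'.symm) (c' y) := by
    refine (hi.mdifferentiable (by simp) _).mfderiv.trans ?_
    rw [ModelWithCorners.range_eq_univ, fderivWithin_univ]
    rfl
  have h2 : DifferentiableAt ℝ (c ∘ i ∘ c'.symm) ((c' ∘ f.symm) b) := by
    have h3 := (contMDiffAt_iff.1 (hi.contMDiffAt (x := y))).2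
    rw [ModelWithCorners.range_eq_univ, contDiffWithinAt_univ] at h3
    exact h3.differentiableAt (by simp)
  have h4 : DifferentiableAt ℝ (c' ∘ f.symm) b :=
    (contDiffAt_chart_comp_symm hf hcm' hb hyc).differentiableAt (by simp)
  have hcJ : e.symm (J b) ∈ c.source := by rw [hJe]; exact hx
  have h5 : DifferentiableAt ℝ (c ∘ e.symm) (J b) :=
    (contDiffAt_chart_comp_symm he hcm hJt hcJ).differentiableAt (by simp)
  have h6 : (c ∘ i ∘ c'.symm) ∘ (c' ∘ f.symm) =ᶠ[𝓝 b] (c ∘ e.symm) ∘ J := by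
    filter_upwards [eventually_mem_target f c'.open_source hb hyc, hJ] with b' hb' hJb'
    simp only [Function.comp_apply]
    rw [c'.left_inv hb'.2, hJb'.2]
  have h7 := h6.fderiv_eq (𝕜 := ℝ)
  rw [fderiv_comp b h2 h4, fderiv_comp b h5 hJd] at h7
  have h8 : chartDeriv e (J b) = fderiv ℝ (c ∘ e.symm) (J b) := by rw [chartDeriv, hJe]
  rw [chartRep, chartRep, one_smul, one_smul, pullback]
  have h9 : (mfderiv (𝓡 k) (𝓡 n) i y : EuclideanSpace ℝ (Fin k) →L[ℝ]
      EuclideanSpace ℝ (Fin n)).comp (chartDeriv f b) =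
        (chartDeriv e (J b)).comp (fderiv ℝ J b) := by
    rw [h8, ← h7, h1]
    rfl
  change (φ (i y)).compContinuousLinearMap ((mfderiv (𝓡 k) (𝓡 n) i y : EuclideanSpace ℝ (Fin k)
    →L[ℝ] EuclideanSpace ℝ (Fin n)).comp (chartDeriv f b)) = _
  rw [h9, hJe]
  rfl

theorem chartRep_pullback {i : Y → X} (hi : ContMDiff (𝓡 k) (𝓡 n) ∞ i) {q : ℕ} (φ : X → Alt n q)
    {e : OpenPartialHomeomorph X (EuclideanSpace ℝ (Fin n))} (he : e ∈ smoothCharts n X)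
    {f : OpenPartialHomeomorph Y (EuclideanSpace ℝ (Fin k))} (hf : f ∈ smoothCharts k Y)
    {J : EuclideanSpace ℝ (Fin k) →L[ℝ] EuclideanSpace ℝ (Fin n)}
    {b : EuclideanSpace ℝ (Fin k)} (hb : b ∈ f.target)
    (hJ : ∀ b ∈ f.target, J b ∈ e.target ∧ e.symm (J b) = i (f.symm b)) :
    chartRep (fun _ => 1) f (pullback i φ) b =
      (chartRep (fun _ => 1) e φ (J b)).compContinuousLinearMap J := by
  have h1 := chartRep_pullback_of_eventually hi φ he hf hb J.differentiableAt
    (mem_of_superset (f.open_target.mem_nhds hb) hJ)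
  rwa [J.fderiv] at h1

theorem smoothFormAt_pullback {i : Y → X} (hi : ContMDiff (𝓡 k) (𝓡 n) ∞ i) {q : ℕ}
    {φ : X → Alt n q} {y : Y} (hφ : SmoothFormAt (fun _ => 1) φ (i y)) :
    SmoothFormAt (fun _ => 1) (pullback (k := k) i φ) y := by
  set c := chartAt (EuclideanSpace ℝ (Fin n)) (i y)
  set c' := chartAt (EuclideanSpace ℝ (Fin k)) y
  have hc : c ∈ smoothCharts n X := chartAt_mem_smoothCharts _
  have hc' : c' ∈ smoothCharts k Y := chartAt_mem_smoothCharts _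
  have hx : i y ∈ c.source := mem_chart_source _ _
  have hy : y ∈ c'.source := mem_chart_source _ _
  set J : EuclideanSpace ℝ (Fin k) → EuclideanSpace ℝ (Fin n) := c ∘ i ∘ c'.symm
  have hJ : ContDiffAt ℝ ∞ J (c' y) := by
    have h3 := (contMDiffAt_iff.1 (hi.contMDiffAt (x := y))).2
    rwa [ModelWithCorners.range_eq_univ, contDiffWithinAt_univ] at h3
  have hJy : J (c' y) = c (i y) := by
    change c (i (c'.symm (c' y))) = _
    rw [c'.left_inv hy]
  have hev : ∀ᶠ b in 𝓝 (c' y), b ∈ c'.target ∧ i (c'.symm b) ∈ c.source :=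
    eventually_mem_target c' (c.open_source.preimage hi.continuous) (c'.map_source hy)
      (by rw [c'.left_inv hy]; exact hx)
  refine ⟨c', hc', hy, ?_⟩
  have h1 : ContDiffAt ℝ ∞ (fun b => (chartRep (fun _ => 1) c φ (J b)).compContinuousLinearMap
      (fderiv ℝ J b)) (c' y) := by
    have h2 : ContDiffAt ℝ ∞ (chartRep (fun _ => 1) c φ) (J (c' y)) := by
      rw [hJy]
      exact hφ.contDiffAt isSignChar_one hc hx
    exact contDiffAt_compContinuousLinearMap (h2.comp (c' y) hJ) (hJ.fderiv_right (by simp))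
  refine h1.congr_of_eventuallyEq ?_
  filter_upwards [hev.eventually_nhds,
    ((hJ.of_le (m := 1) (by simp)).eventually (by simp))] with b hb hJb
  refine chartRep_pullback_of_eventually hi φ hc hc' hb.self_of_nhds.1
    (hJb.differentiableAt (by simp)) ?_
  filter_upwards [hb] with b' hb'
  exact ⟨c.map_source hb'.2, c.left_inv hb'.2⟩

end Pullback

/-! ### Forms on `ℝᵐ × ℝᵏ` with a tame singularity along `0 × ℝᵏ` -/

section Normal

variable {m k n : ℕ}

/-- The inclusion of `ℝᵏ` into `ℝⁿ` as `0 × ℝᵏ`. -/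
def tangentIncl (h : m + k = n) : EuclideanSpace ℝ (Fin k) →L[ℝ] EuclideanSpace ℝ (Fin n) :=
  (split h).symm.toContinuousLinearMap.comp (ContinuousLinearMap.inr ℝ _ _)

/-- The `a`-th basis vector of the factor `ℝᵐ` of `ℝⁿ`. -/
def normalVec (h : m + k = n) (a : Fin m) : EuclideanSpace ℝ (Fin n) :=
  (split h).symm (EuclideanSpace.single a 1, 0)

/-- The projection of `ℝⁿ` to the factor `ℝᵐ`. -/
def normalProj (h : m + k = n) : EuclideanSpace ℝ (Fin n) →L[ℝ] EuclideanSpace ℝ (Fin m) :=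
  (ContinuousLinearMap.fst ℝ _ _).comp (split h).toContinuousLinearMap

/-- The `a`-th coordinate of the factor `ℝᵐ`, as a linear form on `ℝⁿ`. -/
def normalCoord (h : m + k = n) (a : Fin m) : EuclideanSpace ℝ (Fin n) →L[ℝ] ℝ :=
  (EuclideanSpace.proj a).comp (normalProj h)

theorem normalProj_apply (h : m + k = n) (z : EuclideanSpace ℝ (Fin n)) :
    normalProj h z = (split h z).1 := rfl

theorem split_tangentIncl (h : m + k = n) (b : EuclideanSpace ℝ (Fin k)) :
    split h (tangentIncl h b) = (0, b) :=
  (split h).apply_symm_apply _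

theorem split_normalVec (h : m + k = n) (a : Fin m) :
    split h (normalVec h a) = (EuclideanSpace.single a 1, 0) :=
  (split h).apply_symm_apply _

theorem normalCoord_normalVec (h : m + k = n) (a b : Fin m) :
    normalCoord h a (normalVec h b) = if a = b then 1 else 0 := by
  change (split h (normalVec h b)).1 a = _
  rw [split_normalVec]
  simp

theorem normalCoord_tangentIncl (h : m + k = n) (a : Fin m) (b : EuclideanSpace ℝ (Fin k)) :
    normalCoord h a (tangentIncl h b) = 0 := by
  change (split h (tangentIncl h b)).1 a = _
  rw [split_tangentIncl]
  rfl

theorem normalVec_eq_single (h : m + k = n) (a : Fin m) :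
    normalVec h a = EuclideanSpace.single (Fin.cast h (Fin.castAdd k a)) 1 := by
  rw [normalVec, ← split_single_castAdd, ContinuousLinearEquiv.symm_apply_apply]

theorem tangentIncl_single (h : m + k = n) (b : Fin k) :
    tangentIncl h (EuclideanSpace.single b 1) =
      EuclideanSpace.single (Fin.cast h (Fin.natAdd m b)) 1 := by
  change (split h).symm (0, EuclideanSpace.single b 1) = _
  rw [← split_single_natAdd, ContinuousLinearEquiv.symm_apply_apply]

/-- The standard basis of `ℝⁿ` consists of the normal and the tangential basis vectors. -/
theorem append_normalVec_tangentIncl (h : m + k = n) (j : Fin (m + k)) :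
    Fin.append (normalVec h) (fun b => tangentIncl h (EuclideanSpace.single b 1)) j =
      EuclideanSpace.single (Fin.cast h j) 1 := by
  refine Fin.addCases (fun a => ?_) (fun b => ?_) j
  · rw [Fin.append_left, normalVec_eq_single]
  · rw [Fin.append_right, tangentIncl_single]

/-- A form on `ℝⁿ` of degree less than `m` that is killed by all normal coordinate forms
vanishes. -/
theorem eq_zero_of_wedge_normalCoord (h : m + k = n) {p : ℕ} (hp : p < m) {w : Alt n p}
    (hw : ∀ a, wedge (oneForm (normalCoord h a)) w = 0) : w = 0 := by
  refine ContinuousAlternatingMap.toAlternatingMap_injective ?_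
  refine Module.Basis.ext_alternating (EuclideanSpace.basisFun (Fin n) ℝ).toBasis fun I _ => ?_
  obtain ⟨a, ha⟩ : ∃ a : Fin m, ∀ j, I j ≠ Fin.cast h (Fin.castAdd k a) := by
    by_contra! hcon
    choose g hg using hcon
    have hinj : Function.Injective g := fun a b hab => by
      have h1 := hg a
      rw [hab, hg b] at h1
      have h2 := congrArg Fin.val h1
      exact Fin.ext (by simpa using h2.symm)
    have := Fintype.card_le_of_injective g hinj
    simp at this
    omega
  refine apply_eq_zero_of_wedge_oneForm_eq_zero (hw a) (x := normalVec h a)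
    (by rw [normalCoord_normalVec, if_pos rfl]) fun j => ?_
  rw [OrthonormalBasis.coe_toBasis, EuclideanSpace.basisFun_apply]
  change (split h (EuclideanSpace.single (I j) 1)).1 a = 0
  rw [split_fst_apply]
  simp [(ha j).symm]

/-- The multiplication by a fixed form from the left. -/
def wedgeLeftCLM {d p q : ℕ} (a : Alt d p) : Alt d q →L[ℝ] Alt d (p + q) :=
  LinearMap.toContinuousLinearMap
    { toFun := wedge a
      map_add' := wedge_add a
      map_smul' := fun c b => wedge_real_smul c a b }

/-- The form `P` on `ℝⁿ` satisfies `d(‖x‖²) ∧ P = ‖x‖² Q` on `D`, where `x` is the component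
in `ℝᵐ`. -/
def IsTamePair (h : m + k = n) {p : ℕ} (D : Set (EuclideanSpace ℝ (Fin n)))
    (P : EuclideanSpace ℝ (Fin n) → Alt n p) (Q : EuclideanSpace ℝ (Fin n) → Alt n (1 + p)) :
    Prop :=
  ∀ z ∈ D, wedge (oneForm (fderiv ℝ (fun z => ‖normalProj h z‖ ^ 2) z)) (P z) =
    (‖normalProj h z‖ ^ 2 : ℝ) • Q z

theorem fderiv_norm_normalProj_sq (h : m + k = n) (z : EuclideanSpace ℝ (Fin n)) :
    fderiv ℝ (fun z => ‖normalProj h z‖ ^ 2) z =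
      (2 : ℝ) • (innerSL ℝ (normalProj h z)).comp (normalProj h) := by
  have := ((normalProj h).hasFDerivAt (x := z)).norm_sq
  rw [this.fderiv]
  exact (ofNat_smul_eq_nsmul ℝ 2 _).symm

theorem oneForm_smul {d : ℕ} (c : ℝ) (a : EuclideanSpace ℝ (Fin d) →L[ℝ] ℝ) :
    oneForm (c • a) = c • oneForm a := by
  ext v
  rw [oneForm_apply, ContinuousAlternatingMap.smul_apply, oneForm_apply]
  simp

variable {h : m + k = n} {p : ℕ} {D : Set (EuclideanSpace ℝ (Fin n))}
  {P : EuclideanSpace ℝ (Fin n) → Alt n p} {Q : EuclideanSpace ℝ (Fin n) → Alt n (1 + p)}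

/-- Restrict the tame condition to the line through a point of `0 × ℝᵏ` in the `a`-th normal
direction and divide by `2t`. -/
theorem IsTamePair.eventually_eq (hT : IsTamePair h D P Q) (hD : IsOpen D)
    (hP : ContinuousOn P D) (hQ : ContinuousOn Q D) {z : EuclideanSpace ℝ (Fin n)} (hz : z ∈ D)
    (hz0 : normalProj h z = 0) (a : Fin m) :
    ∀ᶠ t : ℝ in 𝓝 0, wedge (oneForm (normalCoord h a)) (P (z + t • normalVec h a)) =
      (t / 2) • Q (z + t • normalVec h a) := by
  set g : ℝ → EuclideanSpace ℝ (Fin n) := fun t => z + t • normalVec h a with hg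
  have hgc : Continuous g := by fun_prop
  have hg0 : g 0 = z := by simp [hg]
  have hev : ∀ᶠ t in 𝓝 (0 : ℝ), g t ∈ D :=
    hgc.continuousAt.eventually (hD.mem_nhds (by rwa [hg0]))
  have hproj : ∀ t, normalProj h (g t) = t • EuclideanSpace.single a (1 : ℝ) := by
    intro t
    rw [hg, map_add, hz0, zero_add, map_smul, normalProj_apply, split_normalVec]
  have hne : ∀ t, g t ∈ D → t ≠ 0 → wedge (oneForm (normalCoord h a)) (P (g t)) =
      (t / 2) • Q (g t) := by
    intro t htD ht
    have h1 := hT (g t) htD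
    have h2 : fderiv ℝ (fun z => ‖normalProj h z‖ ^ 2) (g t) =
        (2 * t : ℝ) • normalCoord h a := by
      rw [fderiv_norm_normalProj_sq, hproj, mul_smul]
      congr 1
      refine ContinuousLinearMap.ext fun v => ?_
      simp [normalCoord, EuclideanSpace.inner_single_left]
    rw [h2, oneForm_smul, real_smul_wedge, hproj, norm_smul, PiLp.norm_single,
      norm_one, mul_one, Real.norm_eq_abs, sq_abs] at h1
    have h3 := congrArg (fun w => (2 * t : ℝ)⁻¹ • w) h1
    simp only [smul_smul] at h3
    rw [inv_mul_cancel₀ (by simpa using ht), one_smul] at h3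
    rw [h3]
    congr 1
    field_simp
  have h0 : wedge (oneForm (normalCoord h a)) (P (g 0)) = ((0 : ℝ) / 2) • Q (g 0) := by
    have hPc : ContinuousAt (fun t => P (g t)) 0 :=
      ContinuousAt.comp (f := g) (hP.continuousAt (hD.mem_nhds (by rwa [hg0]))) hgc.continuousAt
    have hQc : ContinuousAt (fun t => Q (g t)) 0 :=
      ContinuousAt.comp (f := g) (hQ.continuousAt (hD.mem_nhds (by rwa [hg0]))) hgc.continuousAt
    have hl : Tendsto (fun t => wedgeLeftCLM (oneForm (normalCoord h a)) (P (g t))) (𝓝[≠] 0)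
        (𝓝 (wedgeLeftCLM (oneForm (normalCoord h a)) (P (g 0)))) :=
      ((wedgeLeftCLM (q := p) (oneForm (normalCoord h a))).continuous.continuousAt.comp
        hPc).tendsto.mono_left nhdsWithin_le_nhds
    have hr : Tendsto (fun t => (t / 2) • Q (g t)) (𝓝[≠] 0) (𝓝 (((0 : ℝ) / 2) • Q (g 0))) :=
      (Tendsto.smul ((continuous_id.div_const 2).tendsto (0 : ℝ)) hQc.tendsto).mono_left
        nhdsWithin_le_nhds
    refine tendsto_nhds_unique_of_eventuallyEq hl hr ?_
    filter_upwards [self_mem_nhdsWithin, nhdsWithin_le_nhds hev] with t ht htD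
    exact hne t htD ht
  filter_upwards [hev] with t ht
  by_cases ht0 : t = 0
  · rw [ht0]; exact h0
  · exact hne t ht ht0

/-- On `0 × ℝᵏ`, a tame form is killed by the normal coordinate forms. -/
theorem IsTamePair.wedge_normalCoord (hT : IsTamePair h D P Q) (hD : IsOpen D)
    (hP : ContinuousOn P D) (hQ : ContinuousOn Q D) {z : EuclideanSpace ℝ (Fin n)} (hz : z ∈ D)
    (hz0 : normalProj h z = 0) (a : Fin m) : wedge (oneForm (normalCoord h a)) (P z) = 0 := by
  have := (hT.eventually_eq hD hP hQ hz hz0 a).self_of_nhds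
  simpa using this

/-- The derivative of the relation `wedge (oneForm (normalCoord h a)) P = (t / 2) Q` along a line in
the `a`-th normal direction. -/
theorem IsTamePair.wedge_normalCoord_fderiv (hT : IsTamePair h D P Q) (hD : IsOpen D)
    (hP : DifferentiableOn ℝ P D) (hQ : DifferentiableOn ℝ Q D) {z : EuclideanSpace ℝ (Fin n)}
    (hz : z ∈ D) (hz0 : normalProj h z = 0) (a : Fin m) :
    wedge (oneForm (normalCoord h a)) (fderiv ℝ P z (normalVec h a)) = (1 / 2 : ℝ) • Q z := by
  set g : ℝ → EuclideanSpace ℝ (Fin n) := fun t => z + t • normalVec h a with hg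
  have hg0 : g 0 = z := by simp [hg]
  have hgd : HasDerivAt g (normalVec h a) 0 := by
    have := ((hasDerivAt_id (0 : ℝ)).smul_const (normalVec h a)).const_add z
    simpa [hg] using this
  have hPd : HasFDerivAt P (fderiv ℝ P z) (g 0) := by
    rw [hg0]; exact ((hP z hz).differentiableAt (hD.mem_nhds hz)).hasFDerivAt
  have hQd : HasFDerivAt Q (fderiv ℝ Q z) (g 0) := by
    rw [hg0]; exact ((hQ z hz).differentiableAt (hD.mem_nhds hz)).hasFDerivAt
  have hl : HasDerivAt (fun t => wedgeLeftCLM (oneForm (normalCoord h a)) (P (g t)))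
      (wedgeLeftCLM (oneForm (normalCoord h a)) (fderiv ℝ P z (normalVec h a))) 0 :=
    (wedgeLeftCLM (q := p) (oneForm (normalCoord h a))).hasFDerivAt.comp_hasDerivAt 0
      (hPd.comp_hasDerivAt 0 hgd)
  have hr : HasDerivAt (fun t => (t / 2) • Q (g t)) ((1 / 2 : ℝ) • Q z) 0 := by
    have h1 : HasDerivAt (fun t : ℝ => t / 2) (1 / 2) 0 := (hasDerivAt_id (0 : ℝ)).div_const 2
    have h2 : HasDerivAt (fun t => (t / 2) • Q (g t))
        (((0 : ℝ) / 2) • fderiv ℝ Q z (normalVec h a) + (1 / 2 : ℝ) • Q (g 0)) 0 :=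
      h1.smul (hQd.comp_hasDerivAt 0 hgd)
    rwa [zero_div, zero_smul, zero_add, hg0] at h2
  exact (hl.congr_of_eventuallyEq
    ((hT.eventually_eq hD hP.continuousOn hQ.continuousOn hz hz0 a).mono fun t ht =>
      ht.symm)).unique hr

/-- The exterior derivative of a tame form with all `m` normal vectors plugged in. The
derivatives in the normal directions add up to `m / 2` times the form `Q`. -/
theorem IsTamePair.extDeriv_apply (hT : IsTamePair h D P Q) (hD : IsOpen D)
    (hP : DifferentiableOn ℝ P D) (hQ : DifferentiableOn ℝ Q D) {z : EuclideanSpace ℝ (Fin n)}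
    (hz : z ∈ D) (hz0 : normalProj h z = 0) {r q : ℕ} (hr : m = 2 * r) (hq : m + q = p + 1)
    (u : Fin q → EuclideanSpace ℝ (Fin k)) :
    extDeriv P z (fun j => Fin.append (normalVec h) (fun i => tangentIncl h (u i))
        (Fin.cast hq.symm j)) =
      r * Q z (fun j => Fin.append (normalVec h) (fun i => tangentIncl h (u i))
        (Fin.cast ((add_comm 1 p).trans hq.symm) j)) +
      ∑ i : Fin q, (-1 : ℂ) ^ (i : ℕ) * fderiv ℝ P z (tangentIncl h (u i))
        (fun j => Fin.append (normalVec h) (fun i => tangentIncl h (u i))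
          (Fin.cast hq.symm ((Fin.cast hq (Fin.natAdd m i)).succAbove j))) := by
  set V : Fin (m + q) → EuclideanSpace ℝ (Fin n) :=
    Fin.append (normalVec h) (fun i => tangentIncl h (u i)) with hV
  have hVl : ∀ a, V (Fin.castAdd q a) = normalVec h a := fun a => Fin.append_left _ _ _
  have hVr : ∀ i, V (Fin.natAdd m i) = tangentIncl h (u i) := fun i => Fin.append_right _ _ _
  set V' : Fin (p + 1) → EuclideanSpace ℝ (Fin n) := fun j => V (Fin.cast hq.symm j) with hV'
  -- Plug all vectors into `wedge_normalCoord_fderiv`: only the `a`-th normal vector survives in the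
  -- linear form.
  have key : ∀ a : Fin m, (-1 : ℂ) ^ (a : ℕ) * fderiv ℝ P z (normalVec h a)
      ((Fin.cast hq (Fin.castAdd q a)).removeNth V') =
        (1 / 2 : ℂ) * Q z (V' ∘ Fin.cast (add_comm 1 p)) := by
    intro a
    have h1 := wedge_oneForm_apply (normalCoord h a) (fderiv ℝ P z (normalVec h a)) V'
    rw [hT.wedge_normalCoord_fderiv hD hP hQ hz hz0 a, Finset.sum_eq_single
      (Fin.cast hq (Fin.castAdd q a))] at h1
    · have h2 : V' (Fin.cast hq (Fin.castAdd q a)) = normalVec h a := hVl a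
      rw [h2, normalCoord_normalVec, if_pos rfl, ContinuousAlternatingMap.smul_apply] at h1
      simp only [Complex.ofReal_one, one_mul, Complex.real_smul] at h1
      rw [show ((1 / 2 : ℝ) : ℂ) = 1 / 2 by push_cast; rfl] at h1
      exact h1.symm
    · intro j _ hj
      have h3 : normalCoord h a (V' j) = 0 := by
        obtain ⟨j', rfl⟩ : ∃ j', j = Fin.cast hq j' := ⟨Fin.cast hq.symm j, rfl⟩
        change normalCoord h a (V j') = 0
        revert hj
        refine Fin.addCases (fun b hj => ?_) (fun i _ => ?_) j'
        · rw [hVl, normalCoord_normalVec, if_neg]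
          rintro rfl
          exact hj rfl
        · rw [hVr, normalCoord_tangentIncl]
      rw [h3]
      simp
    · intro hcon
      exact absurd (Finset.mem_univ _) hcon
  have hd : extDeriv P z V' = ∑ j : Fin (p + 1), (-1 : ℂ) ^ (j : ℕ) *
      fderiv ℝ P z (V' j) (j.removeNth V') := by
    rw [extDeriv, ContinuousAlternatingMap.alternatizeUncurryFin_apply]
    refine Finset.sum_congr rfl fun j _ => ?_
    rw [zsmul_eq_mul]
    push_cast
    rfl
  have hsplit : ∑ j : Fin (p + 1), (-1 : ℂ) ^ (j : ℕ) *
      fderiv ℝ P z (V' j) (j.removeNth V') = ∑ j : Fin (m + q), (-1 : ℂ) ^ (j : ℕ) *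
      fderiv ℝ P z (V j) ((Fin.cast hq j).removeNth V') :=
    (Fintype.sum_equiv (finCongr hq) _ _ fun j => rfl).symm
  rw [hd, hsplit, Fin.sum_univ_add]
  congr 1
  · have h4 : ∀ a : Fin m, (-1 : ℂ) ^ ((Fin.castAdd q a : Fin (m + q)) : ℕ) *
        fderiv ℝ P z (V (Fin.castAdd q a)) ((Fin.cast hq (Fin.castAdd q a)).removeNth V') =
        (1 / 2 : ℂ) * Q z (V' ∘ Fin.cast (add_comm 1 p)) := by
      intro a
      rw [hVl]
      exact key a
    rw [Finset.sum_congr rfl fun a _ => h4 a, Finset.sum_const, Finset.card_univ,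
      Fintype.card_fin, nsmul_eq_mul, ← mul_assoc]
    have h5 : (m : ℂ) * (1 / 2) = r := by
      rw [show (m : ℂ) = 2 * r by exact_mod_cast hr]
      ring
    rw [h5]
    rfl
  · refine Finset.sum_congr rfl fun i _ => ?_
    have h6 : (-1 : ℂ) ^ m = 1 := by rw [hr, pow_mul]; simp
    rw [hVr, Fin.val_natAdd, pow_add, h6, one_mul]
    rfl

/-- A form of degree `p`, regarded as a form of degree `p'`, if `p = p'`. -/
def castDegree {d p p' : ℕ} (h : p = p') (a : Alt d p) : Alt d p' where
  toContinuousMultilinearMap := a.toContinuousMultilinearMap.domDomCongr (finCongr h)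
  map_eq_zero_of_eq' v i j hv hij :=
    a.map_eq_zero_of_eq (fun i => v (Fin.cast h i)) (i := Fin.cast h.symm i)
      (j := Fin.cast h.symm j) hv fun h => hij (by simpa [Fin.ext_iff] using h)

theorem castDegree_apply {d p p' : ℕ} (h : p = p') (a : Alt d p)
    (v : Fin p' → EuclideanSpace ℝ (Fin d)) : castDegree h a v = a (v ∘ Fin.cast h) := rfl

/-- The restriction to `0 × ℝᵏ` of the form `P`, with the normal basis vectors plugged in. -/
def normalContract (h : m + k = n) {p q : ℕ} (hq : m + q = p)
    (P : EuclideanSpace ℝ (Fin n) → Alt n p) (b : EuclideanSpace ℝ (Fin k)) : Alt k q :=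
  (contract hq (normalVec h) (P (tangentIncl h b))).compContinuousLinearMap (tangentIncl h)

theorem normalContract_apply (h : m + k = n) {p q : ℕ} (hq : m + q = p)
    (P : EuclideanSpace ℝ (Fin n) → Alt n p) (b : EuclideanSpace ℝ (Fin k))
    (u : Fin q → EuclideanSpace ℝ (Fin k)) :
    normalContract h hq P b u = P (tangentIncl h b) fun j =>
      Fin.append (normalVec h) (fun i => tangentIncl h (u i)) (Fin.cast hq.symm j) := rfl

/-- `normalContract` as a linear map between spaces of alternating forms. -/
def normalContractCLM (h : m + k = n) {p q : ℕ} (hq : m + q = p) : Alt n p →L[ℝ] Alt k q :=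
  (ContinuousAlternatingMap.compContinuousLinearMapCLM (tangentIncl h)).comp
    (contractCLM hq (normalVec h))

theorem normalContract_eq (h : m + k = n) {p q : ℕ} (hq : m + q = p)
    (P : EuclideanSpace ℝ (Fin n) → Alt n p) :
    normalContract h hq P = fun b => normalContractCLM h hq (P (tangentIncl h b)) := rfl

theorem contDiffAt_normalContract (h : m + k = n) {p q : ℕ} (hq : m + q = p)
    {P : EuclideanSpace ℝ (Fin n) → Alt n p} {b : EuclideanSpace ℝ (Fin k)}
    (hP : ContDiffAt ℝ ∞ P (tangentIncl h b)) : ContDiffAt ℝ ∞ (normalContract h hq P) b := by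
  rw [normalContract_eq]
  exact (normalContractCLM h hq).contDiff.contDiffAt.comp b
    (hP.comp b (tangentIncl h).contDiff.contDiffAt)

theorem normalProj_tangentIncl (h : m + k = n) (b : EuclideanSpace ℝ (Fin k)) :
    normalProj h (tangentIncl h b) = 0 := by
  rw [normalProj_apply, split_tangentIncl]

/-- The exterior derivative of the contracted form is the contraction of `dP - (m / 2) Q`. -/
theorem IsTamePair.extDeriv_normalContract (hT : IsTamePair h D P Q) (hD : IsOpen D)
    (hP : DifferentiableOn ℝ P D) (hQ : DifferentiableOn ℝ Q D) {b : EuclideanSpace ℝ (Fin k)}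
    (hb : tangentIncl h b ∈ D) {r q : ℕ} (hr : m = 2 * r) (hq : m + q = p)
    (hq' : m + (q + 1) = p + 1) :
    extDeriv (normalContract h hq P) b =
      normalContract h hq'
        (fun z => extDeriv P z - (r : ℂ) • castDegree (add_comm 1 p) (Q z)) b := by
  ext u
  have h1 := hT.extDeriv_apply hD hP hQ hb (normalProj_tangentIncl h b) hr hq' u
  rw [normalContract_apply, ContinuousAlternatingMap.sub_apply, h1,
    ContinuousAlternatingMap.smul_apply, castDegree_apply, smul_eq_mul]
  have hPb : DifferentiableAt ℝ P (tangentIncl h b) :=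
    (hP _ hb).differentiableAt (hD.mem_nhds hb)
  have h2 : fderiv ℝ (normalContract h hq P) b = (normalContractCLM h hq).comp
      ((fderiv ℝ P (tangentIncl h b)).comp (tangentIncl h)) := by
    rw [normalContract_eq]
    have h3 := (normalContractCLM h hq).hasFDerivAt.comp b
      (hPb.hasFDerivAt.comp b (tangentIncl h).hasFDerivAt)
    exact h3.fderiv
  rw [extDeriv, ContinuousAlternatingMap.alternatizeUncurryFin_apply, h2]
  refine Eq.trans ?_ (add_sub_cancel_left _ _).symm
  refine Finset.sum_congr rfl fun i _ => ?_
  rw [zsmul_eq_mul]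
  push_cast
  congr 1
  change fderiv ℝ P (tangentIncl h b) (tangentIncl h (u i)) (fun j => Fin.append (normalVec h)
    (fun i' => tangentIncl h (i.removeNth u i')) (Fin.cast hq.symm j)) = _
  congr 1
  funext j
  obtain ⟨j, rfl⟩ : ∃ j', j = Fin.cast hq j' := ⟨Fin.cast hq.symm j, rfl⟩
  refine Fin.addCases (fun a => ?_) (fun i' => ?_) j
  · have h4 : Fin.cast hq'.symm ((Fin.cast hq' (Fin.natAdd m i)).succAbove
        (Fin.cast hq (Fin.castAdd q a))) = Fin.castAdd (q + 1) a := by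
      rw [Fin.succAbove_of_castSucc_lt _ _ (by
        rw [Fin.lt_def]
        simp only [Fin.val_castSucc, Fin.val_cast, Fin.val_castAdd, Fin.val_natAdd]
        omega)]
      rfl
    rw [h4, Fin.append_left]
    exact Fin.append_left _ _ _
  · have h4 : Fin.cast hq'.symm ((Fin.cast hq' (Fin.natAdd m i)).succAbove
        (Fin.cast hq (Fin.natAdd m i'))) = Fin.natAdd m (i.succAbove i') := by
      refine Fin.ext ?_
      simp only [Fin.succAbove, Fin.lt_def, Fin.val_castSucc, Fin.val_cast, Fin.val_natAdd]
      split_ifs with h5 h6 h6 <;> simp at * <;> omega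
    rw [h4, Fin.append_right]
    exact Fin.append_right _ _ _

/-- The contraction of `dP - (m / 2) Q` vanishes in the lowest degree. -/
theorem IsTamePair.normalContract_eq_zero (hT : IsTamePair h D P Q) (hD : IsOpen D)
    (hP : DifferentiableOn ℝ P D) (hQ : DifferentiableOn ℝ Q D) {b : EuclideanSpace ℝ (Fin k)}
    (hb : tangentIncl h b ∈ D) {r : ℕ} (hr : m = 2 * r) (hq : m + 0 = p + 1) :
    normalContract h hq
      (fun z => extDeriv P z - (r : ℂ) • castDegree (add_comm 1 p) (Q z)) b = 0 := by
  ext u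
  have h1 := hT.extDeriv_apply hD hP hQ hb (normalProj_tangentIncl h b) hr hq u
  rw [normalContract_apply, ContinuousAlternatingMap.sub_apply, h1,
    ContinuousAlternatingMap.smul_apply, castDegree_apply, smul_eq_mul, Finset.univ_eq_empty,
    Finset.sum_empty, add_zero]
  exact sub_self _

/-- The wedge product with a tame form on `0 × ℝᵏ` only depends on the contracted form. -/
theorem IsTamePair.wedge_apply_single (hT : IsTamePair h D P Q) (hD : IsOpen D)
    (hP : DifferentiableOn ℝ P D) (hQ : DifferentiableOn ℝ Q D) {b : EuclideanSpace ℝ (Fin k)}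
    (hb : tangentIncl h b ∈ D) {q l : ℕ} (hq : m + q = p) (hl : p + l = n) (hl' : q + l = k)
    (φ : Alt n l) :
    wedge (P (tangentIncl h b)) φ (fun j => EuclideanSpace.single (Fin.cast hl j) (1 : ℝ)) =
      wedge (normalContract h hq P b) (φ.compContinuousLinearMap (tangentIncl h))
        (fun j => EuclideanSpace.single (Fin.cast hl' j) (1 : ℝ)) := by
  rw [normalContract, wedge_compContinuousLinearMap,
    ContinuousAlternatingMap.compContinuousLinearMap_apply]
  refine Eq.trans ?_ (wedge_append_eq_wedge_contract hq (normalVec h)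
      (tangentIncl h ∘ fun j => EuclideanSpace.single (Fin.cast hl' j) (1 : ℝ))
      (P (tangentIncl h b)) φ (normalCoord h)
      (hT.wedge_normalCoord hD hP.continuousOn hQ.continuousOn hb (normalProj_tangentIncl h b))
      (fun a => by rw [normalCoord_normalVec, if_pos rfl])
      (fun a a' ha => by rw [normalCoord_normalVec, if_neg ha.symm])
      (fun a i => normalCoord_tangentIncl h a _) (by omega))
  congr 1
  funext j
  subst hl'
  have h1 := append_normalVec_tangentIncl h (Fin.cast (by omega) j)
  exact h1.symm

end Normal

/-! ### The residue in a Morse chart -/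

section Pairing

variable {n k m : ℕ} {X Y : Type*} [TopologicalSpace X]
  [ChartedSpace (EuclideanSpace ℝ (Fin n)) X] [IsManifold (𝓡 n) ∞ X] [TopologicalSpace Y]
  [ChartedSpace (EuclideanSpace ℝ (Fin k)) Y] [IsManifold (𝓡 k) ∞ Y]
  [T2Space X] [SigmaCompactSpace X] [T2Space Y] [SigmaCompactSpace Y]

/-- The integral over `Y` of `β ∧ i^* φ`, for a form `β` of degree `p` in the complex shifted
by `-m`, given as a family indexed by the at most one `q` with `q + m = p`. -/
def residuePairing {p l : ℕ} (i : Y → X) (β : (q : {q : ℕ // q + m = p}) → Y → Alt k q)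
    (φ : X → Alt n l) (h : p + l = k + m) : ℂ :=
  if hp : m ≤ p then
    densityIntegral (fun y => wedge (β ⟨p - m, Nat.sub_add_cancel hp⟩ y) (pullback i φ y))
      (show p - m + l = k by omega)
  else 0

/-- `β` is the residue of `w` on `O`: the residue formula holds for all test forms with compact
support in `O`. -/
def HasResidueOn (o : ManifoldOrientation n X) (μ : X → ℝ) (i : Y → X) (hn : n = k + m)
    {p : ℕ} (O : Set X) (w : X → Alt n p) (β : (q : {q : ℕ // q + m = p}) → Y → Alt k q) : Prop :=
  ∀ (l : ℕ) (h : p + l = n) (φ : X → Alt n l) (K : Set X),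
    (∀ x, SmoothFormAt (fun _ => 1) φ x) → IsCompact K → K ⊆ O → (∀ x, x ∉ K → φ x = 0) →
      HasI0 o μ (fun x => wedge (w x) (φ x)) h (residuePairing i β φ (h.trans hn))

variable {o : ManifoldOrientation n X} {μ : X → ℝ} {i : Y → X}

theorem chartDensity_zetaDensity {q : ℕ} (τ : X → Alt n q) (h : q = n)
    (e : OpenPartialHomeomorph X (EuclideanSpace ℝ (Fin n))) (s : ℂ)
    (z : EuclideanSpace ℝ (Fin n)) :
    chartDensity e (zetaDensity o μ τ s) h z = (μ (e.symm z) : ℂ) ^ (s / 2) *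
      ((chartSign o e z : ℂ) * chartRep (fun _ => 1) e τ z
        (fun j => EuclideanSpace.single (Fin.cast h j) (1 : ℝ))) := by
  unfold zetaDensity
  rw [chartDensity_smul, chartDensity, chartRep, chartRep, one_smul, chartSign,
    ContinuousAlternatingMap.smul_apply, Complex.real_smul]
  push_cast
  ring

/-- The residue at `s = 0` may be computed in a chart that contains the support of the form. -/
theorem hasI0_of_chart {q : ℕ} {τ : X → Alt n q} (h : q = n)
    {e : OpenPartialHomeomorph X (EuclideanSpace ℝ (Fin n))} (he : e ∈ smoothCharts n X)
    {K : Set X} (hK : IsCompact K) (hKe : K ⊆ e.source) (hτ : ∀ x, x ∉ K → τ x = 0)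
    {ζ : ℂ → ℂ} {c : ℂ} (a : ℝ) (hζ : Meromorphic ζ)
    (hi : ∀ s : ℂ, a < s.re → IntegrableOn (chartDensity e (zetaDensity o μ τ s) h) e.target ∧
      ζ s = ∫ z in e.target, chartDensity e (zetaDensity o μ τ s) h z)
    (hl : Tendsto (fun s => s * ζ s) (𝓝[≠] 0) (𝓝 c)) : HasI0 o μ τ h c := by
  refine ⟨ζ, a, hζ, fun s hs => ?_, hl⟩
  obtain ⟨h1, h2⟩ := hi s hs
  obtain ⟨h3, h4⟩ := densityIntegral_eq_of_chart h he hK hKe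
    (τ := zetaDensity o μ τ s) (fun x hx => by rw [zetaDensity, hτ x hx, smul_zero]) h1
  exact ⟨h3, h2.trans h4.symm⟩

section Morse

variable {h : m + k = n} {e : OpenPartialHomeomorph X (EuclideanSpace ℝ (Fin n))}
  {f : OpenPartialHomeomorph Y (EuclideanSpace ℝ (Fin k))}

theorem IsMorseChart.tangentIncl_eq (hM : IsMorseChart h i μ e f) {y : Y} (hy : y ∈ f.source) :
    tangentIncl h (f y) = e (i y) := by
  refine (split h).injective ?_
  rw [split_tangentIncl, hM.split_apply y hy]

theorem IsMorseChart.tangentIncl_mem (hM : IsMorseChart h i μ e f)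
    (b : EuclideanSpace ℝ (Fin k)) (hb : b ∈ f.target) :
    tangentIncl h b ∈ e.target ∧ e.symm (tangentIncl h b) = i (f.symm b) := by
  have hy := f.map_target hb
  have h1 := hM.tangentIncl_eq hy
  rw [f.right_inv hb] at h1
  have h2 := (hM.mem_iff _).2 hy
  rw [h1]
  exact ⟨e.map_source h2, e.left_inv h2⟩

theorem IsMorseChart.eventuallyEq_norm_sq (hM : IsMorseChart h i μ e f)
    {z : EuclideanSpace ℝ (Fin n)} (hz : z ∈ e.target) :
    μ ∘ e.symm =ᶠ[𝓝 z] fun z => ‖normalProj h z‖ ^ 2 := by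
  filter_upwards [e.open_target.mem_nhds hz] with z' hz'
  rw [Function.comp_apply, hM.eq_norm_sq _ (e.map_target hz'), e.right_inv hz', normalProj_apply]

/-- In a Morse chart, the points of `0 × ℝᵏ` in the target come from `Y`. -/
theorem IsMorseChart.mem_target_of_tangentIncl_mem (hM : IsMorseChart h i μ e f)
    (hμ : ∀ x, μ x = 0 ↔ x ∈ range i) {b : EuclideanSpace ℝ (Fin k)}
    (hb : tangentIncl h b ∈ e.target) : b ∈ f.target := by
  have h1 : μ (e.symm (tangentIncl h b)) = ‖normalProj h (tangentIncl h b)‖ ^ 2 :=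
    (hM.eventuallyEq_norm_sq hb).self_of_nhds
  rw [normalProj_tangentIncl, norm_zero, zero_pow two_ne_zero] at h1
  obtain ⟨y, hy⟩ := (hμ _).1 h1
  have h2 : y ∈ f.source := (hM.mem_iff y).1 (by rw [hy]; exact e.map_target hb)
  have h3 := hM.tangentIncl_eq h2
  rw [hy, e.right_inv hb] at h3
  have h4 := congrArg (split h) h3
  rw [split_tangentIncl, split_tangentIncl] at h4
  have h5 : f y = b := (Prod.ext_iff.1 h4).2
  rw [← h5]
  exact f.map_source h2

/-- The residue of `μ ^ (-r) ψ` in a Morse chart: the restriction to `Y` of `ψ` with the normal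
basis vectors plugged in, multiplied by the volume of the unit sphere of the normal space. The
sign of the orientation in the chart makes it a form with values in the orientation bundle. -/
def morseResidue (o : ManifoldOrientation n X) (h : m + k = n)
    (e : OpenPartialHomeomorph X (EuclideanSpace ℝ (Fin n)))
    (f : OpenPartialHomeomorph Y (EuclideanSpace ℝ (Fin k))) {p : ℕ} (ψ : X → Alt n p)
    (q : {q : ℕ // q + m = p}) : Y → Alt k q :=
  formOfChart Real.sign f fun b =>
    (((volume : Measure (EuclideanSpace ℝ (Fin m))).toSphere.real univ : ℂ) *
      (chartSign o e (tangentIncl h b) : ℂ)) •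
        normalContract h ((add_comm _ _).trans q.2) (chartRep (fun _ => 1) e ψ) b

variable {p : ℕ} {O : Set X} {ψ : X → Alt n p} {χ : X → Alt n (1 + p)}

theorem chartRep_morseResidue (hM : IsMorseChart h i μ e f) (q : {q : ℕ // q + m = p})
    {b : EuclideanSpace ℝ (Fin k)} (hb : b ∈ f.target) :
    chartRep Real.sign f (morseResidue o h e f ψ q) b =
      (((volume : Measure (EuclideanSpace ℝ (Fin m))).toSphere.real univ : ℂ) *
        (chartSign o e (tangentIncl h b) : ℂ)) •
        normalContract h ((add_comm _ _).trans q.2) (chartRep (fun _ => 1) e ψ) b :=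
  chartRep_formOfChart isSignChar_sign hM.mem_right _ hb

theorem IsMorseChart.eventually_chartRep_morseResidue (hM : IsMorseChart h i μ e f)
    (q : {q : ℕ // q + m = p}) {b : EuclideanSpace ℝ (Fin k)} (hb : b ∈ f.target) :
    chartRep Real.sign f (morseResidue o h e f ψ q) =ᶠ[𝓝 b]
      (((volume : Measure (EuclideanSpace ℝ (Fin m))).toSphere.real univ : ℂ) *
        (chartSign o e (tangentIncl h b) : ℂ)) •
        normalContract h ((add_comm _ _).trans q.2) (chartRep (fun _ => 1) e ψ) := by
  have h1 := (tangentIncl h).continuous.continuousAt.eventually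
    (eventually_chartSign_eq o hM.mem_left (hM.tangentIncl_mem b hb).1)
  filter_upwards [f.open_target.mem_nhds hb, h1] with b' hb' h2
  rw [chartRep_morseResidue hM q hb', h2]
  rfl

theorem smoothFormAt_morseResidue (hM : IsMorseChart h i μ e f) (q : {q : ℕ // q + m = p})
    {y : Y} (hy : y ∈ f.source) (hψ : SmoothFormAt (fun _ => 1) ψ (i y)) :
    SmoothFormAt Real.sign (morseResidue o h e f ψ q) y := by
  refine ⟨f, hM.mem_right, hy, ContDiffAt.congr_of_eventuallyEq ?_
    (hM.eventually_chartRep_morseResidue q (f.map_source hy))⟩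
  refine contDiffAt_const.smul (contDiffAt_normalContract h _ ?_)
  rw [hM.tangentIncl_eq hy]
  exact hψ.contDiffAt isSignChar_one hM.mem_left ((hM.mem_iff y).2 hy)

theorem IsMorseChart.isTamePair (hM : IsMorseChart h i μ e f) (hμ : ContMDiff (𝓡 n) 𝓘(ℝ, ℝ) ∞ μ)
    (hχ : ∀ x ∈ O, wedge (differential μ x) (ψ x) = (μ x : ℂ) • χ x) :
    IsTamePair h (e.target ∩ e.symm ⁻¹' O) (chartRep (fun _ => 1) e ψ)
      (chartRep (fun _ => 1) e χ) := by
  rintro z ⟨hz, hzO⟩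
  have h1 := hM.eventuallyEq_norm_sq hz
  have h3 : μ (e.symm z) = ‖normalProj h z‖ ^ 2 := h1.self_of_nhds
  rw [← h1.fderiv_eq, ← chartRep_differential hμ hM.mem_left hz,
    ← chartRep_wedge (κ := fun _ => 1) (e := e) (differential μ) ψ z, ← h3]
  have h2 : chartRep (fun _ => 1) e (fun x => wedge (differential μ x) (ψ x)) z =
      chartRep (fun _ => 1) e (fun x => (μ x : ℂ) • χ x) z := by
    rw [chartRep, chartRep, hχ _ hzO]
  rw [h2, chartRep_smul, Complex.coe_smul]

theorem contDiffOn_chartRep {q : ℕ} {w : X → Alt n q} (he : e ∈ smoothCharts n X)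
    (hw : ∀ x ∈ O, SmoothFormAt (fun _ => 1) w x) :
    ContDiffOn ℝ ∞ (chartRep (fun _ => 1) e w) (e.target ∩ e.symm ⁻¹' O) := fun _ hz =>
  ((hw _ hz.2).contDiffAt_symm isSignChar_one he hz.1).contDiffWithinAt

theorem norm_cpow_mul_norm_sq_pow {V : Type*} [NormedAddCommGroup V] {v : V} (hv : v ≠ 0) {r : ℕ}
    (hr : m = 2 * r) (s : ℂ) : (‖v‖ : ℂ) ^ (s - m) * ((‖v‖ ^ 2 : ℝ) : ℂ) ^ r =
      ((‖v‖ ^ 2 : ℝ) : ℂ) ^ (s / 2) := by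
  have h0 : (‖v‖ : ℂ) ≠ 0 := by simpa using hv
  have h1 : ((‖v‖ ^ 2 : ℝ) : ℂ) ^ (s / 2) = (‖v‖ : ℂ) ^ s := by
    have h2 := Complex.cpow_nat_mul (‖v‖ : ℂ) 2 (s / 2)
    rw [Complex.ofReal_pow, sq, Complex.mul_cpow_ofReal_nonneg (norm_nonneg _) (norm_nonneg _),
      ← Complex.cpow_add _ _ h0]
    congr 1
    ring
  rw [h1, Complex.ofReal_pow, ← pow_mul, ← hr, ← Complex.cpow_natCast, ← Complex.cpow_add _ _ h0]
  congr 1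
  ring

/-- The residue formula in a Morse chart. The density of `μ ^ (s / 2) w ∧ φ` in the chart is
`‖x‖ ^ (s - m) a (x, y)`, with a smooth function `a` whose restriction to `0 × ℝᵏ` is the density
of the residue paired with `φ`. -/
theorem IsMorseChart.hasResidueOn (hM : IsMorseChart h i μ e f)
    (hμ : ContMDiff (𝓡 n) 𝓘(ℝ, ℝ) ∞ μ) (hμ0 : ∀ x, μ x = 0 ↔ x ∈ range i)
    (hi : ContMDiff (𝓡 k) (𝓡 n) ∞ i) (hic : IsClosedEmbedding i)
    (hn : n = k + m) {r : ℕ} (hr : m = 2 * r) (hr0 : 0 < r) (hO : IsOpen O) (hOe : O ⊆ e.source)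
    {w : X → Alt n p} (hψ : ∀ x ∈ O, SmoothFormAt (fun _ => 1) ψ x)
    (hχ : ∀ x ∈ O, SmoothFormAt (fun _ => 1) χ x)
    (hw : ∀ x ∈ O, x ∉ range i → ψ x = (μ x : ℂ) ^ r • w x)
    (hdμ : ∀ x ∈ O, wedge (differential μ x) (ψ x) = (μ x : ℂ) • χ x) :
    HasResidueOn o μ i hn O w (morseResidue o h e f ψ) := by
  intro l hl φ K hφ hK hKO hφK
  set D := e.target ∩ e.symm ⁻¹' O with hD
  have hDo : IsOpen D := e.isOpen_inter_preimage_symm hO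
  set P := chartRep (fun _ => 1) e ψ with hP
  set Q := chartRep (fun _ => 1) e χ with hQ
  set F := chartRep (fun _ => 1) e φ with hF
  have hT : IsTamePair h D P Q := hM.isTamePair hμ hdμ
  have hPs : ContDiffOn ℝ ∞ P D := contDiffOn_chartRep hM.mem_left hψ
  have hQs : ContDiffOn ℝ ∞ Q D := contDiffOn_chartRep hM.mem_left hχ
  have hPd := hPs.differentiableOn (by simp)
  have hQd := hQs.differentiableOn (by simp)
  set std : Fin (p + l) → EuclideanSpace ℝ (Fin n) := fun j =>
    EuclideanSpace.single (Fin.cast hl j) (1 : ℝ) with hstd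
  have hKe : K ⊆ e.source := hKO.trans hOe
  have heK : IsCompact (e '' K) := hK.image_of_continuousOn (e.continuousOn.mono hKe)
  have heKt : e '' K ⊆ D := by
    rintro _ ⟨x, hx, rfl⟩
    refine ⟨e.map_source (hKe hx), ?_⟩
    rw [mem_preimage, e.left_inv (hKe hx)]
    exact hKO hx
  have hF0 : ∀ z ∈ e.target, z ∉ e '' K → F z = 0 := by
    intro z hz hzK
    have h1 : e.symm z ∉ K := fun hx => hzK ⟨_, hx, e.right_inv hz⟩
    rw [hF, chartRep, hφK _ h1, one_smul]
    rfl
  -- The smooth function `a`, first on `ℝⁿ`.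
  set G : EuclideanSpace ℝ (Fin n) → ℂ := e.target.indicator fun z =>
    (chartSign o e z : ℂ) * wedge (P z) (F z) std with hG
  have hG0 : ∀ z, z ∉ e '' K → G z = 0 := by
    intro z hz
    by_cases hzt : z ∈ e.target
    · rw [hG, indicator_of_mem hzt, hF0 z hzt hz, wedge_zero]
      exact mul_zero _
    · rw [hG, indicator_of_notMem hzt]
  have hGs : ContDiff ℝ ∞ G := by
    rw [contDiff_iff_contDiffAt]
    intro z
    by_cases hz : z ∈ e '' K
    · have hzD := heKt hz
      have h1 : ContDiffAt ℝ ∞ (fun z' => (chartSign o e z : ℂ) * wedge (P z') (F z') std) z := by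
        refine contDiffAt_const.mul ((altApplyCLM std).contDiff.contDiffAt.comp z
          (contDiffAt_wedge (hPs.contDiffAt (hDo.mem_nhds hzD)) ?_))
        exact (hφ _).contDiffAt_symm isSignChar_one hM.mem_left hzD.1
      refine h1.congr_of_eventuallyEq ?_
      filter_upwards [e.open_target.mem_nhds hzD.1,
        eventually_chartSign_eq o hM.mem_left hzD.1] with z' hz' hs
      rw [hG, indicator_of_mem hz', hs]
    · refine (contDiffAt_const (c := (0 : ℂ))).congr_of_eventuallyEq ?_
      filter_upwards [heK.isClosed.isOpen_compl.mem_nhds hz] with z' hz'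
      exact hG0 z' hz'
  set S := split h with hS
  set a : EuclideanSpace ℝ (Fin m) × EuclideanSpace ℝ (Fin k) → ℂ := fun z => G (S.symm z) with ha
  have has : ContDiff ℝ ∞ a := hGs.comp S.symm.contDiff
  have hac : HasCompactSupport a := by
    refine HasCompactSupport.intro (heK.image S.continuous) fun z hz => hG0 _ fun hz' => hz ?_
    exact ⟨_, hz', S.apply_symm_apply z⟩
  obtain ⟨ζ, hζ, hζi, hζl⟩ := exists_meromorphic_integral_norm_fst_cpow (by omega) has hac
  have hmp : MeasurePreserving S := measurePreserving_split h
  have hemb : MeasurableEmbedding S := S.toHomeomorph.measurableEmbedding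
  -- The limit is the pairing of the residue with `φ`.
  have hlim : ((volume : Measure (EuclideanSpace ℝ (Fin m))).toSphere.real univ : ℂ) *
      ∫ y, a (0, y) = residuePairing i (morseResidue o h e f ψ) φ (hl.trans hn) := by
    have ha0 : ∀ b, a (0, b) = G (tangentIncl h b) := fun b => rfl
    rw [residuePairing]
    split_ifs with hp
    · have hK' : IsCompact (i ⁻¹' K) := hic.isCompact_preimage hK
      have hK'f : i ⁻¹' K ⊆ f.source := fun y hy => (hM.mem_iff y).1 (hKe hy)
      have hq : p - m + m = p := Nat.sub_add_cancel hp
      have hkl : p - m + l = k := by omega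
      set τ : Y → Alt k (p - m + l) := fun y =>
        wedge (morseResidue o h e f ψ ⟨p - m, hq⟩ y) (pullback i φ y) with hτ
      have hτ0 : ∀ y, y ∉ i ⁻¹' K → τ y = 0 := by
        intro y hy
        have h1 : pullback (k := k) i φ y = 0 := by rw [pullback, hφK _ hy]; rfl
        rw [hτ]
        simp only
        rw [h1, wedge_zero]
      have hden : ∀ b ∈ f.target, chartDensity f τ hkl b =
          ((volume : Measure (EuclideanSpace ℝ (Fin m))).toSphere.real univ : ℂ) * a (0, b) := by
        intro b hb
        have hJ := hM.tangentIncl_mem b hb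
        rw [ha0, hG, indicator_of_mem hJ.1, chartDensity, hτ, chartRep_wedge,
          chartRep_morseResidue hM _ hb, smul_wedge, ContinuousAlternatingMap.smul_apply,
          chartRep_pullback hi φ hM.mem_left hM.mem_right hb hM.tangentIncl_mem, smul_eq_mul,
          mul_assoc]
        congr 2
        by_cases hbD : tangentIncl h b ∈ D
        · exact (hT.wedge_apply_single hDo hPd hQd hbD _ hl hkl _).symm
        · have h2 : F (tangentIncl h b) = 0 := hF0 _ hJ.1 fun h3 => hbD (heKt h3)
          rw [← hF, h2, wedge_zero]
          change wedge _ (0 : Alt k l) _ = 0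
          rw [wedge_zero]
          rfl
      have haf : ∀ b, b ∉ f.target → a (0, b) = 0 := by
        intro b hb
        rw [ha0, hG, indicator_of_notMem]
        exact fun hJ => hb (hM.mem_target_of_tangentIncl_mem hμ0 hJ)
      have hai : Integrable fun b => a (0, b) := by
        refine Continuous.integrable_of_hasCompactSupport
          (has.continuous.comp
            (by fun_prop : Continuous fun b => ((0 : EuclideanSpace ℝ (Fin m)), b))) ?_
        refine HasCompactSupport.intro (hac.isCompact.image continuous_snd) fun b hb => ?_
        by_contra hne
        exact hb ⟨_, subset_tsupport a hne, rfl⟩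
      have hint : IntegrableOn (chartDensity f τ hkl) f.target :=
        ((hai.const_mul _).integrableOn).congr_fun (fun b hb => (hden b hb).symm)
          f.open_target.measurableSet
      rw [(densityIntegral_eq_of_chart hkl hM.mem_right hK' hK'f hτ0 hint).2,
        setIntegral_congr_fun f.open_target.measurableSet hden, integral_const_mul,
        setIntegral_eq_integral_of_forall_compl_eq_zero haf]
    -- If `p < m`, the pairing is zero, and so is `a` on `0 × ℝᵏ`: a `p`-form that is divisible by
    -- `m` independent linear forms vanishes.
    · have h1 : ∀ b, a (0, b) = 0 := by
        intro b
        rw [ha0]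
        by_cases hbK : tangentIncl h b ∈ e '' K
        · have h2 : P (tangentIncl h b) = 0 := eq_zero_of_wedge_normalCoord h (not_le.1 hp)
            (hT.wedge_normalCoord hDo hPd.continuousOn hQd.continuousOn (heKt hbK)
              (normalProj_tangentIncl h b))
          rw [hG, indicator_of_mem (heKt hbK).1, h2, zero_wedge]
          exact mul_zero _
        · exact hG0 _ hbK
      simp only [h1, integral_zero, mul_zero]
  rw [← hlim]
  have hden : ∀ s : ℂ, (m : ℝ) < s.re → ∀ z ∈ e.target,
      chartDensity e (zetaDensity o μ (fun x => wedge (w x) (φ x)) s) hl z =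
        (‖(S z).1‖ : ℂ) ^ (s - m) * a (S z) := by
    intro s hs z hz
    have haS : a (S z) = G z := by rw [ha]; simp only [S.symm_apply_apply]
    rw [chartDensity_zetaDensity, haS, hG, indicator_of_mem hz]
    by_cases hzK : z ∈ e '' K
    · have hzD := heKt hzK
      have h1 : μ (e.symm z) = ‖(S z).1‖ ^ 2 := by
        rw [hM.eq_norm_sq _ (e.map_target hz), e.right_inv hz]
      have hs0 : s ≠ 0 := by
        rintro rfl
        rw [Complex.zero_re] at hs
        exact absurd hs (not_lt.2 (Nat.cast_nonneg m))
      -- On the submanifold, both sides are zero, since `m < re s`.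
      by_cases hz0 : (S z).1 = 0
      · have hsm : s - m ≠ 0 := by
          intro hcon
          rw [sub_eq_zero] at hcon
          rw [hcon, Complex.natCast_re] at hs
          exact lt_irrefl _ hs
        rw [h1, hz0, norm_zero, zero_pow two_ne_zero, Complex.ofReal_zero,
          Complex.zero_cpow (by simpa using hs0), Complex.zero_cpow hsm, zero_mul, zero_mul]
      · have h2 : e.symm z ∉ range i := by
          rw [← hμ0, h1]
          simpa using hz0
        have h3 : P z = (μ (e.symm z) : ℂ) ^ r • chartRep (fun _ => 1) e w z := by
          rw [hP, chartRep, hw _ hzD.2 h2, chartRep, one_smul, one_smul]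
          rfl
        rw [chartRep_wedge, h3, smul_wedge, ContinuousAlternatingMap.smul_apply, smul_eq_mul, h1,
          ← norm_cpow_mul_norm_sq_pow hz0 hr]
        ring
    · have h1 : chartRep (fun _ => 1) e (fun x => wedge (w x) (φ x)) z = 0 := by
        rw [chartRep_wedge, ← hF, hF0 z hz hzK, wedge_zero]
      rw [h1, hF0 z hz hzK, wedge_zero]
      simp
  refine hasI0_of_chart hl hM.mem_left hK hKe (fun x hx => by rw [hφK x hx, wedge_zero])
    (m : ℝ) hζ (fun s hs => ?_) hζl
  obtain ⟨h1, h2⟩ := hζi s hs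
  have h3 : Integrable fun z => (‖(S z).1‖ : ℂ) ^ (s - m) * a (S z) :=
    (hmp.integrable_comp_emb hemb).2 h1
  have h4 : ∀ z, z ∉ e.target → (‖(S z).1‖ : ℂ) ^ (s - m) * a (S z) = 0 := by
    intro z hz
    have haS : a (S z) = G z := by rw [ha]; simp only [S.symm_apply_apply]
    rw [haS, hG0 z fun h5 => hz (heKt h5).1, mul_zero]
  refine ⟨h3.integrableOn.congr_fun (fun z hz => (hden s hs z hz).symm)
    e.open_target.measurableSet, ?_⟩
  rw [setIntegral_congr_fun e.open_target.measurableSet (hden s hs),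
    setIntegral_eq_integral_of_forall_compl_eq_zero h4, h2]
  exact (hmp.integral_comp hemb (fun z => (‖z.1‖ : ℂ) ^ (s - m) * a z)).symm

end Morse

end Pairing

/-! ### The residue off the submanifold -/

/-- The integral of `exp (s L) g` over a compact set is an entire function of `s`. -/
theorem differentiable_integral_exp_mul {E : Type*} [TopologicalSpace E] [T2Space E]
    [MeasurableSpace E] [OpensMeasurableSpace E] [SecondCountableTopology E] (ν : Measure E)
    [IsFiniteMeasureOnCompacts ν] {K : Set E} (hK : IsCompact K) {L : E → ℝ} {g : E → ℂ}
    (hL : ContinuousOn L K) (hg : ContinuousOn g K) :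
    Differentiable ℂ fun s : ℂ => ∫ z in K, Complex.exp (s * L z) * g z ∂ν := by
  intro s₀
  obtain ⟨A, hA⟩ := hK.exists_bound_of_continuousOn hL
  obtain ⟨B, hB⟩ := hK.exists_bound_of_continuousOn hg
  have hLc : ContinuousOn (fun z => (L z : ℂ)) K := Complex.continuous_ofReal.comp_continuousOn hL
  have hF : ∀ s : ℂ, ContinuousOn (fun z => Complex.exp (s * L z) * g z) K := fun s =>
    (Complex.continuous_exp.comp_continuousOn (continuousOn_const.mul hLc)).mul hg
  have hF' : ∀ s : ℂ, ContinuousOn (fun z => (L z : ℂ) * (Complex.exp (s * L z) * g z)) K :=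
    fun s => hLc.mul (hF s)
  have hKm := hK.measurableSet
  have hmain := hasDerivAt_integral_of_dominated_loc_of_deriv_le (μ := ν.restrict K)
    (F := fun (s : ℂ) z => Complex.exp (s * L z) * g z)
    (F' := fun (s : ℂ) z => (L z : ℂ) * (Complex.exp (s * L z) * g z))
    (bound := fun _ => A * (Real.exp ((‖s₀‖ + 1) * A) * B)) (x₀ := s₀)
    (Metric.ball_mem_nhds s₀ one_pos)
    (Eventually.of_forall fun s => (hF s).aestronglyMeasurable hKm)
    ((hF s₀).integrableOn_compact hK) ((hF' s₀).aestronglyMeasurable hKm) ?_ ?_ ?_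
  · exact hmain.2.differentiableAt
  · refine (ae_restrict_iff' hKm).2 (Eventually.of_forall fun z hz s hs => ?_)
    have h1 : ‖(L z : ℂ)‖ ≤ A := by simpa using hA z hz
    have hA0 : 0 ≤ A := (norm_nonneg _).trans h1
    have h2 : ‖s‖ ≤ ‖s₀‖ + 1 := by
      have h3 := norm_sub_norm_le s s₀
      rw [Metric.mem_ball, dist_eq_norm] at hs
      linarith
    have h4 : ‖Complex.exp (s * L z)‖ ≤ Real.exp ((‖s₀‖ + 1) * A) := by
      refine (Complex.norm_exp_le_exp_norm _).trans (Real.exp_le_exp.2 ?_)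
      rw [norm_mul]
      gcongr
    rw [norm_mul, norm_mul]
    have := hB z hz
    gcongr
  · have : IsFiniteMeasure (ν.restrict K) := ⟨by simpa using hK.measure_lt_top⟩
    exact integrable_const _
  · refine Eventually.of_forall fun z s _ => ?_
    have h1 : HasDerivAt (fun s : ℂ => s * (L z : ℂ)) (L z : ℂ) s := by
      simpa using (hasDerivAt_id s).mul_const (L z : ℂ)
    have h2 := (h1.cexp).mul_const (g z)
    refine h2.congr_deriv ?_
    ring

section Off

variable {n k m : ℕ} {X Y : Type*} [TopologicalSpace X]
  [ChartedSpace (EuclideanSpace ℝ (Fin n)) X] [IsManifold (𝓡 n) ∞ X] [TopologicalSpace Y]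
  [ChartedSpace (EuclideanSpace ℝ (Fin k)) Y] [IsManifold (𝓡 k) ∞ Y]
  [T2Space X] [SigmaCompactSpace X] [T2Space Y] [SigmaCompactSpace Y]
  {o : ManifoldOrientation n X} {μ : X → ℝ} {i : Y → X}

theorem residuePairing_zero {p l : ℕ} (i : Y → X) (φ : X → Alt n l) (h : p + l = k + m) :
    residuePairing i (fun (_ : {q : ℕ // q + m = p}) (_ : Y) => (0 : Alt k _)) φ h = 0 := by
  rw [residuePairing]
  split_ifs with hp
  · simp only [zero_wedge]
    exact (densityIntegral_zero _).2
  · rfl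

/-- Where `μ` is positive, the integral of `μ ^ (s / 2)` against a form with compact support is
an entire function of `s`, and the residue vanishes. -/
theorem hasResidueOn_zero {p : ℕ} {O : Set X} {w : X → Alt n p}
    {e : OpenPartialHomeomorph X (EuclideanSpace ℝ (Fin n))} (he : e ∈ smoothCharts n X)
    (hOe : O ⊆ e.source) (hμ : ContMDiff (𝓡 n) 𝓘(ℝ, ℝ) ∞ μ) (hμ0 : ∀ x ∈ O, 0 < μ x)
    (hw : ∀ x ∈ O, SmoothFormAt (fun _ => 1) w x) (hn : n = k + m) :
    HasResidueOn (k := k) (m := m) o μ i hn O w fun _ _ => 0 := by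
  intro l hl φ K hφ hK hKO hφK
  rw [residuePairing_zero]
  have hKe : K ⊆ e.source := hKO.trans hOe
  have heK : IsCompact (e '' K) := hK.image_of_continuousOn (e.continuousOn.mono hKe)
  have heKt : e '' K ⊆ e.target := by
    rintro _ ⟨x, hx, rfl⟩
    exact e.map_source (hKe hx)
  have hsymm : ∀ z ∈ e '' K, e.symm z ∈ K := by
    rintro _ ⟨x, hx, rfl⟩
    rwa [e.left_inv (hKe hx)]
  set τ : X → Alt n (p + l) := fun x => wedge (w x) (φ x) with hτ
  have hτ0 : ∀ x, x ∉ K → τ x = 0 := fun x hx => by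
    rw [hτ]
    simp only
    rw [hφK x hx, wedge_zero]
  -- In the chart, `μ ^ (s / 2) = exp (s L)` with a continuous function `L`.
  set L : EuclideanSpace ℝ (Fin n) → ℝ := fun z => Real.log (μ (e.symm z)) / 2 with hL
  set g : EuclideanSpace ℝ (Fin n) → ℂ := fun z => (chartSign o e z : ℂ) *
    chartRep (fun _ => 1) e τ z (fun j => EuclideanSpace.single (Fin.cast hl j) (1 : ℝ)) with hg
  have hLc : ContinuousOn L (e '' K) := by
    intro z hz
    have h1 : ContinuousAt (fun z => μ (e.symm z)) z :=
      ContinuousAt.comp (f := e.symm) hμ.continuous.continuousAt (e.continuousAt_symm (heKt hz))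
    exact ((h1.log (hμ0 _ (hKO (hsymm z hz))).ne').div_const 2).continuousWithinAt
  have hgc : ContinuousOn g (e '' K) := by
    intro z hz
    have h1 : SmoothFormAt (fun _ => 1) τ (e.symm z) :=
      (hw _ (hKO (hsymm z hz))).wedge isSignChar_one (hφ _)
    have h2 := ((altApplyCLM fun j =>
      EuclideanSpace.single (Fin.cast hl j) (1 : ℝ)).continuous.continuousAt.comp
      (h1.contDiffAt_symm isSignChar_one he (heKt hz)).continuousAt)
    have h3 : ContinuousAt (fun z => (chartSign o e z : ℂ)) z := by
      refine (continuousAt_const (y := (chartSign o e z : ℂ))).congr ?_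
      filter_upwards [eventually_chartSign_eq o he (heKt hz)] with z' hz'
      rw [hz']
    exact (h3.mul h2).continuousWithinAt
  have hdiff := differentiable_integral_exp_mul volume heK hLc hgc
  have hden : ∀ s : ℂ, ∀ z ∈ e '' K, chartDensity e (zetaDensity o μ τ s) hl z =
      Complex.exp (s * L z) * g z := by
    intro s z hz
    rw [chartDensity_zetaDensity]
    congr 1
    have h1 := hμ0 _ (hKO (hsymm z hz))
    rw [Complex.cpow_def_of_ne_zero (by exact_mod_cast h1.ne'), ← Complex.ofReal_log h1.le]
    congr 1
    rw [hL]
    push_cast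
    ring
  have hden0 : ∀ s : ℂ, ∀ z ∈ e.target \ e '' K, chartDensity e (zetaDensity o μ τ s) hl z = 0 := by
    intro s z hz
    refine chartDensity_eq_zero hl ?_
    have h1 : e.symm z ∉ K := fun hx => hz.2 ⟨_, hx, e.right_inv hz.1⟩
    rw [zetaDensity, hτ0 _ h1, smul_zero]
  refine hasI0_of_chart hl he hK hKe hτ0 0
    (ζ := fun s => ∫ z in e '' K, Complex.exp (s * L z) * g z)
    (fun s => (hdiff.analyticAt s).meromorphicAt) (fun s _ => ⟨?_, ?_⟩) ?_
  · have h1 : IntegrableOn (fun z => Complex.exp (s * L z) * g z) (e '' K) := by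
      refine ContinuousOn.integrableOn_compact heK ?_
      exact (Complex.continuous_exp.comp_continuousOn (continuousOn_const.mul
        (Complex.continuous_ofReal.comp_continuousOn hLc))).mul hgc
    have h2 : IntegrableOn (chartDensity e (zetaDensity o μ τ s) hl) (e '' K) :=
      h1.congr_fun (fun z hz => (hden s z hz).symm) heK.measurableSet
    exact h2.of_forall_sdiff_eq_zero e.open_target.measurableSet (hden0 s)
  · exact (setIntegral_congr_fun heK.measurableSet (hden s)).symm.trans
      (setIntegral_eq_of_subset_of_forall_sdiff_eq_zero e.open_target.measurableSet heKt
        (hden0 s)).symm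
  · have h1 : Tendsto (fun s : ℂ => s * ∫ z in e '' K, Complex.exp (s * L z) * g z) (𝓝[≠] 0)
        (𝓝 ((0 : ℂ) * ∫ z in e '' K, Complex.exp ((0 : ℂ) * L z) * g z)) :=
      ((continuous_id.mul hdiff.continuous).tendsto (0 : ℂ)).mono_left nhdsWithin_le_nhds
    rwa [zero_mul] at h1

end Off

/-! ### The differential of a form with a tame singularity -/

section Differential

/-- `castDegree` as a linear map. -/
def castDegreeCLM {d p p' : ℕ} (h : p = p') : Alt d p →L[ℝ] Alt d p' :=
  LinearMap.toContinuousLinearMap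
    { toFun := castDegree h
      map_add' := fun _ _ => rfl
      map_smul' := fun _ _ => rfl }

/-- The Leibniz rule for the product of a function and a form. -/
theorem extDeriv_real_smul {d p : ℕ} {g : EuclideanSpace ℝ (Fin d) → ℝ}
    {w : EuclideanSpace ℝ (Fin d) → Alt d p} {z : EuclideanSpace ℝ (Fin d)}
    (hg : DifferentiableAt ℝ g z) (hw : DifferentiableAt ℝ w z) :
    extDeriv (fun z => g z • w z) z = g z • extDeriv w z +
      castDegree (add_comm 1 p) (wedge (oneForm (fderiv ℝ g z)) (w z)) := by
  ext v
  have h1 : fderiv ℝ (fun z => g z • w z) z = g z • fderiv ℝ w z +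
      (fderiv ℝ g z).smulRight (w z) := (hg.hasFDerivAt.smul hw.hasFDerivAt).fderiv
  rw [ContinuousAlternatingMap.add_apply, ContinuousAlternatingMap.smul_apply, castDegree_apply,
    wedge_oneForm_apply, extDeriv, extDeriv, ContinuousAlternatingMap.alternatizeUncurryFin_apply,
    ContinuousAlternatingMap.alternatizeUncurryFin_apply, h1, Finset.smul_sum,
    ← Finset.sum_add_distrib]
  refine Finset.sum_congr rfl fun j _ => ?_
  rw [zsmul_eq_mul, zsmul_eq_mul]
  push_cast
  change _ * (g z • fderiv ℝ w z (v j) (j.removeNth v) +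
    fderiv ℝ g z (v j) • w z (j.removeNth v)) = _
  rw [Complex.real_smul, Complex.real_smul, Complex.real_smul]
  ring

variable {d : ℕ} {Z : Type*} [TopologicalSpace Z]
  [ChartedSpace (EuclideanSpace ℝ (Fin d)) Z] [IsManifold (𝓡 d) ∞ Z] {κ : ℝ → ℝ}

theorem SmoothFormAt.castDegree {p p' : ℕ} (h : p = p') {w : Z → Alt d p} {x : Z}
    (hw : SmoothFormAt κ w x) : SmoothFormAt κ (fun x => TameResidue.castDegree h (w x)) x := by
  obtain ⟨e, he, hx, hs⟩ := hw
  exact ⟨e, he, hx, (castDegreeCLM h).contDiff.contDiffAt.comp _ hs⟩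

theorem chartDeriv_chartAt (x : Z) :
    chartDeriv (chartAt (EuclideanSpace ℝ (Fin d)) x) (chartAt _ x x) =
      ContinuousLinearMap.id ℝ _ := by
  rw [chartDeriv_eq_transDeriv, OpenPartialHomeomorph.left_inv _ (mem_chart_source _ x)]
  exact transDeriv_self (mem_chart_target _ x)

theorem chartRep_chartAt (hκ : IsSignChar κ) {q : ℕ} (w : Z → Alt d q) (x : Z) :
    chartRep κ (chartAt _ x) w (chartAt _ x x) = w x := by
  have h5 : (ContinuousLinearMap.id ℝ (EuclideanSpace ℝ (Fin d))).det = 1 := by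
    simp [ContinuousLinearMap.det]
  rw [chartRep, chartDeriv_chartAt, OpenPartialHomeomorph.left_inv _ (mem_chart_source _ x), h5,
    hκ.map_one, one_smul]
  rfl

theorem mfderiv_eq_fderiv {f : Z → ℝ} (hf : ContMDiff (𝓡 d) 𝓘(ℝ, ℝ) ∞ f) (x : Z) :
    mfderiv (𝓡 d) 𝓘(ℝ, ℝ) f x = fderiv ℝ (f ∘ (chartAt (EuclideanSpace ℝ (Fin d)) x).symm)
      (chartAt _ x x) := by
  have h1 := mfderiv_comp_chartDeriv hf (chartAt_mem_smoothCharts (d := d) x) (mem_chart_target _ x)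
  rw [chartDeriv_chartAt, OpenPartialHomeomorph.left_inv _ (mem_chart_source _ x)] at h1
  exact h1

theorem differential_eq_oneForm {f : Z → ℝ} (hf : ContMDiff (𝓡 d) 𝓘(ℝ, ℝ) ∞ f) (x : Z) :
    differential f x = oneForm (fderiv ℝ (f ∘ (chartAt (EuclideanSpace ℝ (Fin d)) x).symm)
      (chartAt _ x x)) := by
  rw [← mfderiv_eq_fderiv hf]
  rfl

theorem tendsto_chartAt_symm (x : Z) :
    Tendsto (chartAt (EuclideanSpace ℝ (Fin d)) x).symm (𝓝 (chartAt _ x x)) (𝓝 x) := by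
  have := (chartAt (EuclideanSpace ℝ (Fin d)) x).continuousAt_symm (mem_chart_target _ x)
  rwa [ContinuousAt, OpenPartialHomeomorph.left_inv _ (mem_chart_source _ x)] at this

theorem differential_eq_zero {f : Z → ℝ} (hf : ContMDiff (𝓡 d) 𝓘(ℝ, ℝ) ∞ f) {x : Z}
    (h0 : ∀ y, 0 ≤ f y) (hx : f x = 0) : differential (d := d) f x = 0 := by
  have h1 : IsLocalMin (f ∘ (chartAt (EuclideanSpace ℝ (Fin d)) x).symm) (chartAt _ x x) := by
    refine Eventually.of_forall fun z => ?_
    simp only [Function.comp_apply]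
    rw [OpenPartialHomeomorph.left_inv _ (mem_chart_source _ x), hx]
    exact h0 _
  rw [differential_eq_oneForm hf, h1.fderiv_eq_zero]
  ext v
  rw [oneForm_apply]
  simp

theorem chartD_congr {q : ℕ} {w w' : Z → Alt d q} {x : Z} (h : w =ᶠ[𝓝 x] w') :
    chartD κ w x = chartD κ w' x := by
  refine Filter.EventuallyEq.extDeriv_eq ?_
  filter_upwards [(tendsto_chartAt_symm x).eventually h] with z hz
  rw [chartRep, hz, chartRep]

theorem chartD_real_smul {f : Z → ℝ} (hf : ContMDiff (𝓡 d) 𝓘(ℝ, ℝ) ∞ f) {q : ℕ} {w : Z → Alt d q}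
    {x : Z} (hw : SmoothFormAt (fun _ => 1) w x) :
    chartD (fun _ => 1) (fun x => (f x : ℂ) • w x) x = (f x : ℂ) • chartD (fun _ => 1) w x +
      castDegree (add_comm 1 q) (wedge (differential f x) (w x)) := by
  have hc := chartAt_mem_smoothCharts (d := d) x
  have hx := mem_chart_source (EuclideanSpace ℝ (Fin d)) x
  have h1 : chartRep (fun _ => 1) (chartAt _ x) (fun x => (f x : ℂ) • w x) =
      fun z => (f ∘ (chartAt (EuclideanSpace ℝ (Fin d)) x).symm) z •
        chartRep (fun _ => 1) (chartAt _ x) w z := by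
    funext z
    rw [chartRep_smul, Complex.coe_smul]
    rfl
  rw [chartD, h1, extDeriv_real_smul
    ((contDiffAt_comp_symm hf.contMDiffAt hc hx).differentiableAt (by simp))
    ((hw.contDiffAt isSignChar_one hc hx).differentiableAt (by simp)), chartRep_chartAt
    isSignChar_one, ← differential_eq_oneForm hf, Function.comp_apply,
    OpenPartialHomeomorph.left_inv _ hx, Complex.coe_smul]
  rfl

theorem chartD_chartD {q : ℕ} {w : Z → Alt d q} {x : Z}
    (hw : ∀ᶠ y in 𝓝 x, SmoothFormAt (fun _ => 1) w y) :
    chartD (fun _ => 1) (chartD (fun _ => 1) w) x = 0 := by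
  have hc := chartAt_mem_smoothCharts (d := d) x
  have hx := mem_chart_source (EuclideanSpace ℝ (Fin d)) x
  have h1 : chartRep (fun _ => 1) (chartAt _ x) (chartD (fun _ => 1) w) =ᶠ[𝓝 (chartAt _ x x)]
      extDeriv (chartRep (fun _ => 1) (chartAt _ x) w) := by
    filter_upwards [(tendsto_chartAt_symm x).eventually hw,
      (chartAt _ x).open_target.mem_nhds (mem_chart_target _ x)] with z hz hz'
    exact chartRep_chartD isSignChar_one hc hz' hz
  rw [chartD, h1.extDeriv_eq]
  refine extDeriv_extDeriv_apply (r := ∞) (hw.self_of_nhds.contDiffAt isSignChar_one hc hx) ?_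
  rw [minSmoothness_of_isRCLikeNormedField]
  exact ENat.LEInfty.out

/-- The differential of a power of a function. -/
theorem differential_pow {f : Z → ℝ} (hf : ContMDiff (𝓡 d) 𝓘(ℝ, ℝ) ∞ f) (r : ℕ) (x : Z) :
    differential (d := d) (fun x => f x ^ r) x = (r * (f x : ℂ) ^ (r - 1)) • differential f x := by
  have hf' : ContMDiff (𝓡 d) 𝓘(ℝ, ℝ) ∞ fun x => f x ^ r := hf.pow r
  have hx := mem_chart_source (EuclideanSpace ℝ (Fin d)) x
  rw [differential_eq_oneForm hf', differential_eq_oneForm hf]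
  have h1 : DifferentiableAt ℝ (f ∘ (chartAt (EuclideanSpace ℝ (Fin d)) x).symm) (chartAt _ x x) :=
    (contDiffAt_comp_symm hf.contMDiffAt (chartAt_mem_smoothCharts x) hx).differentiableAt (by simp)
  have h2 := (h1.hasFDerivAt.pow r).fderiv
  have h3 : fderiv ℝ ((fun x => f x ^ r) ∘ (chartAt (EuclideanSpace ℝ (Fin d)) x).symm)
      (chartAt _ x x) = (r * f x ^ (r - 1)) •
        fderiv ℝ (f ∘ (chartAt (EuclideanSpace ℝ (Fin d)) x).symm) (chartAt _ x x) := by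
    refine Eq.trans h2 ?_
    rw [Function.comp_apply, OpenPartialHomeomorph.left_inv _ hx, nsmul_eq_mul]
  rw [h3, oneForm_smul, ← Complex.coe_smul]
  push_cast
  rfl

end Differential

section TameExtension

variable {d : ℕ} {Z : Type*} [TopologicalSpace Z]
  [ChartedSpace (EuclideanSpace ℝ (Fin d)) Z] [IsManifold (𝓡 d) ∞ Z]

/-- The forms `ψ` and `χ` are smooth extensions to `O` of `μ ^ r w` and `μ ^ (r - 1) dμ ∧ w`. -/
structure IsTameExtension (μ : Z → ℝ) (S : Set Z) (r : ℕ) {p : ℕ} (O : Set Z) (w : Z → Alt d p)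
    (ψ : Z → Alt d p) (χ : Z → Alt d (1 + p)) : Prop where
  smooth_left : ∀ x ∈ O, SmoothFormAt (fun _ => 1) ψ x
  smooth_right : ∀ x ∈ O, SmoothFormAt (fun _ => 1) χ x
  left_eq : ∀ x ∈ O, x ∉ S → ψ x = (μ x : ℂ) ^ r • w x
  right_eq : ∀ x ∈ O, x ∉ S →
    χ x = (μ x : ℂ) ^ ((r : ℤ) - 1) • wedge (differential μ x) (w x)

variable {μ : Z → ℝ} {S O U : Set Z} {r m p : ℕ} {w ψ : Z → Alt d p} {χ : Z → Alt d (1 + p)}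

theorem IsTameExtension.mono (h : IsTameExtension μ S r O w ψ χ) (hU : U ⊆ O) :
    IsTameExtension μ S r U w ψ χ :=
  ⟨fun x hx => h.smooth_left x (hU hx), fun x hx => h.smooth_right x (hU hx),
    fun x hx => h.left_eq x (hU hx), fun x hx => h.right_eq x (hU hx)⟩

theorem IsTameExtension.congr (h : IsTameExtension μ S r O w ψ χ) {w' : Z → Alt d p}
    (hw : ∀ x ∈ O, x ∉ S → w' x = w x) : IsTameExtension μ S r O w' ψ χ :=
  ⟨h.smooth_left, h.smooth_right, fun x hx hS => by rw [h.left_eq x hx hS, hw x hx hS],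
    fun x hx hS => by rw [h.right_eq x hx hS, hw x hx hS]⟩

/-- The relation `dμ ∧ ψ = μ χ` holds on the zero set of `μ` as well, since `dμ` vanishes
there. -/
theorem IsTameExtension.wedge_differential (h : IsTameExtension μ S r O w ψ χ)
    (hμ : IsMorseBott d μ S m) {x : Z} (hx : x ∈ O) :
    wedge (differential μ x) (ψ x) = (μ x : ℂ) • χ x := by
  by_cases hS : x ∈ S
  · have h0 := (hμ.eq_zero_iff x).2 hS
    rw [differential_eq_zero hμ.smooth hμ.nonneg h0, zero_wedge, h0, Complex.ofReal_zero, zero_smul]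
  · have h0 : (μ x : ℂ) ≠ 0 := by
      rw [Complex.ofReal_ne_zero]
      exact fun h1 => hS ((hμ.eq_zero_iff x).1 h1)
    rw [h.left_eq x hx hS, h.right_eq x hx hS, wedge_smul, smul_smul, ← zpow_one_add₀ h0]
    congr 1
    rw [← zpow_natCast]
    congr 1
    ring

/-- If `ψ` and `χ` extend `μ ^ r w` and `μ ^ (r - 1) dμ ∧ w`, then `dψ - r χ` extends `μ ^ r dw`;
a further differentiation shows that `μ ^ (r - 1) dμ ∧ dw` extends as well. -/
theorem IsTameExtension.chartD (h : IsTameExtension μ S r O w ψ χ)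
    (hμ : ContMDiff (𝓡 d) 𝓘(ℝ, ℝ) ∞ μ) (hr : 0 < r)
    (hO : IsOpen O) (hS : IsClosed S) (hw : ∀ x ∈ O, x ∉ S → SmoothFormAt (fun _ => 1) w x) :
    IsTameExtension μ S r O (TameResidue.chartD (fun _ => 1) w)
      (fun x => TameResidue.chartD (fun _ => 1) ψ x - (r : ℂ) • castDegree (add_comm 1 p) (χ x))
      (fun x => (r : ℂ)⁻¹ • castDegree (add_comm (p + 1) 1) (TameResidue.chartD (fun _ => 1)
        (fun x => TameResidue.chartD (fun _ => 1) ψ x - (r : ℂ) • castDegree (add_comm 1 p) (χ x))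
        x)) := by
  set ψ' : Z → Alt d (p + 1) :=
    fun x => TameResidue.chartD (fun _ => 1) ψ x - (r : ℂ) • castDegree (add_comm 1 p) (χ x)
  have hψ' : ∀ x ∈ O, SmoothFormAt (fun _ => 1) ψ' x := by
    intro x hx
    have h1 : SmoothFormAt (fun _ => 1) (TameResidue.chartD (fun _ => 1) ψ) x := by
      refine smoothFormAt_chartD isSignChar_one ?_
      filter_upwards [hO.mem_nhds hx] with y hy using h.smooth_left y hy
    have h2 := (h1.add isSignChar_one
      (((h.smooth_right x hx).castDegree (add_comm 1 p)).const_smul (-(r : ℂ))))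
    refine h2.congr_of_eventuallyEq (Eventually.of_forall fun y => ?_)
    change TameResidue.chartD (fun _ => 1) ψ y - (r : ℂ) • castDegree (add_comm 1 p) (χ y) =
      TameResidue.chartD (fun _ => 1) ψ y + (-(r : ℂ)) • castDegree (add_comm 1 p) (χ y)
    rw [neg_smul, sub_eq_add_neg]
  have hnear : ∀ x ∈ O, x ∉ S → ∀ᶠ y in 𝓝 x, y ∈ O ∧ y ∉ S := fun x hx hxS =>
    (hO.eventually_mem hx).and (hS.isOpen_compl.eventually_mem hxS)
  have hpow : ContMDiff (𝓡 d) 𝓘(ℝ, ℝ) ∞ fun x => μ x ^ r := hμ.pow r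
  have hzpow : ∀ x, x ∉ S → (μ x : ℂ) ^ ((r : ℤ) - 1) = (μ x : ℂ) ^ (r - 1) := by
    intro x hx
    rw [← zpow_natCast]
    congr 1
    omega
  have hleft : ∀ x ∈ O, x ∉ S → ψ' x = (μ x : ℂ) ^ r • TameResidue.chartD (fun _ => 1) w x := by
    intro x hx hxS
    have h1 : ψ =ᶠ[𝓝 x] fun y => ((μ y ^ r : ℝ) : ℂ) • w y := by
      filter_upwards [hnear x hx hxS] with y hy
      rw [h.left_eq y hy.1 hy.2, Complex.ofReal_pow]
    change TameResidue.chartD (fun _ => 1) ψ x - (r : ℂ) • castDegree (add_comm 1 p) (χ x) = _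
    rw [chartD_congr h1, chartD_real_smul hpow (hw x hx hxS), h.right_eq x hx hxS,
      differential_pow hμ, smul_wedge, hzpow x hxS, Complex.ofReal_pow, mul_smul]
    exact add_sub_cancel_right _ _
  refine ⟨hψ', fun x hx => ?_, hleft, fun x hx hxS => ?_⟩
  · refine SmoothFormAt.const_smul _ (SmoothFormAt.castDegree _ ?_)
    refine smoothFormAt_chartD isSignChar_one ?_
    filter_upwards [hO.mem_nhds hx] with y hy using hψ' y hy
  · have h1 : ψ' =ᶠ[𝓝 x] fun y => ((μ y ^ r : ℝ) : ℂ) • TameResidue.chartD (fun _ => 1) w y := by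
      filter_upwards [hnear x hx hxS] with y hy
      rw [hleft y hy.1 hy.2, Complex.ofReal_pow]
    have h2 : ∀ᶠ y in 𝓝 x, SmoothFormAt (fun _ => 1) w y := by
      filter_upwards [hnear x hx hxS] with y hy using hw y hy.1 hy.2
    rw [chartD_congr h1, chartD_real_smul hpow (smoothFormAt_chartD isSignChar_one h2),
      chartD_chartD h2, smul_zero, zero_add, differential_pow hμ, smul_wedge, hzpow x hxS, mul_smul]
    have h3 : (r : ℂ) ≠ 0 := by exact_mod_cast hr.ne'
    change (r : ℂ)⁻¹ • (r : ℂ) • ((μ x : ℂ) ^ (r - 1) • wedge (differential μ x)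
      (TameResidue.chartD (fun _ => 1) w x)) = _
    rw [smul_smul, inv_mul_cancel₀ h3, one_smul]

theorem exists_isTameExtension (hU : IsOpen U) (hw : w ∈ tameSections d μ S r U p) :
    ∃ ψ χ, IsTameExtension μ S r U w ψ χ := by
  obtain ⟨_, ⟨ψ, hψ, hψe⟩, ⟨χ, hχ, hχe⟩⟩ := hw
  exact ⟨ψ, χ, ((mem_formSections_iff hU).1 hψ).2, ((mem_formSections_iff hU).1 hχ).2,
    fun x hx hS => hψe x ⟨hx, hS⟩, fun x hx hS => hχe x ⟨hx, hS⟩⟩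

theorem indicator_mem_formSections_of_smoothFormAt (hU : IsOpen U) {q : ℕ} {η : Z → Alt d q}
    (hη : ∀ x ∈ U, SmoothFormAt (fun _ => 1) η x) : U.indicator η ∈ formSections d U q := by
  rw [mem_formSections_iff hU]
  refine ⟨fun x hx => indicator_of_notMem hx _, fun x hx => ?_⟩
  refine (hη x hx).congr_of_eventuallyEq ?_
  filter_upwards [hU.mem_nhds hx] with y hy using indicator_of_mem hy _

theorem mem_tameSections_of_isTameExtension (hU : IsOpen U) (hw : w ∈ formSections d (U \ S) p)
    (h : IsTameExtension μ S r U w ψ χ) : w ∈ tameSections d μ S r U p :=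
  ⟨hw, ⟨_, indicator_mem_formSections_of_smoothFormAt hU h.smooth_left, fun x hx => by
      rw [indicator_of_mem hx.1, h.left_eq x hx.1 hx.2]⟩,
    ⟨_, indicator_mem_formSections_of_smoothFormAt hU h.smooth_right, fun x hx => by
      rw [indicator_of_mem hx.1, h.right_eq x hx.1 hx.2]⟩⟩

theorem dForm_mem_formSections (hU : IsOpen U) (hw : w ∈ formSections d U p) :
    dForm U w ∈ formSections d U (p + 1) := by
  rw [dForm_eq]
  refine indicator_mem_formSections_of_smoothFormAt hU fun x hx => ?_
  refine smoothFormAt_chartD isSignChar_one ?_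
  filter_upwards [hU.mem_nhds hx] with y hy using ((mem_formSections_iff hU).1 hw).2 y hy

/-- If `S` is open, all smooth forms on `U \ S` extend smoothly to `U`. -/
theorem mem_tameSections_of_isOpen (hU : IsOpen U) (hS : IsClosed S) (hSo : IsOpen S)
    (hμ : ContMDiff (𝓡 d) 𝓘(ℝ, ℝ) ∞ μ) (hμ0 : ∀ x, x ∉ S → μ x ≠ 0)
    (hw : w ∈ formSections d (U \ S) p) : w ∈ tameSections d μ S r U p := by
  have hUS : IsOpen (U \ S) := hU.sdiff hS
  have key : ∀ {q : ℕ} {η : Z → Alt d q}, (∀ x ∈ U \ S, SmoothFormAt (fun _ => 1) η x) →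
      ∀ x ∈ U, SmoothFormAt (fun _ => 1) ((U \ S).indicator η) x := by
    intro q η hη x hx
    by_cases hxS : x ∈ S
    · have h0 : SmoothFormAt (fun _ => 1) (0 : Z → Alt d q) x :=
        ((mem_formSections_iff isOpen_univ).1 (zero_mem (formSections d univ q))).2 x (mem_univ x)
      refine h0.congr_of_eventuallyEq ?_
      filter_upwards [hSo.mem_nhds hxS] with y hy
      exact indicator_of_notMem (fun hy' => hy'.2 hy) _
    · refine (hη x ⟨hx, hxS⟩).congr_of_eventuallyEq ?_
      filter_upwards [hUS.mem_nhds ⟨hx, hxS⟩] with y hy using indicator_of_mem hy _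
  have hws := ((mem_formSections_iff hUS).1 hw).2
  have hμc : ContMDiff (𝓡 d) 𝓘(ℝ, ℂ) ∞ fun x => (μ x : ℂ) :=
    Complex.ofRealCLM.contDiff.contMDiff.comp hμ
  have hz : ∀ (N : ℤ) x, x ∉ S → ContMDiffAt (𝓡 d) 𝓘(ℝ, ℂ) ∞ (fun x => (μ x : ℂ) ^ N) x := by
    intro N x hx
    have h1 : ContDiffAt ℝ ∞ (fun c : ℂ => c ^ N) (μ x : ℂ) := by
      have h0 : (μ x : ℂ) ≠ 0 := by exact_mod_cast hμ0 x hx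
      have h2 : AnalyticAt ℂ (fun c : ℂ => c ^ N) (μ x : ℂ) := analyticAt_id.zpow h0
      exact h2.contDiffAt.restrict_scalars ℝ
    exact h1.contMDiffAt.comp x hμc.contMDiffAt
  refine ⟨hw, ⟨_, indicator_mem_formSections_of_smoothFormAt hU (key
    (η := fun x => (μ x : ℂ) ^ r • w x) fun x hx => ?_), fun x hx => ?_⟩,
    ⟨_, indicator_mem_formSections_of_smoothFormAt hU (key (η := fun x =>
      (μ x : ℂ) ^ ((r : ℤ) - 1) • wedge (differential μ x) (w x)) fun x hx => ?_), fun x hx => ?_⟩⟩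
  · exact (hws x hx).smul ((contDiff_id.pow r).contMDiff.comp hμc).contMDiffAt
  · rw [indicator_of_mem hx.1, indicator_of_mem hx]
  · exact ((smoothFormAt_differential hμ x).wedge isSignChar_one (hws x hx)).smul (hz _ x hx.2)
  · rw [indicator_of_mem hx.1, indicator_of_mem hx]

end TameExtension

/-! ### Existence of residues locally -/

section LocalResidue

variable {n k m : ℕ} {X Y : Type*} [TopologicalSpace X]
  [ChartedSpace (EuclideanSpace ℝ (Fin n)) X] [IsManifold (𝓡 n) ∞ X] [TopologicalSpace Y]
  [ChartedSpace (EuclideanSpace ℝ (Fin k)) Y] [IsManifold (𝓡 k) ∞ Y]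
  [T2Space X] [SigmaCompactSpace X] [T2Space Y] [SigmaCompactSpace Y]
  {o : ManifoldOrientation n X} {μ : X → ℝ} {i : Y → X} {p : ℕ}

/-- The differential of a family of twisted forms indexed by `q` with `q + m = p`, computed
at every point in the preferred chart. -/
def shiftedChartD (β : (q : {q : ℕ // q + m = p}) → Y → Alt k q) :
    (q : {q : ℕ // q + m = p + 1}) → Y → Alt k q
  | ⟨0, _⟩ => 0
  | ⟨q + 1, h⟩ => chartD Real.sign (β ⟨q, by omega⟩)

theorem HasResidueOn.congr {hn : n = k + m} {O : Set X} {w w' : X → Alt n p}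
    {β β' : (q : {q : ℕ // q + m = p}) → Y → Alt k q} (h : HasResidueOn o μ i hn O w β)
    (hw : ∀ x ∈ O, w' x = w x) (hβ : ∀ q y, i y ∈ O → β' q y = β q y) :
    HasResidueOn o μ i hn O w' β' := by
  intro l hl φ K hφ hK hKO hφK
  have h1 := h l hl φ K hφ hK hKO hφK
  have h2 : (fun x => wedge (w' x) (φ x)) = fun x => wedge (w x) (φ x) := by
    funext x
    by_cases hx : x ∈ K
    · rw [hw x (hKO hx)]
    · rw [hφK x hx, wedge_zero, wedge_zero]
  have h3 : residuePairing i β' φ (hl.trans hn) = residuePairing i β φ (hl.trans hn) := by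
    rw [residuePairing, residuePairing]
    split_ifs with hp
    · congr 1
      funext y
      by_cases hy : i y ∈ K
      · rw [hβ _ y (hKO hy)]
      · have h4 : pullback (k := k) i φ y = 0 := by rw [pullback, hφK _ hy]; rfl
        rw [h4, wedge_zero, wedge_zero]
    · rfl
  rw [h2, h3]
  exact h1

theorem HasResidueOn.mono {hn : n = k + m} {O O' : Set X} {w : X → Alt n p}
    {β : (q : {q : ℕ // q + m = p}) → Y → Alt k q} (h : HasResidueOn o μ i hn O w β)
    (hO : O' ⊆ O) : HasResidueOn o μ i hn O' w β :=
  fun l hl φ K hφ hK hKO hφK => h l hl φ K hφ hK (hKO.trans hO) hφK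

theorem hasResidueOn_zero_zero (o : ManifoldOrientation n X) (μ : X → ℝ) (i : Y → X)
    (hn : n = k + m) (O : Set X) (p : ℕ) :
    HasResidueOn (k := k) (m := m) o μ i hn O (fun _ => (0 : Alt n p)) fun _ _ => 0 := by
  intro l hl φ K hφ hK hKO hφK
  rw [residuePairing_zero]
  simp only [zero_wedge]
  exact hasI0_zero o μ hl

theorem smoothFormAt_zero {d : ℕ} {Z : Type*} [TopologicalSpace Z]
    [ChartedSpace (EuclideanSpace ℝ (Fin d)) Z] [IsManifold (𝓡 d) ∞ Z] {κ : ℝ → ℝ} {q : ℕ} (x : Z) :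
    SmoothFormAt κ (fun _ : Z => (0 : Alt d q)) x := by
  refine ⟨_, chartAt_mem_smoothCharts x, mem_chart_source _ x, ?_⟩
  have h1 : chartRep κ (chartAt _ x) (fun _ : Z => (0 : Alt d q)) = fun _ => 0 := by
    funext z
    have h2 : (0 : Alt d q).compContinuousLinearMap (chartDeriv (chartAt _ x) z) = 0 := rfl
    rw [chartRep, h2, smul_zero]
  rw [h1]
  exact contDiffAt_const

theorem shiftedChartD_zero (q : {q : ℕ // q + m = p + 1}) (y : Y) :
    shiftedChartD (fun (_ : {q : ℕ // q + m = p}) (_ : Y) => (0 : Alt k _)) q y = 0 := by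
  obtain ⟨q, hq⟩ := q
  cases q with
  | zero => rfl
  | succ q =>
    have h1 : chartRep Real.sign (chartAt _ y) (fun _ : Y => (0 : Alt k q)) =
        (0 : ℝ) • fun _ => (0 : Alt k q) := by
      funext z
      have h2 : (0 : Alt k q).compContinuousLinearMap (chartDeriv (chartAt _ y) z) = 0 := rfl
      rw [chartRep, h2, smul_zero]
      simp
    change chartD Real.sign (fun _ : Y => (0 : Alt k q)) y = 0
    rw [chartD, h1, extDeriv_smul, zero_smul]

section Morse

variable {h : m + k = n} {e : OpenPartialHomeomorph X (EuclideanSpace ℝ (Fin n))}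
  {f : OpenPartialHomeomorph Y (EuclideanSpace ℝ (Fin k))} {O : Set X} {ψ : X → Alt n p}
  {χ : X → Alt n (1 + p)}

/-- In a Morse chart, taking residues commutes with the differential. -/
theorem IsMorseChart.morseResidue_chartD (hM : IsMorseChart h i μ e f)
    (hμ : ContMDiff (𝓡 n) 𝓘(ℝ, ℝ) ∞ μ) {r : ℕ} (hr : m = 2 * r) (hO : IsOpen O)
    (hψ : ∀ x ∈ O, SmoothFormAt (fun _ => 1) ψ x) (hχ : ∀ x ∈ O, SmoothFormAt (fun _ => 1) χ x)
    (hdμ : ∀ x ∈ O, wedge (differential μ x) (ψ x) = (μ x : ℂ) • χ x)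
    {y : Y} (hy : y ∈ f.source) (hyO : i y ∈ O) (q : {q : ℕ // q + m = p + 1}) :
    morseResidue o h e f
      (fun x => chartD (fun _ => 1) ψ x - (r : ℂ) • castDegree (add_comm 1 p) (χ x)) q y =
      shiftedChartD (morseResidue o h e f ψ) q y := by
  set D := e.target ∩ e.symm ⁻¹' O with hD
  have hDo : IsOpen D := e.isOpen_inter_preimage_symm hO
  have hT : IsTamePair h D _ _ := hM.isTamePair hμ hdμ
  have hPd := (contDiffOn_chartRep hM.mem_left hψ).differentiableOn (by simp)
  have hQd := (contDiffOn_chartRep hM.mem_left hχ).differentiableOn (by simp)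
  have hb := f.map_source hy
  have hJ : tangentIncl h (f y) = e (i y) := hM.tangentIncl_eq hy
  have hbD : tangentIncl h (f y) ∈ D := by
    rw [hJ]
    refine ⟨e.map_source ((hM.mem_iff y).2 hy), ?_⟩
    rw [mem_preimage, e.left_inv ((hM.mem_iff y).2 hy)]
    exact hyO
  have hrep : ∀ z ∈ D, chartRep (fun _ => 1) e
      (fun x => chartD (fun _ => 1) ψ x - (r : ℂ) • castDegree (add_comm 1 p) (χ x)) z =
      extDeriv (chartRep (fun _ => 1) e ψ) z -
        (r : ℂ) • castDegree (add_comm 1 p) (chartRep (fun _ => 1) e χ z) := by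
    intro z hz
    rw [← chartRep_chartD isSignChar_one hM.mem_left hz.1 (hψ _ hz.2)]
    simp only [chartRep, one_smul]
    rfl
  have hy' : f.symm (f y) = y := f.left_inv hy
  obtain ⟨q, hq⟩ := q
  suffices hs : chartRep Real.sign f (morseResidue o h e f
      (fun x => chartD (fun _ => 1) ψ x - (r : ℂ) • castDegree (add_comm 1 p) (χ x)) ⟨q, hq⟩) (f y)
      = chartRep Real.sign f (shiftedChartD (morseResidue o h e f ψ) ⟨q, hq⟩) (f y) by
    have := eq_of_chartRep_eq isSignChar_sign hM.mem_right hb hs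
    rwa [hy'] at this
  rw [chartRep_morseResidue hM _ hb]
  have hcon : ∀ {q : ℕ} (hq : m + q = p + 1), normalContract h hq (chartRep (fun _ => 1) e
      (fun x => chartD (fun _ => 1) ψ x - (r : ℂ) • castDegree (add_comm 1 p) (χ x))) (f y) =
      normalContract h hq (fun z => extDeriv (chartRep (fun _ => 1) e ψ) z -
        (r : ℂ) • castDegree (add_comm 1 p) (chartRep (fun _ => 1) e χ z)) (f y) := by
    intro q hq
    rw [normalContract, normalContract, hrep _ hbD]
  rw [hcon]
  cases q with
  | zero =>
    rw [hT.normalContract_eq_zero hDo hPd hQd hbD hr, smul_zero]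
    change _ = chartRep Real.sign f (fun _ : Y => (0 : Alt k 0)) (f y)
    rw [chartRep]
    exact (smul_zero _).symm
  | succ q =>
    have hsm : SmoothFormAt Real.sign (morseResidue o h e f ψ ⟨q, by omega⟩) (f.symm (f y)) := by
      rw [hy']
      exact smoothFormAt_morseResidue hM _ hy (hψ _ hyO)
    change _ = chartRep Real.sign f (chartD Real.sign (morseResidue o h e f ψ ⟨q, _⟩)) (f y)
    rw [chartRep_chartD isSignChar_sign hM.mem_right hb hsm,
      (hM.eventually_chartRep_morseResidue _ hb).extDeriv_eq,
      ← hT.extDeriv_normalContract hDo hPd hQd hbD hr ((add_comm _ _).trans (by omega))]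
    have hreal : ∀ g : EuclideanSpace ℝ (Fin k) → Alt k q,
        (((volume : Measure (EuclideanSpace ℝ (Fin m))).toSphere.real univ : ℂ) *
          (chartSign o e (tangentIncl h (f y)) : ℂ)) • g =
        ((volume : Measure (EuclideanSpace ℝ (Fin m))).toSphere.real univ *
          chartSign o e (tangentIncl h (f y))) • g := by
      intro g
      rw [← Complex.ofReal_mul]
      funext b
      exact Complex.coe_smul _ _
    rw [hreal, extDeriv_smul, ← Complex.ofReal_mul]
    exact Complex.coe_smul _ _

end Morse

variable {r : ℕ}

theorem isOpen_range_of_codim_zero (hn : n = k) (hi : IsSmoothEmbedding (𝓡 k) (𝓡 n) ∞ i)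
    (hμ : IsMorseBott n μ (range i) 0) : IsOpen (range i) := by
  refine isOpen_iff_mem_nhds.2 ?_
  rintro _ ⟨y, rfl⟩
  obtain ⟨e, f, hM, hy⟩ := exists_isMorseChart (by omega : 0 + k = n) hi hμ y
  refine mem_of_superset (e.open_source.mem_nhds ((hM.mem_iff y).2 hy)) fun x hx => ?_
  rw [← hμ.eq_zero_iff, hM.eq_norm_sq x hx, Subsingleton.elim (split _ (e x)).1 0, norm_zero,
    zero_pow two_ne_zero]

/-- The differential of a form with a tame singularity has a tame singularity. -/
theorem dForm_mem_tameSections (hn : n = k + 2 * r) (hi : IsSmoothEmbedding (𝓡 k) (𝓡 n) ∞ i)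
    (hY : IsClosed (range i)) (hμ : IsMorseBott n μ (range i) (2 * r)) {U : Set X} (hU : IsOpen U)
    {w : X → Alt n p} (hw : w ∈ tameSections n μ (range i) r U p) :
    dForm (U \ range i) w ∈ tameSections n μ (range i) r U (p + 1) := by
  have hUS : IsOpen (U \ range i) := hU.sdiff hY
  have h1 := dForm_mem_formSections hUS hw.1
  have hμ0 : ∀ x, x ∉ range i → μ x ≠ 0 := fun x hx h0 => hx ((hμ.eq_zero_iff x).1 h0)
  -- In codimension zero, `Y` is open and closed, and the condition at `Y` is empty.
  rcases Nat.eq_zero_or_pos r with rfl | hr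
  · exact mem_tameSections_of_isOpen hU hY (isOpen_range_of_codim_zero (by omega) hi hμ) hμ.smooth
      hμ0 h1
  · obtain ⟨ψ, χ, hE⟩ := exists_isTameExtension hU hw
    have hE' := hE.chartD hμ.smooth hr hU hY fun x hx hS =>
      ((mem_formSections_iff hUS).1 hw.1).2 x ⟨hx, hS⟩
    refine mem_tameSections_of_isTameExtension hU h1 (hE'.congr fun x hx hS => ?_)
    rw [dForm_eq, indicator_of_mem (show x ∈ U \ range i from ⟨hx, hS⟩)]

/-- Near every point, a form with a tame singularity has a smooth residue, and the differential
of this residue is the residue of the differential of the form. -/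
theorem exists_hasResidueOn (o : ManifoldOrientation n X) (hn : n = k + 2 * r)
    (hi : IsSmoothEmbedding (𝓡 k) (𝓡 n) ∞ i)
    (hY : IsClosed (range i)) (hμ : IsMorseBott n μ (range i) (2 * r)) {U : Set X} (hU : IsOpen U)
    {w : X → Alt n p} (hw : w ∈ tameSections n μ (range i) r U p) {x : X} (hx : x ∈ U) :
    ∃ (O : Set X) (β : (q : {q : ℕ // q + 2 * r = p}) → Y → Alt k q), IsOpen O ∧ x ∈ O ∧ O ⊆ U ∧
      (∀ q y, i y ∈ O → SmoothFormAt Real.sign (β q) y) ∧ HasResidueOn o μ i hn O w β ∧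
      HasResidueOn o μ i hn O (dForm (U \ range i) w) (shiftedChartD β) := by
  have hUS : IsOpen (U \ range i) := hU.sdiff hY
  have hws := ((mem_formSections_iff hUS).1 hw.1).2
  have hdw := (mem_formSections_iff hUS).1 (dForm_mem_formSections hUS hw.1)
  by_cases hxS : x ∈ range i
  · obtain ⟨y₀, rfl⟩ := hxS
    obtain ⟨e, f, hM, hy₀⟩ := exists_isMorseChart (by omega : 2 * r + k = n) hi hμ y₀
    have hO : IsOpen (e.source ∩ U) := e.open_source.inter hU
    have hx' : i y₀ ∈ e.source ∩ U := ⟨(hM.mem_iff y₀).2 hy₀, hx⟩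
    -- In codimension zero, `Y` is open and closed, and sections are extended by zero to `Y`.
    rcases Nat.eq_zero_or_pos r with rfl | hr
    · have hr0 := isOpen_range_of_codim_zero (by omega) hi hμ
      refine ⟨range i ∩ U, fun _ _ => 0, hr0.inter hU, ⟨⟨y₀, rfl⟩, hx⟩, inter_subset_right,
        fun _ _ _ => smoothFormAt_zero _, ?_, ?_⟩
      · exact (hasResidueOn_zero_zero o μ i hn _ p).congr
          (fun x hx => hw.1.1 x fun hx' => hx'.2 hx.1) fun _ _ _ => rfl
      · exact (hasResidueOn_zero_zero o μ i hn _ (p + 1)).congr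
          (fun x hx => hdw.1 x fun hx' => hx'.2 hx.1) fun _ _ _ => shiftedChartD_zero _ _
    · obtain ⟨ψ, χ, hE⟩ := exists_isTameExtension hU hw
      have hE' := (hE.chartD hμ.smooth hr hU hY fun x hx hS => hws x ⟨hx, hS⟩).congr
        (w' := dForm (U \ range i) w) fun x hx hS => by
          rw [dForm_eq, indicator_of_mem (show x ∈ U \ range i from ⟨hx, hS⟩)]
      replace hE := hE.mono (inter_subset_right : e.source ∩ U ⊆ U)
      replace hE' := hE'.mono (inter_subset_right : e.source ∩ U ⊆ U)
      have hic : IsClosedEmbedding i := ⟨hi.isEmbedding, hY⟩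
      refine ⟨e.source ∩ U, morseResidue o _ e f ψ, hO, hx', inter_subset_right,
        fun q y hy => smoothFormAt_morseResidue hM q ((hM.mem_iff y).1 hy.1)
          (hE.smooth_left _ hy), ?_, ?_⟩
      · exact hM.hasResidueOn hμ.smooth hμ.eq_zero_iff hi.contMDiff hic hn rfl hr hO
          inter_subset_left hE.smooth_left hE.smooth_right hE.left_eq
          fun x hx => hE.wedge_differential hμ hx
      · refine (hM.hasResidueOn hμ.smooth hμ.eq_zero_iff hi.contMDiff hic hn rfl hr hO
          inter_subset_left hE'.smooth_left hE'.smooth_right hE'.left_eq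
          fun x hx => hE'.wedge_differential hμ hx).congr (fun _ _ => rfl) fun q y hy => ?_
        exact (hM.morseResidue_chartD hμ.smooth rfl hO hE.smooth_left hE.smooth_right
          (fun x hx => hE.wedge_differential hμ hx) ((hM.mem_iff y).1 hy.1) hy q).symm
  -- Off `Y`, the residue is zero.
  · set e := chartAt (EuclideanSpace ℝ (Fin n)) x
    have hpos : ∀ x ∈ e.source ∩ (U \ range i), 0 < μ x := fun x hx =>
      lt_of_le_of_ne (hμ.nonneg x) fun h0 => hx.2.2 ((hμ.eq_zero_iff x).1 h0.symm)
    refine ⟨e.source ∩ (U \ range i), fun _ _ => 0, e.open_source.inter hUS,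
      ⟨mem_chart_source _ x, hx, hxS⟩, inter_subset_right.trans sdiff_subset,
      fun _ _ _ => smoothFormAt_zero _, ?_, ?_⟩
    · exact hasResidueOn_zero (chartAt_mem_smoothCharts x) inter_subset_left hμ.smooth hpos
        (fun x hx => hws x hx.2) hn
    · exact (hasResidueOn_zero (chartAt_mem_smoothCharts x) inter_subset_left hμ.smooth hpos
        (fun x hx => hdw.2 x hx.2) hn).congr (fun _ _ => rfl) fun _ _ _ => shiftedChartD_zero _ _

end LocalResidue

/-! ### Uniqueness of residues -/

section Integrable

variable {d : ℕ} {Z : Type*} [TopologicalSpace Z]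
  [ChartedSpace (EuclideanSpace ℝ (Fin d)) Z] [IsManifold (𝓡 d) ∞ Z] {κ : ℝ → ℝ}

theorem smoothFormAt_smul_of_tsupport {q : ℕ} {U : Set Z} {η : Z → Alt d q}
    (hη : ∀ x ∈ U, SmoothFormAt κ η x) {f : Z → ℂ} (hf : ∀ x ∈ U, ContMDiffAt (𝓡 d) 𝓘(ℝ, ℂ) ∞ f x)
    {K : Set Z} (hK : IsClosed K) (hKU : K ⊆ U) (h0 : ∀ x, x ∉ K → f x • η x = 0) (x : Z) :
    SmoothFormAt κ (fun x => f x • η x) x := by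
  by_cases hx : x ∈ K
  · exact (hη x (hKU hx)).smul (hf x (hKU hx))
  · refine (smoothFormAt_zero x).congr_of_eventuallyEq ?_
    filter_upwards [hK.isOpen_compl.mem_nhds hx] with y hy using h0 y hy

variable [T2Space Z] [SigmaCompactSpace Z]

/-- Smooth densities with compact support are integrable. -/
theorem densityIntegrable_of_smoothFormAt {q : ℕ} {τ : Z → Alt d q} (h : q = d) {K : Set Z}
    (hK : IsCompact K) (hτ0 : ∀ x, x ∉ K → τ x = 0) (hτ : ∀ x, SmoothFormAt Real.sign τ x) :
    DensityIntegrable τ h := by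
  intro x₀
  set c := chartAt (EuclideanSpace ℝ (Fin d)) x₀
  have hc : c ∈ smoothCharts d Z := chartAt_mem_smoothCharts _
  set A := K ∩ tsupport (chartPartition d Z x₀) with hA
  have hAc : IsCompact A := hK.inter_right (isClosed_tsupport _)
  have hAs : A ⊆ c.source := inter_subset_right.trans (chartPartition_isSubordinate x₀)
  have hcA : IsCompact (c '' A) := hAc.image_of_continuousOn (c.continuousOn.mono hAs)
  have hcAt : c '' A ⊆ c.target := by
    rintro _ ⟨x, hx, rfl⟩
    exact c.map_source (hAs hx)
  rw [extChartAt_target_eq]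
  have h1 : IntegrableOn (densityPiece τ h x₀) (c '' A) := by
    refine ContinuousOn.integrableOn_compact hcA fun z hz => ?_
    have hzt := hcAt hz
    have h2 : ContinuousAt (fun z => (chartPartition d Z x₀ (c.symm z) : ℂ) *
        chartRep Real.sign c τ z (fun j => EuclideanSpace.single (Fin.cast h j) (1 : ℝ))) z := by
      refine ContinuousAt.mul (Complex.continuous_ofReal.continuousAt.comp
        (ContinuousAt.comp (f := c.symm) (chartPartition d Z x₀).contMDiff.continuous.continuousAt
          (c.continuousAt_symm hzt))) ?_
      exact (altApplyCLM _).continuous.continuousAt.comp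
        ((hτ _).contDiffAt_symm isSignChar_sign hc hzt).continuousAt
    refine (h2.congr ?_).continuousWithinAt
    filter_upwards [c.open_target.mem_nhds hzt] with z' hz'
    exact (densityPiece_eq τ h x₀ hz').symm
  refine h1.of_forall_sdiff_eq_zero c.open_target.measurableSet fun z hz => ?_
  rw [densityPiece_eq τ h x₀ hz.1]
  have h3 : c.symm z ∉ A := fun hx => hz.2 ⟨_, hx, c.right_inv hz.1⟩
  by_cases hx : c.symm z ∈ K
  · have h4 : chartPartition d Z x₀ (c.symm z) = 0 := by
      by_contra hne
      exact h3 ⟨hx, subset_tsupport _ hne⟩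
    rw [h4, Complex.ofReal_zero, zero_mul]
  · rw [chartDensity_eq_zero h (hτ0 _ hx), mul_zero]

end Integrable

section Uniqueness

variable {n k m : ℕ} {X Y : Type*} [TopologicalSpace X]
  [ChartedSpace (EuclideanSpace ℝ (Fin n)) X] [IsManifold (𝓡 n) ∞ X] [TopologicalSpace Y]
  [ChartedSpace (EuclideanSpace ℝ (Fin k)) Y] [IsManifold (𝓡 k) ∞ Y]
  [T2Space X] [SigmaCompactSpace X] [T2Space Y] [SigmaCompactSpace Y]
  {o : ManifoldOrientation n X} {μ : X → ℝ} {i : Y → X} {p : ℕ} {O : Set X}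
  {w w' : X → Alt n p} {β β' : (q : {q : ℕ // q + m = p}) → Y → Alt k q} {hn : n = k + m}

theorem pullback_eq_zero {l : ℕ} {φ : X → Alt n l} {y : Y} (h : φ (i y) = 0) :
    pullback (k := k) i φ y = 0 := by
  rw [pullback, h]
  rfl

theorem densityIntegrable_wedge_pullback (hi : ContMDiff (𝓡 k) (𝓡 n) ∞ i)
    (hic : IsClosedEmbedding i) {q l : ℕ} (h : q + l = k) {β : Y → Alt k q}
    (hβ : ∀ y, i y ∈ O → SmoothFormAt Real.sign β y) {φ : X → Alt n l} {K : Set X}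
    (hφ : ∀ x, SmoothFormAt (fun _ => 1) φ x) (hK : IsCompact K) (hKO : K ⊆ O)
    (hφK : ∀ x, x ∉ K → φ x = 0) :
    DensityIntegrable (fun y => wedge (β y) (pullback i φ y)) h := by
  have h0 : ∀ y, y ∉ i ⁻¹' K → wedge (β y) (pullback (k := k) i φ y) = 0 := fun y hy => by
    rw [pullback_eq_zero (hφK _ hy), wedge_zero]
  refine densityIntegrable_of_smoothFormAt h (hic.isCompact_preimage hK) h0 fun y => ?_
  by_cases hy : i y ∈ K
  · exact (hβ y (hKO hy)).wedge isSignChar_sign (smoothFormAt_pullback hi (hφ _))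
  · refine (smoothFormAt_zero y).congr_of_eventuallyEq ?_
    filter_upwards [(hK.isClosed.isOpen_compl.preimage hi.continuous).mem_nhds hy] with y' hy'
    exact h0 y' hy'

theorem residuePairing_add_left (hi : ContMDiff (𝓡 k) (𝓡 n) ∞ i) (hic : IsClosedEmbedding i)
    {l : ℕ} (h : p + l = k + m) (hβ : ∀ q y, i y ∈ O → SmoothFormAt Real.sign (β q) y)
    (hβ' : ∀ q y, i y ∈ O → SmoothFormAt Real.sign (β' q) y) {φ : X → Alt n l} {K : Set X}
    (hφ : ∀ x, SmoothFormAt (fun _ => 1) φ x) (hK : IsCompact K) (hKO : K ⊆ O)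
    (hφK : ∀ x, x ∉ K → φ x = 0) :
    residuePairing i (fun q y => β q y + β' q y) φ h =
      residuePairing i β φ h + residuePairing i β' φ h := by
  rw [residuePairing, residuePairing, residuePairing]
  split_ifs with hp
  · simp only [add_wedge]
    exact (densityIntegral_add _ (hic.isCompact_preimage hK)
      (fun y hy => by rw [pullback_eq_zero (hφK _ hy), wedge_zero])
      (fun y hy => by rw [pullback_eq_zero (hφK _ hy), wedge_zero])
      (densityIntegrable_wedge_pullback hi hic _ (hβ _) hφ hK hKO hφK)
      (densityIntegrable_wedge_pullback hi hic _ (hβ' _) hφ hK hKO hφK)).2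
  · rw [add_zero]

theorem pullback_add {l : ℕ} (φ φ' : X → Alt n l) (y : Y) :
    pullback (k := k) i (φ + φ') y = pullback i φ y + pullback i φ' y := rfl

theorem residuePairing_add_right (hi : ContMDiff (𝓡 k) (𝓡 n) ∞ i) (hic : IsClosedEmbedding i)
    {l : ℕ} (h : p + l = k + m) (hβ : ∀ q y, i y ∈ O → SmoothFormAt Real.sign (β q) y)
    {φ φ' : X → Alt n l} {K : Set X} (hφ : ∀ x, SmoothFormAt (fun _ => 1) φ x)
    (hφ' : ∀ x, SmoothFormAt (fun _ => 1) φ' x) (hK : IsCompact K) (hKO : K ⊆ O)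
    (hφK : ∀ x, x ∉ K → φ x = 0) (hφK' : ∀ x, x ∉ K → φ' x = 0) :
    residuePairing i β (φ + φ') h = residuePairing i β φ h + residuePairing i β φ' h := by
  rw [residuePairing, residuePairing, residuePairing]
  split_ifs with hp
  · simp only [pullback_add, wedge_add]
    exact (densityIntegral_add _ (hic.isCompact_preimage hK)
      (fun y hy => by rw [pullback_eq_zero (hφK _ hy), wedge_zero])
      (fun y hy => by rw [pullback_eq_zero (hφK' _ hy), wedge_zero])
      (densityIntegrable_wedge_pullback hi hic _ (hβ _) hφ hK hKO hφK)
      (densityIntegrable_wedge_pullback hi hic _ (hβ _) hφ' hK hKO hφK')).2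
  · rw [add_zero]

theorem HasResidueOn.add (hi : ContMDiff (𝓡 k) (𝓡 n) ∞ i) (hic : IsClosedEmbedding i)
    (h : HasResidueOn o μ i hn O w β) (h' : HasResidueOn o μ i hn O w' β')
    (hβ : ∀ q y, i y ∈ O → SmoothFormAt Real.sign (β q) y)
    (hβ' : ∀ q y, i y ∈ O → SmoothFormAt Real.sign (β' q) y) :
    HasResidueOn o μ i hn O (fun x => w x + w' x) fun q y => β q y + β' q y := by
  intro l hl φ K hφ hK hKO hφK
  rw [residuePairing_add_left hi hic _ hβ hβ' hφ hK hKO hφK]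
  simp only [add_wedge]
  exact (h l hl φ K hφ hK hKO hφK).add hK (fun x hx => by rw [hφK x hx, wedge_zero])
    (fun x hx => by rw [hφK x hx, wedge_zero]) (h' l hl φ K hφ hK hKO hφK)

/-- Multiplication of a form by a function amounts to multiplication of the test forms. -/
theorem HasResidueOn.smul (h : HasResidueOn o μ i hn O w β) {f : X → ℂ}
    (hf : ∀ x ∈ O, ContMDiffAt (𝓡 n) 𝓘(ℝ, ℂ) ∞ f x) :
    HasResidueOn o μ i hn O (fun x => f x • w x) fun q y => f (i y) • β q y := by
  intro l hl φ K hφ hK hKO hφK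
  have h0 : ∀ x, x ∉ K → f x • φ x = 0 := fun x hx => by rw [hφK x hx, smul_zero]
  have h1 := h l hl (fun x => f x • φ x) K (smoothFormAt_smul_of_tsupport (fun x _ => hφ x) hf
    hK.isClosed hKO h0) hK hKO h0
  have h2 : ∀ y, pullback (k := k) i (fun x => f x • φ x) y = f (i y) • pullback i φ y :=
    fun y => rfl
  have h3 : residuePairing i β (fun x => f x • φ x) (hl.trans hn) =
      residuePairing i (fun q y => f (i y) • β q y) φ (hl.trans hn) := by
    rw [residuePairing, residuePairing]
    simp only [h2, wedge_smul, smul_wedge]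
  rw [← h3]
  simpa only [wedge_smul, smul_wedge] using h1

theorem alt_eq_zero_of_lt {d q : ℕ} (h : d < q) (a : Alt d q) : a = 0 := by
  refine ContinuousAlternatingMap.toAlternatingMap_injective ?_
  refine Module.Basis.ext_alternating (EuclideanSpace.basisFun (Fin d) ℝ).toBasis fun I hI => ?_
  have := Fintype.card_le_of_injective I hI
  simp at this
  omega

/-- The residue of the zero form vanishes: otherwise its wedge product with the pull-back of a
suitable test form with small support has an integral with nonzero real part. -/
theorem eq_zero_of_hasResidueOn_zero (hi : IsSmoothEmbedding (𝓡 k) (𝓡 n) ∞ i)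
    (hY : IsClosed (range i)) (hμ : IsMorseBott n μ (range i) m) (hO : IsOpen O)
    (h : HasResidueOn o μ i hn O (fun _ => (0 : Alt n p)) β)
    (hβ : ∀ q y, i y ∈ O → SmoothFormAt Real.sign (β q) y) (q : {q : ℕ // q + m = p}) {y₀ : Y}
    (hy₀ : i y₀ ∈ O) : β q y₀ = 0 := by
  have hic : IsClosedEmbedding i := ⟨hi.isEmbedding, hY⟩
  obtain ⟨q, hq⟩ := q
  rcases lt_or_ge k q with hkq | hkq
  · exact alt_eq_zero_of_lt hkq _
  obtain ⟨l, hql⟩ : ∃ l, q + l = k := ⟨k - q, by omega⟩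
  have hl : p + l = n := by omega
  obtain ⟨e, f, hM, hyf⟩ := exists_isMorseChart (by omega : m + k = n) hi hμ y₀
  set hmk : m + k = n := by omega
  have hfs : f.symm (f y₀) = y₀ := f.left_inv hyf
  by_contra hne
  set g := chartRep Real.sign f (β ⟨q, hq⟩) with hg
  have hg0 : g (f y₀) ≠ 0 := by
    intro h0
    refine hne ?_
    have h1 : chartRep Real.sign f (β ⟨q, hq⟩) (f y₀) =
        chartRep Real.sign f (fun _ => (0 : Alt k q)) (f y₀) := by
      rw [← hg, h0, chartRep]
      exact (smul_zero _).symm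
    have h2 := eq_of_chartRep_eq isSignChar_sign hM.mem_right (f.map_source hyf) h1
    rwa [hfs] at h2
  -- In a Morse chart, pair with a constant form `φ₀`, pulled back by the projection `π` to `ℝᵏ` and
  -- cut off by a bump function `χ`.
  obtain ⟨φ₀, hφ₀⟩ := exists_wedge_ne_zero hql hg0
  set std : Fin (q + l) → EuclideanSpace ℝ (Fin k) := fun j =>
    EuclideanSpace.single (Fin.cast hql j) (1 : ℝ) with hstd
  set c : EuclideanSpace ℝ (Fin k) → ℂ := fun b => wedge (g b) φ₀ std with hc
  have hcc : ∀ b ∈ f.target, i (f.symm b) ∈ O → ContinuousAt c b := by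
    intro b hb hbO
    have h1 := ((hβ ⟨q, hq⟩ _ hbO).contDiffAt_symm isSignChar_sign hM.mem_right hb)
    exact ((altApplyCLM std).contDiff.contDiffAt.comp b
      (contDiffAt_wedge h1 (contDiffAt_const (c := φ₀)))).continuousAt
  -- Rotated by the argument of `c` at the given point, `c` has positive real part there.
  set R : ℂ → ℝ := fun u => (starRingEnd ℂ (c (f y₀)) * u).re with hR
  have hRc : Continuous R := by fun_prop
  have hR0 : 0 < R (c (f y₀)) := by
    rw [hR]
    simp only [← Complex.normSq_eq_conj_mul_self, Complex.ofReal_re]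
    exact Complex.normSq_pos.2 hφ₀
  -- The support of the test form is so small that `R (c b)` remains positive.
  have hN : ∀ᶠ y in 𝓝 y₀, 0 < R (c (f y)) := by
    have h1 : ContinuousAt (fun y => R (c (f y))) y₀ := by
      refine hRc.continuousAt.comp (ContinuousAt.comp (f := f) (hcc _ (f.map_source hyf) ?_)
        (f.continuousAt hyf))
      rwa [hfs]
    exact h1.eventually (lt_mem_nhds hR0)
  rw [hi.isEmbedding.isInducing.nhds_eq_comap] at hN
  obtain ⟨G, hG, hGN⟩ := mem_comap.1 hN
  have hG' : G ∩ (O ∩ e.source) ∈ 𝓝 (i y₀) :=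
    inter_mem hG ((hO.inter e.open_source).mem_nhds ⟨hy₀, (hM.mem_iff y₀).2 hyf⟩)
  obtain ⟨χ, -, hχ⟩ := (SmoothBumpFunction.nhds_basis_tsupport (I := 𝓡 n) (i y₀)).mem_iff.1 hG'
  set π : EuclideanSpace ℝ (Fin n) →L[ℝ] EuclideanSpace ℝ (Fin k) :=
    (ContinuousLinearMap.snd ℝ _ _).comp (split hmk).toContinuousLinearMap with hπ
  have hπJ : π.comp (tangentIncl hmk) = ContinuousLinearMap.id ℝ _ := by
    refine ContinuousLinearMap.ext fun b => ?_
    change (split hmk (tangentIncl hmk b)).2 = b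
    rw [split_tangentIncl]
  set η : X → Alt n l := formOfChart (fun _ => 1) e fun _ => φ₀.compContinuousLinearMap π with hη
  set φ : X → Alt n l := fun x => (χ x : ℂ) • η x with hφ
  have hχ0 : ∀ x, x ∉ tsupport χ → χ x = 0 := fun x hx => image_eq_zero_of_notMem_tsupport hx
  have hφ0 : ∀ x, x ∉ tsupport χ → φ x = 0 := fun x hx => by
    rw [hφ]
    simp only [hχ0 x hx, Complex.ofReal_zero, zero_smul]
  have hφs : ∀ x, SmoothFormAt (fun _ => 1) φ x :=
    smoothFormAt_smul_of_tsupport (U := e.source)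
      (fun x hx => smoothFormAt_formOfChart isSignChar_one hM.mem_left hx contDiffAt_const)
      (fun x _ => Complex.ofRealCLM.contDiff.contMDiff.contMDiffAt.comp x χ.contMDiffAt)
      (isClosed_tsupport _) (fun x hx => (hχ hx).2.2) hφ0
  have hK : IsCompact (tsupport χ) := χ.hasCompactSupport
  have h1 := h l hl φ (tsupport χ) hφs hK (fun x hx => (hχ hx).2.1) hφ0
  have hpair : residuePairing i β φ (hl.trans hn) = 0 := by
    simp only [zero_wedge] at h1
    exact h1.unique (hasI0_zero o μ hl)
  have hK' : IsCompact (i ⁻¹' tsupport χ) := hic.isCompact_preimage hK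
  have hK'f : i ⁻¹' tsupport χ ⊆ f.source := fun y hy => (hM.mem_iff y).1 (hχ hy).2.2
  have hfK : IsCompact (f '' (i ⁻¹' tsupport χ)) :=
    hK'.image_of_continuousOn (f.continuousOn.mono hK'f)
  have hfKt : f '' (i ⁻¹' tsupport χ) ⊆ f.target := by
    rintro _ ⟨y, hy, rfl⟩
    exact f.map_source (hK'f hy)
  set F : EuclideanSpace ℝ (Fin k) → ℂ :=
    f.target.indicator fun b => (χ (i (f.symm b)) : ℂ) * c b with hF
  have hF0 : ∀ b, b ∉ f '' (i ⁻¹' tsupport χ) → F b = 0 := by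
    intro b hb
    by_cases hbt : b ∈ f.target
    · rw [hF, indicator_of_mem hbt, hχ0 _ fun hx => hb ⟨_, hx, f.right_inv hbt⟩]
      simp
    · rw [hF, indicator_of_notMem hbt]
  have hFc : Continuous F := by
    rw [continuous_iff_continuousAt]
    intro b
    by_cases hb : b ∈ f '' (i ⁻¹' tsupport χ)
    · have hbt := hfKt hb
      obtain ⟨y, hy, rfl⟩ := hb
      have hys : f.symm (f y) = y := f.left_inv (hK'f hy)
      have h2 : ContinuousAt (fun b => (χ (i (f.symm b)) : ℂ) * c b) (f y) := by
        refine ContinuousAt.mul ?_ (hcc _ hbt (by rw [hys]; exact (hχ hy).2.1))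
        exact Complex.continuous_ofReal.continuousAt.comp (ContinuousAt.comp (f := f.symm)
          (χ.continuous.comp hi.contMDiff.continuous).continuousAt (f.continuousAt_symm hbt))
      refine h2.congr ?_
      filter_upwards [f.open_target.mem_nhds hbt] with b' hb'
      rw [hF, indicator_of_mem hb']
    · refine (continuousAt_const (y := (0 : ℂ))).congr ?_
      filter_upwards [hfK.isClosed.isOpen_compl.mem_nhds hb] with b' hb'
      exact (hF0 b' hb').symm
  have hFs : HasCompactSupport F := HasCompactSupport.intro hfK hF0
  have hint : ∫ b, F b = 0 := by
    have hp : m ≤ p := by omega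
    have hpq : p - m = q := by omega
    subst hpq
    rw [residuePairing, dif_pos hp] at hpair
    have hden : ∀ b ∈ f.target, chartDensity f (fun y => wedge (β ⟨p - m, hq⟩ y)
        (pullback i φ y)) hql b = F b := by
      intro b hb
      have hJ := hM.tangentIncl_mem b hb
      rw [hF, indicator_of_mem hb, chartDensity, chartRep_wedge,
        chartRep_pullback hi.contMDiff φ hM.mem_left hM.mem_right hb hM.tangentIncl_mem, hφ,
        chartRep_smul, hη, chartRep_formOfChart isSignChar_one hM.mem_left _ hJ.1, hJ.2]
      have h2 : (((χ (i (f.symm b)) : ℂ)) • φ₀.compContinuousLinearMap π).compContinuousLinearMap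
          (tangentIncl hmk) = (χ (i (f.symm b)) : ℂ) •
            φ₀.compContinuousLinearMap (π.comp (tangentIncl hmk)) := rfl
      rw [h2, hπJ, wedge_smul]
      rfl
    have hi' : IntegrableOn (chartDensity f (fun y => wedge (β ⟨p - m, hq⟩ y)
        (pullback i φ y)) hql) f.target :=
      (hFc.integrable_of_hasCompactSupport hFs).integrableOn.congr_fun
        (fun b hb => (hden b hb).symm) f.open_target.measurableSet
    rw [(densityIntegral_eq_of_chart hql hM.mem_right hK' hK'f
      (fun y hy => by rw [pullback_eq_zero (hφ0 _ hy), wedge_zero]) hi').2,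
      setIntegral_congr_fun f.open_target.measurableSet hden,
      setIntegral_eq_integral_of_forall_compl_eq_zero] at hpair
    · exact hpair
    · intro b hb
      rw [hF, indicator_of_notMem hb]
  have hRF : ∫ b, R (F b) = 0 := by
    have h2 : ∫ b, starRingEnd ℂ (c (f y₀)) * F b = 0 := by
      rw [integral_const_mul, hint, mul_zero]
    have h3 := integral_re (𝕜 := ℂ) (μ := volume) (f := fun b => starRingEnd ℂ (c (f y₀)) * F b)
      ((hFc.integrable_of_hasCompactSupport hFs).const_mul _)
    rw [h2] at h3
    exact h3.trans (map_zero RCLike.re)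
  have hpos : 0 < ∫ b, R (F b) := by
    refine Continuous.integral_pos_of_hasCompactSupport_nonneg_nonzero (μ := volume)
      (f := fun b => R (F b)) (x := f y₀) (hRc.comp hFc) ?_ ?_ ?_
    · refine HasCompactSupport.intro hfK fun b hb => ?_
      rw [hF0 b hb, hR]
      simp
    · intro b
      by_cases hb : b ∈ f '' (i ⁻¹' tsupport χ)
      · have hbt := hfKt hb
        obtain ⟨y, hy, rfl⟩ := hb
        have h2 : 0 < R (c (f y)) := hGN (hχ hy).1
        change 0 ≤ R (F (f y))
        rw [hF, indicator_of_mem hbt, hR]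
        simp only [mul_left_comm _ ((χ _ : ℝ) : ℂ), Complex.re_ofReal_mul]
        exact mul_nonneg χ.nonneg h2.le
      · change 0 ≤ R (F b)
        rw [hF0 b hb, hR]
        simp
    · have h2 : F (f y₀) = c (f y₀) := by
        rw [hF, indicator_of_mem (f.map_source hyf), hfs, χ.eq_one]
        simp
      rw [h2]
      exact hR0.ne'
  exact hpos.ne' hRF

/-- The residue of a form is unique. -/
theorem HasResidueOn.unique (hi : IsSmoothEmbedding (𝓡 k) (𝓡 n) ∞ i)
    (hY : IsClosed (range i)) (hμ : IsMorseBott n μ (range i) m) (hO : IsOpen O)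
    (h : HasResidueOn o μ i hn O w β) (h' : HasResidueOn o μ i hn O w β')
    (hβ : ∀ q y, i y ∈ O → SmoothFormAt Real.sign (β q) y)
    (hβ' : ∀ q y, i y ∈ O → SmoothFormAt Real.sign (β' q) y) (q : {q : ℕ // q + m = p}) {y : Y}
    (hy : i y ∈ O) : β q y = β' q y := by
  have hic : IsClosedEmbedding i := ⟨hi.isEmbedding, hY⟩
  have hs : ∀ q y, i y ∈ O → SmoothFormAt Real.sign (fun y => (-1 : ℂ) • β' q y) y :=
    fun q y hy => (hβ' q y hy).const_smul (-1)
  have h1 := (h.add hi.contMDiff hic (h'.smul (f := fun _ => -1) fun x _ => contMDiffAt_const)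
    hβ hs).congr (w' := fun _ => (0 : Alt n p)) (fun x _ => by
      rw [neg_smul, one_smul, add_neg_cancel]) (fun _ _ _ => rfl)
  have h2 := eq_zero_of_hasResidueOn_zero hi hY hμ hO h1
    (fun q y hy => (hβ q y hy).add isSignChar_sign (hs q y hy)) q hy
  rw [neg_smul, one_smul, ← sub_eq_add_neg] at h2
  exact sub_eq_zero.1 h2

end Uniqueness

/-! ### Residues of tame forms on open sets -/

section Global

variable {n k m r : ℕ} {X Y : Type*} [TopologicalSpace X]
  [ChartedSpace (EuclideanSpace ℝ (Fin n)) X] [IsManifold (𝓡 n) ∞ X] [TopologicalSpace Y]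
  [ChartedSpace (EuclideanSpace ℝ (Fin k)) Y] [IsManifold (𝓡 k) ∞ Y]
  [T2Space X] [SigmaCompactSpace X] [T2Space Y] [SigmaCompactSpace Y]
  {o : ManifoldOrientation n X} {μ : X → ℝ} {i : Y → X} {p : ℕ} {U : Set X}

/-- The residue formula is local: a smooth partition of unity splits the test form. -/
theorem hasResidueOn_of_locally {w : X → Alt n p} {β : (q : {q : ℕ // q + m = p}) → Y → Alt k q}
    {hn : n = k + m} (hi : ContMDiff (𝓡 k) (𝓡 n) ∞ i) (hic : IsClosedEmbedding i)
    (hβ : ∀ q y, i y ∈ U → SmoothFormAt Real.sign (β q) y)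
    (h : ∀ x ∈ U, ∃ O, IsOpen O ∧ x ∈ O ∧ HasResidueOn o μ i hn O w β) :
    HasResidueOn o μ i hn U w β := by
  intro l hl φ K hφ hK hKU hφK
  choose O hO hxO hres using fun x : K => h x (hKU x.2)
  obtain ⟨ρ, hρ⟩ := SmoothPartitionOfUnity.exists_isSubordinate (𝓡 n) hK.isClosed O hO
    fun x hx => mem_iUnion.2 ⟨⟨x, hx⟩, hxO _⟩
  have hfin : {j | ∃ x ∈ K, ρ j x ≠ 0}.Finite := by
    refine (ρ.locallyFinite.finite_nonempty_inter_compact hK).subset ?_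
    rintro j ⟨x, hx, hj⟩
    exact ⟨x, hj, hx⟩
  set t := hfin.toFinset
  have hρs : ∀ j, ContMDiff (𝓡 n) 𝓘(ℝ, ℂ) ∞ fun x => (ρ j x : ℂ) := fun j =>
    Complex.ofRealCLM.contDiff.contMDiff.comp (ρ j).contMDiff
  have hj0 : ∀ j x, x ∉ K → (ρ j x : ℂ) • φ x = 0 := fun j x hx => by rw [hφK x hx, smul_zero]
  have hjs : ∀ j x, SmoothFormAt (fun _ => 1) (fun x => (ρ j x : ℂ) • φ x) x :=
    fun j x => (hφ x).smul (hρs j).contMDiffAt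
  have hsum : φ = fun x => ∑ j ∈ t, (ρ j x : ℂ) • φ x := by
    funext x
    by_cases hx : x ∈ K
    · rw [← Finset.sum_smul]
      have h1 : ∑ j ∈ t, ρ j x = 1 := by
        rw [← ρ.sum_eq_one hx]
        refine (finsum_eq_sum_of_support_subset _ fun j hj => ?_).symm
        exact hfin.mem_toFinset.2 ⟨x, hx, hj⟩
      rw [← Complex.ofReal_sum, h1, Complex.ofReal_one, one_smul]
    · rw [hφK x hx]
      simp
  classical
  -- The formula for all partial sums, by induction on the number of terms.
  have key : ∀ s : Finset K,
      (∀ x, SmoothFormAt (fun _ => 1) (fun x => ∑ j ∈ s, (ρ j x : ℂ) • φ x) x) ∧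
      (∀ x, x ∉ K → ∑ j ∈ s, (ρ j x : ℂ) • φ x = 0) ∧
      HasI0 o μ (fun x => wedge (w x) (∑ j ∈ s, (ρ j x : ℂ) • φ x)) hl
        (residuePairing i β (fun x => ∑ j ∈ s, (ρ j x : ℂ) • φ x) (hl.trans hn)) := by
    intro s
    induction s using Finset.induction_on with
    | empty =>
      simp only [Finset.sum_empty, wedge_zero]
      refine ⟨fun x => smoothFormAt_zero x, fun _ _ => trivial, ?_⟩
      have h1 : residuePairing i β (fun _ => (0 : Alt n l)) (hl.trans hn) = 0 := by
        rw [residuePairing]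
        split_ifs with hp
        · have h2 : ∀ y, pullback (k := k) i (fun _ : X => (0 : Alt n l)) y = 0 := fun y => rfl
          simp only [h2, wedge_zero]
          exact (densityIntegral_zero _).2
        · rfl
      rw [h1]
      exact hasI0_zero o μ hl
    | insert j s hj ih =>
      obtain ⟨ih1, ih2, ih3⟩ := ih
      have h1 := hres j l hl (fun x => (ρ j x : ℂ) • φ x) (K ∩ tsupport (ρ j)) (hjs j)
        (hK.inter_right (isClosed_tsupport _)) (inter_subset_right.trans (hρ j)) (by
          intro x hx
          by_cases hxK : x ∈ K
          · have h2 : ρ j x = 0 := by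
              by_contra hne
              exact hx ⟨hxK, subset_tsupport _ hne⟩
            rw [h2, Complex.ofReal_zero, zero_smul]
          · exact hj0 j x hxK)
      simp only [Finset.sum_insert hj, wedge_add]
      refine ⟨fun x => (hjs j x).add isSignChar_one (ih1 x), fun x hx => by
        rw [hj0 j x hx, ih2 x hx, add_zero], ?_⟩
      have h3 := residuePairing_add_right hi hic (hl.trans hn) hβ (hjs j) ih1 hK hKU (hj0 j) ih2
      have h4 := h1.add hK (fun x hx => by rw [hj0 j x hx, wedge_zero])
        (fun x hx => by rw [ih2 x hx, wedge_zero]) ih3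
      rw [← h3] at h4
      exact h4
  have h5 := (key t).2.2
  rw [hsum]
  exact h5

theorem shiftedSections_smoothFormAt {V : Set Y} (hV : IsOpen V) (β : ShiftedSections k V m p)
    (q : {q : ℕ // q + m = p}) {y : Y} (hy : y ∈ V) :
    SmoothFormAt Real.sign (β q : Y → Alt k q) y :=
  ((mem_twistedSections_iff hV).1 (β q).2).2 y hy

/-- A tame form on an open set has a residue. -/
theorem exists_residue (o : ManifoldOrientation n X) (hn : n = k + 2 * r)
    (hi : IsSmoothEmbedding (𝓡 k) (𝓡 n) ∞ i) (hY : IsClosed (range i))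
    (hμ : IsMorseBott n μ (range i) (2 * r)) (hU : IsOpen U) {w : X → Alt n p}
    (hw : w ∈ tameSections n μ (range i) r U p) :
    ∃ β : ShiftedSections k (i ⁻¹' U) (2 * r) p,
      HasResidueOn o μ i hn U w fun q => (β q : Y → Alt k q) := by
  have hic : IsClosedEmbedding i := ⟨hi.isEmbedding, hY⟩
  have hV : IsOpen (i ⁻¹' U) := hU.preimage hi.contMDiff.continuous
  choose O β hO hxO hOU hβ hres _ using fun x : U =>
    exists_hasResidueOn o hn hi hY hμ hU hw x.2
  classical
  -- Local residues agree where they are both defined, hence they glue.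
  set γ : (q : {q : ℕ // q + 2 * r = p}) → Y → Alt k q := fun q y =>
    if hy : i y ∈ U then β ⟨i y, hy⟩ q y else 0 with hγ
  have hγβ : ∀ (x : U) q y, i y ∈ O x → γ q y = β x q y := by
    intro x q y hy
    have hyU := hOU x hy
    rw [hγ]
    simp only [dif_pos hyU]
    exact ((hres ⟨i y, hyU⟩).mono inter_subset_left).unique hi hY hμ
      ((hO ⟨i y, hyU⟩).inter (hO x)) ((hres x).mono inter_subset_right)
      (fun q y hy => hβ _ q y hy.1) (fun q y hy => hβ _ q y hy.2) q ⟨hxO ⟨i y, hyU⟩, hy⟩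
  have hγs : ∀ q y, i y ∈ U → SmoothFormAt Real.sign (γ q) y := by
    intro q y hy
    refine (hβ ⟨i y, hy⟩ q y (hxO _)).congr_of_eventuallyEq ?_
    filter_upwards [((hO ⟨i y, hy⟩).preimage hi.contMDiff.continuous).mem_nhds (hxO ⟨i y, hy⟩)]
      with y' hy' using hγβ _ q y' hy'
  refine ⟨fun q => ⟨γ q, (mem_twistedSections_iff hV).2 ⟨fun y hy => dif_neg hy, hγs q⟩⟩, ?_⟩
  exact hasResidueOn_of_locally hi.contMDiff hic hγs fun x hx =>
    ⟨O ⟨x, hx⟩, hO _, hxO _, (hres _).congr (fun _ _ => rfl) fun q y hy => hγβ _ q y hy⟩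

theorem shiftedSections_eq_of_hasResidueOn {hn : n = k + m}
    (hi : IsSmoothEmbedding (𝓡 k) (𝓡 n) ∞ i) (hY : IsClosed (range i))
    (hμ : IsMorseBott n μ (range i) m) (hU : IsOpen U) {w : X → Alt n p}
    {β : ShiftedSections k (i ⁻¹' U) m p}
    {γ : (q : {q : ℕ // q + m = p}) → Y → Alt k q}
    (h : HasResidueOn o μ i hn U w fun q => (β q : Y → Alt k q))
    (hγ : HasResidueOn o μ i hn U w γ) (hγs : ∀ q y, i y ∈ U → SmoothFormAt Real.sign (γ q) y)
    (hγ0 : ∀ q y, i y ∉ U → γ q y = 0) (q : {q : ℕ // q + m = p}) :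
    (β q : Y → Alt k q) = γ q := by
  have hV : IsOpen (i ⁻¹' U) := hU.preimage hi.contMDiff.continuous
  funext y
  by_cases hy : i y ∈ U
  · exact h.unique hi hY hμ hU hγ (fun q y hy => shiftedSections_smoothFormAt hV β q hy) hγs q hy
  · rw [((mem_twistedSections_iff hV).1 (β q).2).1 y hy, hγ0 q y hy]

end Global

/-! ### The residue morphism -/

section Morphism

variable {n k r : ℕ} {X Y : Type*} [TopologicalSpace X]
  [ChartedSpace (EuclideanSpace ℝ (Fin n)) X] [IsManifold (𝓡 n) ∞ X] [TopologicalSpace Y]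
  [ChartedSpace (EuclideanSpace ℝ (Fin k)) Y] [IsManifold (𝓡 k) ∞ Y]
  [T2Space X] [SigmaCompactSpace X] [T2Space Y] [SigmaCompactSpace Y]
  {o : ManifoldOrientation n X} {μ : X → ℝ} {i : Y → X} {p : ℕ} {U : Set X}

/-- The residue of a tame form on an open set. -/
def residue (o : ManifoldOrientation n X) (hn : n = k + 2 * r)
    (hi : IsSmoothEmbedding (𝓡 k) (𝓡 n) ∞ i) (hY : IsClosed (range i))
    (hμ : IsMorseBott n μ (range i) (2 * r)) (hU : IsOpen U)
    (w : tameSections n μ (range i) r U p) : ShiftedSections k (i ⁻¹' U) (2 * r) p :=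
  Classical.choose (exists_residue o hn hi hY hμ hU w.2)

variable (o : ManifoldOrientation n X) (hn : n = k + 2 * r)
  (hi : IsSmoothEmbedding (𝓡 k) (𝓡 n) ∞ i) (hY : IsClosed (range i))
  (hμ : IsMorseBott n μ (range i) (2 * r)) (hU : IsOpen U) (w : tameSections n μ (range i) r U p)

theorem hasResidueOn_residue :
    HasResidueOn o μ i hn U w.1 fun q => (residue o hn hi hY hμ hU w q : Y → Alt k q) :=
  Classical.choose_spec (exists_residue o hn hi hY hμ hU w.2)

theorem smoothFormAt_residue (q : {q : ℕ // q + 2 * r = p}) (y : Y) (hy : i y ∈ U) :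
    SmoothFormAt Real.sign (residue o hn hi hY hμ hU w q : Y → Alt k q) y :=
  shiftedSections_smoothFormAt (hU.preimage hi.contMDiff.continuous) _ q hy

theorem residue_eq_zero (q : {q : ℕ // q + 2 * r = p}) (y : Y) (hy : i y ∉ U) :
    (residue o hn hi hY hμ hU w q : Y → Alt k q) y = 0 :=
  (residue o hn hi hY hμ hU w q).2.1 y hy

theorem residue_eq_of_hasResidueOn {w' : X → Alt n p} (hw' : w' ∈ tameSections n μ (range i) r U p)
    {γ : (q : {q : ℕ // q + 2 * r = p}) → Y → Alt k q} (hγ : HasResidueOn o μ i hn U w' γ)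
    (hγs : ∀ q y, i y ∈ U → SmoothFormAt Real.sign (γ q) y)
    (hγ0 : ∀ q y, i y ∉ U → γ q y = 0) (q : {q : ℕ // q + 2 * r = p}) :
    (residue o hn hi hY hμ hU ⟨w', hw'⟩ q : Y → Alt k q) = γ q :=
  shiftedSections_eq_of_hasResidueOn hi hY hμ hU (hasResidueOn_residue o hn hi hY hμ hU ⟨w', hw'⟩)
    hγ hγs hγ0 q

theorem residue_add (w' : tameSections n μ (range i) r U p) :
    residue o hn hi hY hμ hU (w + w') =
      residue o hn hi hY hμ hU w + residue o hn hi hY hμ hU w' := by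
  funext q
  refine Subtype.ext ?_
  refine residue_eq_of_hasResidueOn o hn hi hY hμ hU _
    ((hasResidueOn_residue o hn hi hY hμ hU w).add hi.contMDiff ⟨hi.isEmbedding, hY⟩
      (hasResidueOn_residue o hn hi hY hμ hU w') (smoothFormAt_residue o hn hi hY hμ hU w)
      (smoothFormAt_residue o hn hi hY hμ hU w')) (fun q y hy => ?_) (fun q y hy => ?_) q
  · exact (smoothFormAt_residue o hn hi hY hμ hU w q y hy).add isSignChar_sign
      (smoothFormAt_residue o hn hi hY hμ hU w' q y hy)
  · rw [residue_eq_zero o hn hi hY hμ hU w q y hy, residue_eq_zero o hn hi hY hμ hU w' q y hy,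
      add_zero]

theorem residue_indicator {V : Set X} (hV : IsOpen V) (h : V ⊆ U)
    (q : {q : ℕ // q + 2 * r = p}) :
    (residue o hn hi hY hμ hV ⟨V.indicator w.1, indicator_mem_tameSections h w.2⟩ q :
      Y → Alt k q) = (i ⁻¹' V).indicator (residue o hn hi hY hμ hU w q : Y → Alt k q) := by
  refine residue_eq_of_hasResidueOn o hn hi hY hμ hV _
    (γ := fun q => (i ⁻¹' V).indicator (residue o hn hi hY hμ hU w q : Y → Alt k q))
    (((hasResidueOn_residue o hn hi hY hμ hU w).mono h).congr
      (fun x hx => indicator_of_mem hx _) fun q y hy => indicator_of_mem (mem_preimage.2 hy) _)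
    (fun q y hy => ?_) (fun q y hy => indicator_of_notMem (mem_preimage.not.2 hy) _) q
  refine (smoothFormAt_residue o hn hi hY hμ hU w q y (h hy)).congr_of_eventuallyEq ?_
  filter_upwards [(hV.preimage hi.contMDiff.continuous).mem_nhds hy] with y' hy'
    using indicator_of_mem hy' _

theorem residue_smul {f : X → ℂ} (hf : ContMDiffOn (𝓡 n) 𝓘(ℝ, ℂ) ∞ f U)
    (q : {q : ℕ // q + 2 * r = p}) :
    (residue o hn hi hY hμ hU ⟨fun x => f x • w.1 x, smul_mem_tameSections hf w.2⟩ q :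
      Y → Alt k q) = fun y => f (i y) • (residue o hn hi hY hμ hU w q : Y → Alt k q) y := by
  have hf' : ∀ x ∈ U, ContMDiffAt (𝓡 n) 𝓘(ℝ, ℂ) ∞ f x := fun x hx =>
    hf.contMDiffAt (hU.mem_nhds hx)
  refine residue_eq_of_hasResidueOn o hn hi hY hμ hU _
    (γ := fun q y => f (i y) • (residue o hn hi hY hμ hU w q : Y → Alt k q) y)
    ((hasResidueOn_residue o hn hi hY hμ hU w).smul hf') (fun q y hy => ?_) (fun q y hy => ?_) q
  · have h1 : ContMDiffAt (𝓡 k) 𝓘(ℝ, ℂ) ∞ (fun y => f (i y)) y :=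
      ContMDiffAt.comp y (hf' _ hy) hi.contMDiff.contMDiffAt
    exact SmoothFormAt.smul h1 (smoothFormAt_residue o hn hi hY hμ hU w q y hy)
  · rw [residue_eq_zero o hn hi hY hμ hU w q y hy, smul_zero]

theorem residue_const_smul (c : ℂ) :
    residue o hn hi hY hμ hU (c • w) = c • residue o hn hi hY hμ hU w :=
  funext fun q => Subtype.ext
    (residue_smul o hn hi hY hμ hU w (f := fun _ => c) contMDiffOn_const q)

/-- The residue as a morphism of sheaves; its compatibilities follow from the uniqueness of
residues. -/
def residueMorphism : TameMorphism (n := n) (k := k) i μ r where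
  app _ U :=
    { toFun := residue o hn hi hY hμ U.isOpen
      map_add' := residue_add o hn hi hY hμ U.isOpen
      map_smul' := fun c w => residue_const_smul o hn hi hY hμ U.isOpen w c }
  app_restrict _ U V h w q := residue_indicator o hn hi hY hμ U.isOpen w V.isOpen h q
  app_smul _ U _ hf w q := residue_smul o hn hi hY hμ U.isOpen w hf q

theorem isResidue_residueMorphism : (residueMorphism o hn hi hY hμ).IsResidue o hn := by
  intro p l h w φ hφ hφc
  exact hasResidueOn_residue o hn hi hY hμ
    (⊤ : TopologicalSpace.Opens X).isOpen w l h φ (tsupport φ)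
    (fun x => ((mem_formSections_iff isOpen_univ).1 hφ).2 x (mem_univ x)) hφc (fun _ _ => trivial)
    fun x hx => image_eq_zero_of_notMem_tsupport hx

/-- The compatibility with the differential is local, and in a Morse chart it is the
compatibility of the normal contraction with the exterior derivative; the sign `(-1) ^ m` is `1`
since the codimension is even. -/
theorem isComplexMorphism_residueMorphism : (residueMorphism o hn hi hY hμ).IsComplexMorphism := by
  intro p U w
  refine ⟨dForm_mem_tameSections hn hi hY hμ U.isOpen w.2, fun q => ?_⟩
  funext y
  change (residue o hn hi hY hμ U.isOpen _ q : Y → Alt k q) y =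
    shiftedD (residue o hn hi hY hμ U.isOpen w) q y
  have key : ∀ (q : ℕ) (hq : q + 1 + 2 * r = p + 1),
      shiftedD (residue o hn hi hY hμ U.isOpen w) ⟨q + 1, hq⟩ y =
        (i ⁻¹' (U : Set X)).indicator
          (chartD Real.sign (residue o hn hi hY hμ U.isOpen w ⟨q, by omega⟩ : Y → Alt k q)) y := by
    intro q hq
    change ((-1 : ℂ) ^ (2 * r) • dTwisted (i ⁻¹' (U : Set X)) _) y = _
    rw [pow_mul, neg_one_sq, one_pow, one_smul, dTwisted_eq]
  by_cases hy : i y ∈ (U : Set X)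
  · obtain ⟨O, β, hO, hyO, hOU, hβ, hres, hdres⟩ :=
      exists_hasResidueOn o hn hi hY hμ U.isOpen w.2 hy
    have h1 : ∀ q y, i y ∈ O →
        (residue o hn hi hY hμ U.isOpen w q : Y → Alt k q) y = β q y := fun q y hy =>
      ((hasResidueOn_residue o hn hi hY hμ U.isOpen w).mono hOU).unique hi hY hμ hO hres
        (fun q y hy => smoothFormAt_residue o hn hi hY hμ U.isOpen w q y (hOU hy)) hβ q hy
    have hβ' : ∀ q y, i y ∈ O → SmoothFormAt Real.sign (shiftedChartD β q) y := by
      rintro ⟨q, hq⟩ y hy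
      cases q with
      | zero => exact smoothFormAt_zero y
      | succ q =>
        refine smoothFormAt_chartD isSignChar_sign ?_
        filter_upwards [(hO.preimage hi.contMDiff.continuous).mem_nhds hy] with y' hy'
          using hβ _ y' hy'
    have h2 := ((hasResidueOn_residue o hn hi hY hμ U.isOpen
      ⟨_, dForm_mem_tameSections hn hi hY hμ U.isOpen w.2⟩).mono hOU).unique hi hY hμ hO hdres
        (fun q y hy => smoothFormAt_residue o hn hi hY hμ U.isOpen _ q y (hOU hy)) hβ' q hyO
    rw [h2]
    obtain ⟨q, hq⟩ := q
    cases q with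
    | zero => rfl
    | succ q =>
      rw [key q hq, indicator_of_mem (mem_preimage.2 hy)]
      refine (chartD_congr ?_).symm
      filter_upwards [(hO.preimage hi.contMDiff.continuous).mem_nhds hyO] with y' hy'
        using h1 _ y' hy'
  · rw [residue_eq_zero o hn hi hY hμ U.isOpen _ q y hy]
    obtain ⟨q, hq⟩ := q
    cases q with
    | zero => rfl
    | succ q => rw [key q hq, indicator_of_notMem (mem_preimage.not.2 hy)]

end Morphism

/-! ### Uniqueness of the residue morphism -/

section Unique

variable {n k r : ℕ} {X Y : Type*} [TopologicalSpace X]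
  [ChartedSpace (EuclideanSpace ℝ (Fin n)) X] [IsManifold (𝓡 n) ∞ X] [TopologicalSpace Y]
  [ChartedSpace (EuclideanSpace ℝ (Fin k)) Y] [IsManifold (𝓡 k) ∞ Y]
  [T2Space X] [SigmaCompactSpace X] [T2Space Y] [SigmaCompactSpace Y]
  {o : ManifoldOrientation n X} {μ : X → ℝ} {i : Y → X} {p : ℕ}

/-- A smooth form on `U`, multiplied by a smooth function with support in `U`, extends smoothly
by zero. -/
theorem ExtendsSmoothly.smul_of_tsupport {q : ℕ} {U S : Set X} (hU : IsOpen U) {η : X → Alt n q}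
    (h : ExtendsSmoothly U S η) (hη : ∀ x, x ∉ U → η x = 0) {f : X → ℂ}
    (hf : ContMDiff (𝓡 n) 𝓘(ℝ, ℂ) ∞ f) (hfU : tsupport f ⊆ U) :
    ExtendsSmoothly univ S (fun x => f x • η x) := by
  obtain ⟨ψ, hψ, hψe⟩ := h
  rw [mem_formSections_iff hU] at hψ
  refine ⟨fun x => f x • ψ x, (mem_formSections_iff isOpen_univ).2
    ⟨fun x hx => (hx trivial).elim, fun x _ => ?_⟩, fun x hx => ?_⟩
  · exact smoothFormAt_smul_of_tsupport hψ.2 (fun x _ => hf.contMDiffAt) (isClosed_tsupport f) hfU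
      (fun x hx => by rw [image_eq_zero_of_notMem_tsupport hx, zero_smul]) x
  · change f x • ψ x = f x • η x
    by_cases hxU : x ∈ U
    · rw [hψe x ⟨hxU, hx.2⟩]
    · rw [hψ.1 x hxU, hη x hxU]

theorem smul_mem_tameSections_univ {U S : Set X} (hU : IsOpen U) (hS : IsClosed S) {w : X → Alt n p}
    (hw : w ∈ tameSections n μ S r U p) {f : X → ℂ}
    (hf : ContMDiff (𝓡 n) 𝓘(ℝ, ℂ) ∞ f) (hfU : tsupport f ⊆ U) :
    (fun x => f x • w x) ∈ tameSections n μ S r univ p := by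
  obtain ⟨h₁, h₂, h₃⟩ := hw
  have hw0 : ∀ x, x ∉ U → w x = 0 := fun x hx => h₁.1 x fun h => hx h.1
  refine ⟨(mem_formSections_iff (isOpen_univ.sdiff hS)).2 ⟨fun x hx => ?_, fun x hx => ?_⟩, ?_, ?_⟩
  · rw [h₁.1 x fun h => hx ⟨trivial, h.2⟩, smul_zero]
  · by_cases hxU : x ∈ tsupport f
    · exact (((mem_formSections_iff (hU.sdiff hS)).1 h₁).2 x ⟨hfU hxU, hx.2⟩).smul hf.contMDiffAt
    · refine (smoothFormAt_zero x).congr_of_eventuallyEq ?_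
      filter_upwards [(isClosed_tsupport f).isOpen_compl.mem_nhds hxU] with x' hx'
      rw [image_eq_zero_of_notMem_tsupport hx', zero_smul]
  · have := h₂.smul_of_tsupport hU (fun x hx => by rw [hw0 x hx, smul_zero]) hf hfU
    simpa only [smul_comm (f _)] using this
  · have := h₃.smul_of_tsupport hU (fun x hx => by rw [hw0 x hx, wedge_zero, smul_zero]) hf hfU
    simpa only [smul_comm (f _), wedge_smul] using this

/-- Every tame form on an open set is locally the restriction of a global one. -/
theorem exists_global_tameSection {U S : Set X} (hU : IsOpen U) (hS : IsClosed S) {w : X → Alt n p}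
    (hw : w ∈ tameSections n μ S r U p) {x : X} (hx : x ∈ U) :
    ∃ V ⊆ U, IsOpen V ∧ x ∈ V ∧ ∃ w' ∈ tameSections n μ S r univ p, ∀ x ∈ V, w' x = w x := by
  obtain ⟨f, -, hfU⟩ :=
    (SmoothBumpFunction.nhds_basis_tsupport (I := 𝓡 n) x).mem_iff.1 (hU.mem_nhds hx)
  obtain ⟨V, hV, hVo, hxV⟩ := mem_nhds_iff.1 f.eventuallyEq_one
  have hs : ContMDiff (𝓡 n) 𝓘(ℝ, ℂ) ∞ fun x => (f x : ℂ) :=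
    Complex.ofRealCLM.contDiff.contMDiff.comp f.contMDiff
  have hsU : tsupport (fun x => (f x : ℂ)) ⊆ U := by
    refine (closure_mono fun x hx => ?_).trans hfU
    exact fun h0 => hx (by simp [h0])
  refine ⟨V ∩ U, inter_subset_right, hVo.inter hU, ⟨hxV, hx⟩, _,
    smul_mem_tameSections_univ hU hS hw hs hsU, fun x hx => ?_⟩
  have h1 : f x = 1 := hV hx.1
  simp only [h1, Complex.ofReal_one, one_smul]

/-- A morphism is determined by its values on global tame forms. -/
theorem TameMorphism.eq_of_app_top (hY : IsClosed (range i))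
    {R R' : TameMorphism (n := n) (k := k) i μ r} (h : ∀ p w, R.app p ⊤ w = R'.app p ⊤ w) :
    R = R' := by
  refine TameMorphism.ext (funext fun p => funext fun U => LinearMap.ext fun w => funext fun q =>
    Subtype.ext (funext fun y => ?_))
  by_cases hy : i y ∈ (U : Set X)
  · obtain ⟨V, hVU, hV, hyV, w', hw', hww'⟩ := exists_global_tameSection U.isOpen hY w.2 hy
    have hR : ∀ R : TameMorphism (n := n) (k := k) i μ r, (R.app p U w q : Y → Alt k q) y =
        (R.app p ⊤ ⟨w', hw'⟩ q : Y → Alt k q) y := by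
      intro R
      have h1 := R.app_restrict p U ⟨V, hV⟩ hVU w q
      have h2 := R.app_restrict p ⊤ ⟨V, hV⟩ le_top ⟨w', hw'⟩ q
      have h3 : V.indicator w' = V.indicator w.1 := by
        funext x
        by_cases hx : x ∈ V
        · rw [indicator_of_mem hx, indicator_of_mem hx, hww' x hx]
        · rw [indicator_of_notMem hx, indicator_of_notMem hx]
      have h4 : (⟨V.indicator w', indicator_mem_tameSections (subset_univ V) hw'⟩ :
          tameSections n μ (range i) r V p) =
          ⟨V.indicator w.1, indicator_mem_tameSections hVU w.2⟩ := Subtype.ext h3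
      have h5 := congrFun (h1.symm.trans ((congrArg (fun v => (R.app p ⟨V, hV⟩ v q :
        Y → Alt k q)) h4.symm).trans h2)) y
      have hyV' : y ∈ i ⁻¹' V := hyV
      exact (indicator_of_mem hyV' _).symm.trans (h5.trans (indicator_of_mem hyV' _))
    rw [hR R, hR R', h]
  · rw [(R.app p U w q).2.1 y hy, (R'.app p U w q).2.1 y hy]

theorem TameMorphism.IsResidue.hasResidueOn_univ {R : TameMorphism (n := n) (k := k) i μ r}
    {hn : n = k + 2 * r} (hR : R.IsResidue o hn)
    (w : tameSections n μ (range i) r ((⊤ : TopologicalSpace.Opens X) : Set X) p) :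
    HasResidueOn o μ i hn univ w.1 fun q => (R.app p ⊤ w q : Y → Alt k q) := by
  intro l hl φ K hφ hK _ hφK
  exact hR p l hl w φ ((mem_formSections_iff isOpen_univ).2
    ⟨fun x hx => (hx trivial).elim, fun x _ => hφ x⟩)
    (HasCompactSupport.intro hK fun x hx => hφK x hx)

/-- A morphism that satisfies the residue formula is unique: the formula determines its values on
global tame forms, and these determine the morphism. -/
theorem TameMorphism.IsResidue.eq (hi : IsSmoothEmbedding (𝓡 k) (𝓡 n) ∞ i)
    (hY : IsClosed (range i))
    (hμ : IsMorseBott n μ (range i) (2 * r)) {R R' : TameMorphism (n := n) (k := k) i μ r}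
    {hn : n = k + 2 * r} (hR : R.IsResidue o hn) (hR' : R'.IsResidue o hn) : R = R' := by
  have hs : ∀ (R : TameMorphism (n := n) (k := k) i μ r) p w (q : {q : ℕ // q + 2 * r = p}) y,
      SmoothFormAt Real.sign (R.app p ⊤ w q : Y → Alt k q) y := fun R p w q y =>
    shiftedSections_smoothFormAt isOpen_univ (R.app p ⊤ w) q (mem_univ y)
  refine TameMorphism.eq_of_app_top hY fun p w => funext fun q =>
    Subtype.ext (funext fun y => ?_)
  exact (hR.hasResidueOn_univ w).unique hi hY hμ isOpen_univ (hR'.hasResidueOn_univ w)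
    (fun q y _ => hs R p w q y) (fun q y _ => hs R' p w q y) q (mem_univ _)

end Unique

end TameResidue

end

theorem mainTheorem2 {n k r : ℕ} (hn : n = k + 2 * r)
    {X : Type*} [TopologicalSpace X] [T2Space X] [SigmaCompactSpace X]
    [ChartedSpace (EuclideanSpace ℝ (Fin n)) X] [IsManifold (𝓡 n) ∞ X]
    {Y : Type*} [TopologicalSpace Y] [T2Space Y] [SigmaCompactSpace Y]
    [ChartedSpace (EuclideanSpace ℝ (Fin k)) Y] [IsManifold (𝓡 k) ∞ Y]
    (o : TameResidue.ManifoldOrientation n X)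
    (i : Y → X) (hi : IsSmoothEmbedding (𝓡 k) (𝓡 n) ∞ i) (hY : IsClosed (range i))
    (μ : X → ℝ) (hμ : TameResidue.IsMorseBott n μ (range i) (2 * r)) :
    (∃! R : TameResidue.TameMorphism (n := n) (k := k) i μ r, R.IsResidue o hn) ∧
      ∀ R : TameResidue.TameMorphism (n := n) (k := k) i μ r,
        R.IsResidue o hn → R.IsComplexMorphism := by
  have hR := TameResidue.isResidue_residueMorphism o hn hi hY hμ
  refine ⟨⟨_, hR, fun R' hR' => hR'.eq hi hY hμ hR⟩, fun R hR' => ?_⟩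
  rw [hR'.eq hi hY hμ hR]
  exact TameResidue.isComplexMorphism_residueMorphism o hn hi hY hμ
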